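/- **Setting.** Seller types $\theta\in[\underline\theta,\overline\theta]$ have a probability law with continuous c.d.f. $F$ and support $[\underline\theta,\overline\theta]$. A seller of type $\theta$ produces quality $q\ge 0$ at cost $C(q,\theta)$, where $C$ is twice continuously differentiable on $[0,\infty)\times[\underline\theta,\overline\theta]$, $C_q\ge0$, $C_\theta\le0$, $C_{qq}\ge0$, $C_{q\theta}\le0$, $C(0,\theta)=0$ and $C_q(0,\theta)=0$. For each $\theta$ the first-best quality $q^{FB}(\theta)$ is the unique $q\ge0$ with $C_q(q,\theta)=1$. A *rating system* is a signal space $S$ with a Markov kernel $\pi(ds\mid q)$ from qualities to signals; if type $\theta$ chooses quality $q(\theta)$, it *implements* the signaled qualities $\overline q(\theta)=\int_S\mathbb E[q\mid s]\,\pi(ds\mid q(\theta))$. The welfare weights $\lambda\ge0$ satisfy $\int\lambda\,dF=1$ and are *hump-shaped* with peak $\theta^*\in(\underline\theta,\overline\theta)$: $\lambda$ is strictly increasing on $[\underline\theta,\theta^*]$ and strictly decreasing on $[\theta^*,\overline\theta]$. A pair $(q,\overline q)$ with $q\ge 0$ is *optimal* if, with $\Pi(\theta)=\overline q(\theta)-C(q(\theta),\theta)$,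 it maximizes $\int\lambda\,\Pi\,dF$ subject to: $q$ and $\overline q$ are nondecreasing; $\Pi(\theta)\ge \overline q(\theta')-C(q(\theta'),\theta)$ for all $\theta,\theta'$ (incentive compatibility); $\Pi\ge0$ (participation); and majorization, $\int_{\underline\theta}^{\theta}(\overline q-q)\,dF\ge0$ for all $\theta$, with equality at $\theta=\overline\theta$. **Proposition.** Suppose $\lambda$ is hump-shaped with peak $\theta^*$ and $(q,\overline q)$ is optimal. Then there are thresholds $\underline\theta\le\hat\theta\le\tilde\theta<\theta^*$ such that 1. $q(\theta)=q^{FB}(\theta)$ for all $\theta\in(\underline\theta,\hat\theta]$; 2. $q(\theta)=q^{FB}(\hat\theta)$ for all $\theta\in[\hat\theta,\tilde\theta)$, $\theta\ne\underline\theta$; 3. there is a rating system that implements $\overline q(\theta)$ for every $\theta\in(\underline\theta,\overline\theta)$, that reveals the quality $q(\theta)$ with certainty for every $\theta\in(\underline\theta,\tilde\theta)$, and that is full mixing above $\tilde\theta$: for every $\theta\in(\tilde\theta,\overline\theta)$ it reveals the quality $q(\theta)$ with some probability $\alpha(q(\theta))\in[0,1]$ and otherwise sends one generic signal, common to all these qualities.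 If moreover $C$ is strictly submodular, i.e. $C_{q\theta}(q,\theta)<0$ for all $q>0$ and all $\theta$, then these can be chosen so that for all $\theta\in(\tilde\theta,\overline\theta)$ majorization is slack, $\int_{\underline\theta}^{\theta}(\overline q-q)\,dF>0$, and the generic signal is sent with positive probability, $\alpha(q(\theta))<1$. -/

import Mathlib

open MeasureTheory ProbabilityTheory Set

noncomputable section

/-- `C_q`: derivative of the cost `C q θ` in the quality `q`, on qualities `q ≥ 0`. -/
def costQ (C : ℝ → ℝ → ℝ) (x t : ℝ) : ℝ :=
  derivWithin (fun y => C y t) (Ici 0) x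

/-- `C_θ`: derivative of the cost in the type `θ`, on the type interval `[a, b]`. -/
def costT (a b : ℝ) (C : ℝ → ℝ → ℝ) (x t : ℝ) : ℝ :=
  derivWithin (fun s => C x s) (Icc a b) t

/-- `C_qq`. -/
def costQQ (C : ℝ → ℝ → ℝ) (x t : ℝ) : ℝ :=
  derivWithin (fun y => costQ C y t) (Ici 0) x

/-- `C_qθ`. -/
def costQT (a b : ℝ) (C : ℝ → ℝ → ℝ) (x t : ℝ) : ℝ :=
  derivWithin (fun s => costQ C x s) (Icc a b) t

/-- The standing assumptions on the cost of producing quality `x ≥ 0` by type `t ∈ [a, b]`. -/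
structure IsCost (a b : ℝ) (C : ℝ → ℝ → ℝ) : Prop where
  smooth : ContDiffOn ℝ 2 (fun z : ℝ × ℝ => C z.1 z.2) (Ici 0 ×ˢ Icc a b)
  costQ_nonneg : ∀ x, 0 ≤ x → ∀ t ∈ Icc a b, 0 ≤ costQ C x t
  costT_nonpos : ∀ x, 0 ≤ x → ∀ t ∈ Icc a b, costT a b C x t ≤ 0
  costQQ_nonneg : ∀ x, 0 ≤ x → ∀ t ∈ Icc a b, 0 ≤ costQQ C x t
  costQT_nonpos : ∀ x, 0 ≤ x → ∀ t ∈ Icc a b, costQT a b C x t ≤ 0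
  zero : ∀ t ∈ Icc a b, C 0 t = 0
  costQ_zero : ∀ t ∈ Icc a b, costQ C 0 t = 0

/-- Strict submodularity (at positive qualities; `C_qθ(0, θ) = 0` because `C_q(0, θ) = 0`). -/
def StrictlySubmodular (a b : ℝ) (C : ℝ → ℝ → ℝ) : Prop :=
  ∀ x, 0 < x → ∀ t ∈ Icc a b, costQT a b C x t < 0

/-- `qFB` is the first-best quality: `qFB t` is the unique `x ≥ 0` with `C_q(x, t) = 1`. -/
def IsFirstBest (a b : ℝ) (C : ℝ → ℝ → ℝ) (qFB : ℝ → ℝ) : Prop :=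
  ∀ t ∈ Icc a b, 0 ≤ qFB t ∧ costQ C (qFB t) t = 1 ∧ ∀ x, 0 ≤ x → costQ C x t = 1 → x = qFB t

/-- The law `F` of types: a probability measure with continuous distribution function
and support `[a, b]`. -/
structure IsTypeLaw (a b : ℝ) (F : Measure ℝ) : Prop where
  isProbabilityMeasure : IsProbabilityMeasure F
  continuous_cdf : Continuous (cdf F)
  support_eq : F.support = Icc a b

/-- Hump-shaped welfare weights with peak `p`, nonnegative and normalised to mean one. -/
structure IsHumpShaped (a b : ℝ) (F : Measure ℝ) (w : ℝ → ℝ) (p : ℝ) : Prop where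
  peak_mem : p ∈ Ioo a b
  nonneg : ∀ t ∈ Icc a b, 0 ≤ w t
  increasing : StrictMonoOn w (Icc a p)
  decreasing : StrictAntiOn w (Icc p b)
  mean_one : ∫ t, w t ∂F = 1

/-- `Π(θ) = q̄(θ) - C(q(θ), θ)`. -/
def profit (C : ℝ → ℝ → ℝ) (q qbar : ℝ → ℝ) (t : ℝ) : ℝ :=
  qbar t - C (q t) t

/-- `∫_a^t (q̄ - q) dF`: the slack at `t` in the majorization inequality. -/
def majSlack (a : ℝ) (F : Measure ℝ) (q qbar : ℝ → ℝ) (t : ℝ) : ℝ :=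
  ∫ s in Icc a t, (qbar s - q s) ∂F

/-- `q ≽_F q̄`. -/
def Majorizes (a b : ℝ) (F : Measure ℝ) (q qbar : ℝ → ℝ) : Prop :=
  (∀ t ∈ Icc a b, 0 ≤ majSlack a F q qbar t) ∧ majSlack a F q qbar b = 0

/-- The constraints of the rating design problem on qualities `q` and signaled qualities `q̄`. -/
structure IsFeasible (a b : ℝ) (C : ℝ → ℝ → ℝ) (F : Measure ℝ) (q qbar : ℝ → ℝ) : Prop where
  nonneg : ∀ t ∈ Icc a b, 0 ≤ q t
  mono_q : MonotoneOn q (Icc a b)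
  mono_qbar : MonotoneOn qbar (Icc a b)
  incentive : ∀ t ∈ Icc a b, ∀ s ∈ Icc a b, qbar s - C (q s) t ≤ profit C q qbar t
  participation : ∀ t ∈ Icc a b, 0 ≤ profit C q qbar t
  majorizes : Majorizes a b F q qbar

/-- The weighted sum of the sellers' profits, `∫ λ Π dF`. -/
def welfare (C : ℝ → ℝ → ℝ) (F : Measure ℝ) (w q qbar : ℝ → ℝ) : ℝ :=
  ∫ t, w t * profit C q qbar t ∂F

/-- `(q, q̄)` solves the Pareto-optimal rating design problem with welfare weights `w`. -/
def IsOptimal (a b : ℝ) (C : ℝ → ℝ → ℝ) (F : Measure ℝ) (w q qbar : ℝ → ℝ) : Prop :=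
  IsFeasible a b C F q qbar ∧
    ∀ q' qbar' : ℝ → ℝ, IsFeasible a b C F q' qbar' →
      welfare C F w q' qbar' ≤ welfare C F w q qbar

/-- A rating system with signal space `S` is a Markov kernel `π` from qualities to signals.
`IsPrice F q π P` says that `P s = 𝔼[q | s]`: under the joint law of quality and signal, when
types have law `F` and type `t` chooses quality `q t`, the function `P` of the signal is a version
of the conditional expectation of quality given the signal. -/
def IsPrice {S : Type*} [MeasurableSpace S] (F : Measure ℝ) (q : ℝ → ℝ) (π : Kernel ℝ S)
    (P : S → ℝ) : Prop :=
  Measurable P ∧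
    (fun z : ℝ × S => P z.2) =ᵐ[(F.map q) ⊗ₘ π]
      ((F.map q) ⊗ₘ π)[fun z : ℝ × S => z.1 |
        MeasurableSpace.comap Prod.snd (inferInstance : MeasurableSpace S)]

/-- The rating system `π` generates the signaled qualities `q̄(t) = ∫ 𝔼[q | s] π(ds | q(t))`
(for all types other than the two extreme ones, which have probability zero). -/
def Implements {S : Type*} [MeasurableSpace S] (a b : ℝ) (F : Measure ℝ) (q qbar : ℝ → ℝ)
    (π : Kernel ℝ S) : Prop :=
  ∃ P : S → ℝ, IsPrice F q π P ∧ ∀ t ∈ Ioo a b, qbar t = ∫ s, P s ∂(π (q t))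

/-- Signals: either a quality is announced (`Sum.inl`), or the generic signal `Sum.inr ()`
is sent. -/
abbrev Signal : Type := ℝ ⊕ Unit

/-- Quality `x` is announced with probability `r`; otherwise the generic signal is sent. -/
def mixSignal (r x : ℝ) : Measure Signal :=
  ENNReal.ofReal r • Measure.dirac (Sum.inl x) +
    ENNReal.ofReal (1 - r) • Measure.dirac (Sum.inr ())

end

/-! ### Technologies, the envelope formula, and monotonicity of price minus quality -/

namespace RatingDesign
open Filter Topology

/-! Call price minus quality the excess. Majorization says that the primitive of the excess is
nonnegative and vanishes at the top. By the envelope formula (`envelope`, `incentive_of_envelope`),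
a feasible pair amounts to a monotone quality `q` with profits that grow at the rate `h (q z) z`.
Everything else compares an optimal plan with explicit deviations.

The main deviation (`candidate`) is first best up to a type `t`, and above `t` it is the median of
`q`, the first best and a level `x`. The median moves quality towards the first best, so it adds
surplus. Since weights are hump-shaped, the mean weight of an upper tail, compared with the mean
above `t`, crosses from above to below at a single type `τ`. If `x` separates the qualities below
`τ` from those above, the median raises rents exactly where this favours heavily weighted types and
lowers them elsewhere. A connectedness argument (`exists_candidate`) finds `t`, `τ` and `x` for
which the deviation is feasible. `welfare_sub` splits its welfare gain into terms that are all
nonnegative here, so optimality makes them vanish (`comparison`). Hence `q` has the shape of the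
deviation (`exists_pattern`): first best and priced at quality below `t`, between `min f x` and `x`
up to `τ`, and between `x` and `max f x` afterwards.

A schedule of this shape has nonnegative excess before `τ` and decreasing excess after it, so the
excess, once negative, stays negative (`single_crossing`). Therefore one pooling price separates the
types paid more than their quality from those paid less, and every price is a mixture of quality and
the pooling price (`exists_rating`). Without strict submodularity this suffices: both thresholds are
set to `a`, and the claims about lower types are vacuous.

Under strict submodularity both thresholds are the type `s` at which the initial stretch of zero
excess ends (`exists_split`). A second family of deviations shrinks qualities above a level `y`
towards `y`. Where quality exceeds the first best this saves rents at first order, while the loss of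
surplus is of second order (`lowering`), or surplus even rises at first order (`lowering_jump`).
`not_lowerable` shows that an optimal plan admits no such gain. It follows that majorization is
slack somewhere, that `s` lies below the peak, that `q s` is first best, and that all types above
`s` with zero excess share one quality. That quality can serve as the pooling price and be announced
with probability zero. -/

/-- The properties of a cost function `c` that are used below: `h` is the marginal rent `-c_θ`, and
`f` is the first-best quality. Both arguments range over all reals. -/
structure Technology (a b : ℝ) (c h : ℝ → ℝ → ℝ) (f : ℝ → ℝ) : Prop where
  lt : a < b
  cont_c : Continuous fun z : ℝ × ℝ => c z.1 z.2
  cont_h : Continuous fun z : ℝ × ℝ => h z.1 z.2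
  c_zero : ∀ u, c 0 u = 0
  c_mono : ∀ u x y, 0 ≤ x → x ≤ y → c x u ≤ c y u
  c_lip : ∀ M, ∃ K, 0 ≤ K ∧ ∀ u x y, 0 ≤ x → x ≤ y → y ≤ M → c y u - c x u ≤ K * (y - x)
  c_convex : ∀ u x y r, 0 ≤ x → 0 ≤ y → 0 ≤ r → r ≤ 1 →
    c ((1 - r) * x + r * y) u ≤ (1 - r) * c x u + r * c y u
  h_nonneg : ∀ u x, 0 ≤ x → 0 ≤ h x u
  h_mono : ∀ u x y, 0 ≤ x → x ≤ y → h x u ≤ h y u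
  h_lip : ∀ M, ∃ K, 0 ≤ K ∧ ∀ u x y, 0 ≤ x → x ≤ y → y ≤ M → h y u - h x u ≤ K * (y - x)
  ftc : ∀ x, 0 ≤ x → ∀ u ∈ Icc a b, ∀ v ∈ Icc a b, c x u - c x v = ∫ z in u..v, h x z
  f_cont : Continuous f
  f_mono : Monotone f
  f_pos : ∀ u, 0 < f u
  s_lt_left : ∀ u x y, 0 ≤ x → x < y → y ≤ f u → x - c x u < y - c y u
  s_lt_right : ∀ u x y, f u ≤ x → x < y → y - c y u < x - c x u
  s_quad : ∀ M, ∃ L, 0 ≤ L ∧ ∀ u y, 0 ≤ y → y ≤ M →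
    f u - c (f u) u - L * (y - f u) ^ 2 ≤ y - c y u

/-- The surplus from quality `y` of type `u`. -/
def surplus (c : ℝ → ℝ → ℝ) (y u : ℝ) : ℝ := y - c y u

lemma intervalIntegrable_comp {k : ℝ × ℝ → ℝ} (hk : Continuous k) {q : ℝ → ℝ} (hq : Monotone q)
    (μ : Measure ℝ) [IsLocallyFiniteMeasure μ] (u v : ℝ) :
    IntervalIntegrable (fun z => k (q z, z)) μ u v := by
  have hm : Measurable fun z => k (q z, z) :=
    hk.measurable.comp (hq.measurable.prodMk measurable_id)
  obtain ⟨B, hB⟩ := ((isCompact_Icc (a := q (min u v)) (b := q (max u v))).prod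
    (isCompact_Icc (a := min u v) (b := max u v))).exists_bound_of_continuousOn hk.continuousOn
  rw [intervalIntegrable_iff]
  refine Measure.integrableOn_of_bounded (M := B) ?_ hm.aestronglyMeasurable ?_
  · exact (measure_mono uIoc_subset_uIcc).trans_lt isCompact_uIcc.measure_lt_top |>.ne
  · refine (ae_restrict_iff' measurableSet_uIoc).2 (Eventually.of_forall fun z hz => hB _ ?_)
    have : z ∈ Icc (min u v) (max u v) := uIoc_subset_uIcc hz
    exact ⟨⟨hq this.1, hq this.2⟩, this⟩

lemma exists_bound_comp {k : ℝ × ℝ → ℝ} (hk : Continuous k) {q : ℝ → ℝ} (hq : Monotone q)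
    (u v : ℝ) : ∃ B, ∀ z ∈ Icc u v, |k (q z, z)| ≤ B := by
  obtain ⟨B, hB⟩ := ((isCompact_Icc (a := q u) (b := q v)).prod
    (isCompact_Icc (a := u) (b := v))).exists_bound_of_continuousOn hk.continuousOn
  exact ⟨B, fun z hz => hB _ ⟨⟨hq hz.1, hq hz.2⟩, hz⟩⟩

/-- A function whose increments are dominated by products of increments is constant. -/
lemma eq_of_abs_sub_le_mul {E g : ℝ → ℝ} {u v : ℝ} (huv : u ≤ v)
    (h : ∀ x ∈ Icc u v, ∀ y ∈ Icc u v, x ≤ y → |E y - E x| ≤ (g y - g x) * (y - x)) :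
    E v = E u := by
  -- Over `n + 1` equal steps the increments of `g` telescope, while each factor `y - x` equals `(v
  -- - u) / (n + 1)`; the bound tends to zero.
  have key : ∀ n : ℕ, |E v - E u| ≤ (g v - g u) * (v - u) * (1 / ((n : ℝ) + 1)) := by
    intro n
    set x : ℕ → ℝ := fun i => u + (v - u) * (i / ((n : ℝ) + 1)) with hx
    have hn : (0 : ℝ) < (n : ℝ) + 1 := by positivity
    have hmem : ∀ i, i ≤ n + 1 → x i ∈ Icc u v := by
      intro i hi
      have h1 : (i : ℝ) / ((n : ℝ) + 1) ≤ 1 := by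
        rw [div_le_one hn]; exact_mod_cast hi
      have h0 : (0 : ℝ) ≤ (i : ℝ) / ((n : ℝ) + 1) := by positivity
      constructor
      · simp only [hx]; nlinarith
      · simp only [hx]; nlinarith
    have hstep : ∀ i, x (i + 1) - x i = (v - u) * (1 / ((n : ℝ) + 1)) := by
      intro i; simp only [hx]; push_cast; field_simp; ring
    have h0 : x 0 = u := by simp [hx]
    have h1 : x (n + 1) = v := by simp only [hx]; push_cast; field_simp; ring
    have hE := Finset.sum_range_sub (fun i => E (x i)) (n + 1)
    have hg := Finset.sum_range_sub (fun i => g (x i)) (n + 1)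
    rw [h0, h1] at hE hg
    rw [← hE]
    calc |∑ i ∈ Finset.range (n + 1), (E (x (i + 1)) - E (x i))|
        ≤ ∑ i ∈ Finset.range (n + 1), |E (x (i + 1)) - E (x i)| := Finset.abs_sum_le_sum_abs _ _
      _ ≤ ∑ i ∈ Finset.range (n + 1),
          (g (x (i + 1)) - g (x i)) * ((v - u) * (1 / ((n : ℝ) + 1))) := by
          refine Finset.sum_le_sum fun i hi => ?_
          have hi' : i + 1 ≤ n + 1 := by simpa using Finset.mem_range.1 hi
          rw [← hstep i]
          refine h _ (hmem i (by omega)) _ (hmem (i + 1) hi') ?_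
          have := hstep i
          have : 0 ≤ (v - u) * (1 / ((n : ℝ) + 1)) :=
            mul_nonneg (by linarith) (by positivity)
          linarith
      _ = (g v - g u) * (v - u) * (1 / ((n : ℝ) + 1)) := by
          rw [← Finset.sum_mul, hg]; ring
  have hlim : Tendsto (fun n : ℕ => (g v - g u) * (v - u) * (1 / ((n : ℝ) + 1))) atTop (𝓝 0) := by
    simpa using tendsto_one_div_add_atTop_nhds_zero_nat.const_mul ((g v - g u) * (v - u))
  have := ge_of_tendsto' hlim key
  have := abs_nonpos_iff.1 this
  linarith

namespace Technology

variable {a b : ℝ} {c h : ℝ → ℝ → ℝ} {f : ℝ → ℝ}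

lemma surplus_cont (T : Technology a b c h f) :
    Continuous fun z : ℝ × ℝ => surplus c z.1 z.2 := continuous_fst.sub T.cont_c

lemma rent_integrable (T : Technology a b c h f) {q : ℝ → ℝ} (hq : Monotone q) (u v : ℝ) :
    IntervalIntegrable (fun z => h (q z) z) volume u v :=
  intervalIntegrable_comp T.cont_h hq volume u v

lemma surplus_integrable (T : Technology a b c h f) {q : ℝ → ℝ} (hq : Monotone q)
    (F : Measure ℝ) [IsLocallyFiniteMeasure F] (u v : ℝ) :
    IntervalIntegrable (fun z => surplus c (q z) z) F u v :=
  intervalIntegrable_comp T.surplus_cont hq F u v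

lemma surplus_le_left (T : Technology a b c h f) {u x y : ℝ} (hx : 0 ≤ x) (hxy : x ≤ y)
    (hy : y ≤ f u) : surplus c x u ≤ surplus c y u := by
  rcases hxy.eq_or_lt with rfl | hlt
  · exact le_rfl
  · exact (T.s_lt_left u x y hx hlt hy).le

lemma surplus_le_right (T : Technology a b c h f) {u x y : ℝ} (hx : f u ≤ x) (hxy : x ≤ y) :
    surplus c y u ≤ surplus c x u := by
  rcases hxy.eq_or_lt with rfl | hlt
  · exact le_rfl
  · exact (T.s_lt_right u x y hx hlt).le

lemma surplus_le_firstBest (T : Technology a b c h f) {u y : ℝ} (hy : 0 ≤ y) :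
    surplus c y u ≤ surplus c (f u) u := by
  rcases le_total y (f u) with h1 | h1
  · exact T.surplus_le_left hy h1 le_rfl
  · exact T.surplus_le_right le_rfl h1

lemma eq_firstBest (T : Technology a b c h f) {u y : ℝ} (hy : 0 ≤ y)
    (h1 : surplus c (f u) u ≤ surplus c y u) : y = f u := by
  rcases lt_trichotomy y (f u) with h2 | h2 | h2
  · exact absurd h1 (not_le.2 (T.s_lt_left u y _ hy h2 le_rfl))
  · exact h2
  · exact absurd h1 (not_le.2 (T.s_lt_right u _ y le_rfl h2))

lemma surplus_firstBest_nonneg (T : Technology a b c h f) (u : ℝ) : 0 ≤ surplus c (f u) u := by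
  have := T.surplus_le_firstBest (u := u) (le_refl 0)
  simpa [surplus, T.c_zero] using this

lemma surplus_nonneg (T : Technology a b c h f) {u y : ℝ} (hy : 0 ≤ y) (hf : y ≤ f u) :
    0 ≤ surplus c y u := by
  have := T.surplus_le_left (u := u) le_rfl hy hf
  simpa [surplus, T.c_zero] using this

/-- The rents of two constant qualities differ by at most the product of the differences. -/
lemma cost_increment_le (T : Technology a b c h f) {K M : ℝ}
    (hK : ∀ u x y, 0 ≤ x → x ≤ y → y ≤ M → h y u - h x u ≤ K * (y - x)) {x y u v : ℝ} (hx : 0 ≤ x)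
    (hxy : x ≤ y) (hy : y ≤ M) (hu : u ∈ Icc a b) (hv : v ∈ Icc a b) (huv : u ≤ v) :
    (c y u - c y v) - (c x u - c x v) ≤ K * (y - x) * (v - u) := by
  have hc : ∀ x, Continuous fun z => h x z := fun x => T.cont_h.comp (Continuous.prodMk_right x)
  rw [T.ftc y (hx.trans hxy) u hu v hv, T.ftc x hx u hu v hv,
    ← intervalIntegral.integral_sub ((hc y).intervalIntegrable _ _)
      ((hc x).intervalIntegrable _ _)]
  calc ∫ z in u..v, (h y z - h x z) ≤ ∫ _ in u..v, K * (y - x) := by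
        refine intervalIntegral.integral_mono_on huv
          (((hc y).sub (hc x)).intervalIntegrable _ _) (by simp) fun z _ => hK z x y hx hxy hy
    _ = K * (y - x) * (v - u) := by simp; ring

/-- Bounds for the rent of a monotone quality schedule. -/
lemma rent_between (T : Technology a b c h f) {q : ℝ → ℝ} (hq : Monotone q) (hq0 : ∀ u, 0 ≤ q u)
    {u v : ℝ} (hu : u ∈ Icc a b) (hv : v ∈ Icc a b) (huv : u ≤ v) :
    c (q u) u - c (q u) v ≤ ∫ z in u..v, h (q z) z ∧
      ∫ z in u..v, h (q z) z ≤ c (q v) u - c (q v) v := by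
  have hc : ∀ x, Continuous fun z => h x z := fun x => T.cont_h.comp (Continuous.prodMk_right x)
  rw [T.ftc _ (hq0 u) u hu v hv, T.ftc _ (hq0 v) u hu v hv]
  constructor
  · exact intervalIntegral.integral_mono_on huv ((hc _).intervalIntegrable _ _)
      (T.rent_integrable hq u v) fun z hz => T.h_mono _ _ _ (hq0 u) (hq hz.1)
  · exact intervalIntegral.integral_mono_on huv (T.rent_integrable hq u v)
      ((hc _).intervalIntegrable _ _) fun z hz => T.h_mono _ _ _ (hq0 z) (hq hz.2)

/-- The envelope formula for incentive compatible schedules. -/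
lemma envelope (T : Technology a b c h f) {q p : ℝ → ℝ} (hq : Monotone q) (hq0 : ∀ u, 0 ≤ q u)
    (hic : ∀ t ∈ Icc a b, ∀ s ∈ Icc a b, p s - c (q s) t ≤ p t - c (q t) t)
    {u v : ℝ} (hu : u ∈ Icc a b) (hv : v ∈ Icc a b) (huv : u ≤ v) :
    (p v - c (q v) v) - (p u - c (q u) u) = ∫ z in u..v, h (q z) z := by
  obtain ⟨K, hK0, hK⟩ := T.h_lip (q b)
  have hsub : Icc u v ⊆ Icc a b := Icc_subset_Icc hu.1 hv.2
  -- Incentive compatibility and `rent_between` place the profit increment and the rent integral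
  -- between the same two bounds, and `cost_increment_le` bounds their distance by a product of
  -- increments. No regularity of `q` beyond monotonicity is needed.
  have := eq_of_abs_sub_le_mul (E := fun x => (p x - c (q x) x) - ∫ z in u..x, h (q z) z)
    (g := fun x => K * q x) huv ?_
  · simp only [intervalIntegral.integral_same, sub_zero] at this
    linarith
  · intro x hx y hy hxy
    have hxI := hsub hx
    have hyI := hsub hy
    have h1 := hic y hyI x hxI
    have h2 := hic x hxI y hyI
    obtain ⟨h3, h4⟩ := T.rent_between hq hq0 hxI hyI hxy
    have h5 := T.cost_increment_le hK (hq0 x) (hq hxy) (hq hyI.2) hxI hyI hxy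
    have h6 : (∫ z in u..y, h (q z) z) - ∫ z in u..x, h (q z) z = ∫ z in x..y, h (q z) z :=
      intervalIntegral.integral_interval_sub_left (T.rent_integrable hq _ _)
        (T.rent_integrable hq _ _)
    rw [abs_le]
    constructor <;> nlinarith

/-- Monotone schedules with profits given by the envelope formula are incentive compatible. -/
lemma incentive_of_envelope (T : Technology a b c h f) {q U : ℝ → ℝ} (hq : Monotone q)
    (hq0 : ∀ u, 0 ≤ q u)
    (henv : ∀ u ∈ Icc a b, ∀ v ∈ Icc a b, u ≤ v → U v - U u = ∫ z in u..v, h (q z) z)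
    {t s : ℝ} (ht : t ∈ Icc a b) (hs : s ∈ Icc a b) :
    U s + c (q s) s - c (q s) t ≤ U t := by
  rcases le_total s t with hst | hst
  · have := (T.rent_between hq hq0 hs ht hst).1
    have := henv s hs t ht hst
    linarith
  · have := (T.rent_between hq hq0 ht hs hst).2
    have := henv t ht s hs hst
    linarith

/-- The best quality in `[lo, hi]`. -/
lemma surplus_le_clamp (T : Technology a b c h f) {lo hi y u : ℝ} (h0 : 0 ≤ lo) (h1 : lo ≤ y)
    (h2 : y ≤ hi) : surplus c y u ≤ surplus c (max lo (min (f u) hi)) u := by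
  rcases le_total (f u) hi with h3 | h3
  · rw [min_eq_left h3]
    rcases le_total lo (f u) with h4 | h4
    · rw [max_eq_right h4]; exact T.surplus_le_firstBest (h0.trans h1)
    · rw [max_eq_left h4]; exact T.surplus_le_right h4 h1
  · rw [min_eq_right h3, max_eq_right (h1.trans h2)]
    exact T.surplus_le_left (h0.trans h1) h2 h3

lemma clamp_mono (T : Technology a b c h f) (lo hi : ℝ) :
    Monotone fun u => max lo (min (f u) hi) := fun _ _ huv =>
  max_le_max le_rfl (min_le_min (T.f_mono huv) le_rfl)

/-- The envelope formula for the value of choosing the best quality in `[lo, hi]`. -/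
lemma clamp_envelope (T : Technology a b c h f) {lo hi : ℝ} (h0 : 0 ≤ lo) (h1 : lo ≤ hi)
    {u v : ℝ} (hu : u ∈ Icc a b) (hv : v ∈ Icc a b) (huv : u ≤ v) :
    surplus c (max lo (min (f v) hi)) v - surplus c (max lo (min (f u) hi)) u =
      ∫ z in u..v, h (max lo (min (f z) hi)) z := by
  refine T.envelope (q := fun z => max lo (min (f z) hi)) (p := fun z => max lo (min (f z) hi))
    (T.clamp_mono lo hi) (fun u => h0.trans (le_max_left _ _)) ?_ hu hv huv
  intro t _ s _
  exact T.surplus_le_clamp h0 (le_max_left _ _) (max_le h1 (min_le_right _ _))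

/-- Selling every quality at a price equal to itself makes the first best incentive compatible, so
the envelope formula applies to first-best surplus. -/
lemma firstBest_envelope (T : Technology a b c h f)
    {u v : ℝ} (hu : u ∈ Icc a b) (hv : v ∈ Icc a b) (huv : u ≤ v) :
    surplus c (f v) v - surplus c (f u) u = ∫ z in u..v, h (f z) z :=
  T.envelope (q := f) (p := f) T.f_mono (fun u => (T.f_pos u).le)
    (fun _ _ s _ => T.surplus_le_firstBest (T.f_pos s).le) hu hv huv

/-- Where quality does not exceed the first best (or a constant lower bound of it), the excess
of the price over quality is decreasing. -/
lemma gap_antitone (T : Technology a b c h f) {q U : ℝ → ℝ} (hq : Monotone q)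
    (hq0 : ∀ u, 0 ≤ q u)
    (henv : ∀ u ∈ Icc a b, ∀ v ∈ Icc a b, u ≤ v → U v - U u = ∫ z in u..v, h (q z) z)
    {x u v : ℝ} (hu : u ∈ Icc a b) (hv : v ∈ Icc a b) (huv : u ≤ v)
    (hx : ∀ z ∈ Icc u v, x ≤ q z ∧ q z ≤ max (f z) x) :
    U v - surplus c (q v) v ≤ U u - surplus c (q u) u ∧
      (q u < f u → q u < q v → U v - surplus c (q v) v < U u - surplus c (q u) u) := by
  have hle : q u ≤ q v := hq huv
  -- Benchmark: each type picks the best quality in `[q u, q v]` at a price equal to quality. Its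
  -- rents dominate those of `q`, it ends at `q v`, and it starts with at least the surplus of `q
  -- u`.
  have hV := T.clamp_envelope (hq0 u) hle hu hv huv
  have hR : ∫ z in u..v, h (q z) z ≤ ∫ z in u..v, h (max (q u) (min (f z) (q v))) z := by
    refine intervalIntegral.integral_mono_on huv (T.rent_integrable hq _ _)
      (T.rent_integrable (T.clamp_mono _ _) _ _) fun z hz => T.h_mono _ _ _ (hq0 z) ?_
    have h1 := (hx z hz).2
    have h2 := (hx u ⟨le_rfl, huv⟩).1
    have h3 : q z ≤ q v := hq hz.2
    rcases le_total (f z) x with h4 | h4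
    · rw [max_eq_right h4] at h1; exact le_max_of_le_left (h1.trans h2)
    · rw [max_eq_left h4] at h1; exact le_max_of_le_right (le_min h1 h3)
  have hv' : max (q u) (min (f v) (q v)) = q v := by
    have h1 := (hx v ⟨huv, le_rfl⟩).2
    have h2 := (hx u ⟨le_rfl, huv⟩).1
    rcases le_total (f v) x with h4 | h4
    · rw [max_eq_right h4] at h1
      have : q u = q v := le_antisymm hle (h1.trans h2)
      rw [← this]; exact max_eq_left (min_le_right _ _)
    · rw [max_eq_left h4] at h1
      rw [min_eq_right h1]; exact max_eq_right hle
  rw [hv'] at hV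
  have hPi := henv u hu v hv huv
  have hc := T.surplus_le_clamp (u := u) (hq0 u) le_rfl hle
  refine ⟨by linarith, fun h1 h2 => ?_⟩
  have : surplus c (q u) u < surplus c (max (q u) (min (f u) (q v))) u := by
    refine T.s_lt_left u _ _ (hq0 u) ?_ ?_
    · exact lt_max_of_lt_right (lt_min h1 h2)
    · exact max_le h1.le (min_le_left _ _)
  linarith

/-- Where quality is at least the first best (or a constant upper bound of quality), the price
exceeds quality if initial profits are at least first best. -/
lemma gap_nonneg (T : Technology a b c h f) {q U : ℝ → ℝ} (hq : Monotone q)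
    (hq0 : ∀ u, 0 ≤ q u)
    (henv : ∀ u ∈ Icc a b, ∀ v ∈ Icc a b, u ≤ v → U v - U u = ∫ z in u..v, h (q z) z)
    {x t v : ℝ} (ht : t ∈ Icc a b) (hv : v ∈ Icc a b) (htv : t ≤ v)
    (hx : ∀ z ∈ Ioc t v, min (f z) x ≤ q z ∧ q z ≤ x) (hxt : f t ≤ x)
    (hU : surplus c (f t) t ≤ U t) :
    0 ≤ U v - surplus c (q v) v := by
  rcases htv.eq_or_lt with rfl | hlt
  · have := T.surplus_le_firstBest (u := t) (hq0 t); linarith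
  have hvx := hx v ⟨hlt, le_rfl⟩
  have hft : f t ≤ q v := (le_min (T.f_mono htv) hxt).trans hvx.1
  -- Benchmark: the best quality up to `q v`. It is `f t` at `t`, does not exceed `q` on `(t, v]`,
  -- and its value at `v` is at least the surplus of `q v`.
  have hV := T.clamp_envelope (lo := 0) le_rfl (hq0 v) ht hv htv
  have hR : ∫ z in t..v, h (max 0 (min (f z) (q v))) z ≤ ∫ z in t..v, h (q z) z := by
    refine intervalIntegral.integral_mono_ae_restrict htv
      (T.rent_integrable (T.clamp_mono _ _) _ _) (T.rent_integrable hq _ _) ?_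
    have : ∀ᵐ z ∂(volume : Measure ℝ), z ≠ t := by
      simp [ae_iff]
    filter_upwards [ae_restrict_mem measurableSet_Icc, ae_restrict_of_ae this] with z hz hzt
    refine T.h_mono _ _ _ (le_max_left _ _) (max_le (hq0 z) ?_)
    exact (min_le_min le_rfl hvx.2).trans (hx z ⟨lt_of_le_of_ne hz.1 (Ne.symm hzt), hz.2⟩).1
  have h1 : max 0 (min (f t) (q v)) = f t := by
    rw [min_eq_left hft]; exact max_eq_right (T.f_pos t).le
  have h2 : surplus c (q v) v ≤ surplus c (max 0 (min (f v) (q v))) v :=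
    T.surplus_le_clamp le_rfl (hq0 v) le_rfl
  rw [h1] at hV
  have := henv t ht v hv htv
  linarith

end Technology
end RatingDesign

/-! ### The law of types and tail averages of hump-shaped weights -/

namespace RatingDesign
open Filter Topology

/-- `F` charges exactly the subintervals of `[a, b]`. -/
structure FullLaw (a b : ℝ) (F : Measure ℝ) : Prop where
  compl_null : F (Icc a b)ᶜ = 0
  pos : ∀ u v, a ≤ u → u < v → v ≤ b → 0 < F (Ioo u v)

noncomputable section Law

set_option linter.unusedSectionVars false

variable {a b : ℝ} {F : Measure ℝ} [NullSingletonClass F]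

/-- `F` has no atoms, so the values of schedules at endpoints, where they may jump, never matter in
an integral. -/
lemma ae_restrict_mem_Ioo (u v : ℝ) : ∀ᵐ z ∂(F.restrict (Ioc u v)), z ∈ Ioo u v := by
  rw [← restrict_Ioo_eq_restrict_Ioc]
  exact ae_restrict_mem measurableSet_Ioo

lemma integral_congr_Ioo {g k : ℝ → ℝ} {u v : ℝ} (huv : u ≤ v) (h : ∀ z ∈ Ioo u v, g z = k z) :
    ∫ z in u..v, g z ∂F = ∫ z in u..v, k z ∂F := by
  rw [intervalIntegral.integral_of_le huv, intervalIntegral.integral_of_le huv]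
  refine integral_congr_ae ?_
  filter_upwards [ae_restrict_mem_Ioo u v] with z hz using h z hz

lemma integral_nonneg_Ioo {g : ℝ → ℝ} {u v : ℝ} (huv : u ≤ v) (h : ∀ z ∈ Ioo u v, 0 ≤ g z) :
    0 ≤ ∫ z in u..v, g z ∂F := by
  rw [intervalIntegral.integral_of_le huv]
  refine integral_nonneg_of_ae ?_
  filter_upwards [ae_restrict_mem_Ioo u v] with z hz using h z hz

lemma integral_mono_Ioo {g k : ℝ → ℝ} {u v : ℝ} (huv : u ≤ v) (hg : IntervalIntegrable g F u v)
    (hk : IntervalIntegrable k F u v) (h : ∀ z ∈ Ioo u v, g z ≤ k z) :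
    ∫ z in u..v, g z ∂F ≤ ∫ z in u..v, k z ∂F := by
  rw [← sub_nonneg, ← intervalIntegral.integral_sub hk hg]
  exact integral_nonneg_Ioo huv fun z hz => sub_nonneg.2 (h z hz)

lemma FullLaw.integral_pos (hF : FullLaw a b F) {g : ℝ → ℝ} {u v : ℝ} (hu : a ≤ u) (huv : u < v)
    (hv : v ≤ b) (hg : IntervalIntegrable g F u v) (h : ∀ z ∈ Ioo u v, 0 < g z) :
    0 < ∫ z in u..v, g z ∂F := by
  rw [intervalIntegral.integral_of_le huv.le]
  rw [setIntegral_pos_iff_support_of_nonneg_ae ?_ hg.1]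
  · refine (hF.pos u v hu huv hv).trans_le (measure_mono fun z hz => ⟨(h z hz).ne', hz.1, hz.2.le⟩)
  · filter_upwards [ae_restrict_mem_Ioo u v] with z hz using (h z hz).le

/-- A nonnegative function with zero integral vanishes somewhere on every subinterval. -/
lemma FullLaw.exists_eq_zero (hF : FullLaw a b F) {g : ℝ → ℝ} {u v u' v' : ℝ} (hu : a ≤ u)
    (hv : v ≤ b) (hu' : u ≤ u') (huv' : u' < v') (hv' : v' ≤ v)
    (hg : IntervalIntegrable g F u v) (h : ∀ z ∈ Ioo u v, 0 ≤ g z)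
    (h0 : ∫ z in u..v, g z ∂F ≤ 0) : ∃ z ∈ Ioo u' v', g z = 0 := by
  by_contra! hne
  have hsub : uIcc u' v' ⊆ uIcc u v := by
    rw [uIcc_of_le huv'.le, uIcc_of_le (hu'.trans (huv'.le.trans hv'))]
    exact Icc_subset_Icc hu' hv'
  have huv : u ≤ v := hu'.trans (huv'.le.trans hv')
  have h1 := hF.integral_pos (hu.trans hu') huv' (hv'.trans hv) (hg.mono_set hsub)
    fun z hz => lt_of_le_of_ne (h z ⟨hu'.trans_lt hz.1, hz.2.trans_le hv'⟩) (Ne.symm (hne z hz))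
  have i1 : IntervalIntegrable g F u u' := hg.mono_set (by
    rw [uIcc_of_le hu', uIcc_of_le huv]; exact Icc_subset_Icc le_rfl (huv'.le.trans hv'))
  have i3 : IntervalIntegrable g F v' v := hg.mono_set (by
    rw [uIcc_of_le hv', uIcc_of_le huv]; exact Icc_subset_Icc (hu'.trans huv'.le) le_rfl)
  have i2 := hg.mono_set hsub
  have h2 := intervalIntegral.integral_add_adjacent_intervals i1 i2
  have h3 := intervalIntegral.integral_add_adjacent_intervals (i1.trans i2) i3
  have h4 : 0 ≤ ∫ z in u..u', g z ∂F :=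
    integral_nonneg_Ioo hu' fun z hz => h z ⟨hz.1, hz.2.trans_le (huv'.le.trans hv')⟩
  have h5 : 0 ≤ ∫ z in v'..v, g z ∂F :=
    integral_nonneg_Ioo hv' fun z hz => h z ⟨(hu'.trans_lt huv').trans hz.1, hz.2⟩
  linarith

variable [IsProbabilityMeasure F]

/-- Exchange of the order of integration over a triangle. -/
lemma integral_mul_primitive {g k : ℝ → ℝ} {t b : ℝ} (htb : t ≤ b)
    (hg : IntervalIntegrable g F t b) (hk : IntervalIntegrable k volume t b) :
    ∫ θ in t..b, g θ * (∫ u in t..θ, k u) ∂F = ∫ u in t..b, k u * (∫ θ in u..b, g θ ∂F) := by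
  have h1 : ∀ θ ∈ Ioc t b, g θ * (∫ u in t..θ, k u) =
      ∫ u in Ioc t b, (if u ≤ θ then g θ * k u else 0) := by
    intro θ hθ
    rw [intervalIntegral.integral_of_le hθ.1.le, ← integral_const_mul,
      ← integral_indicator measurableSet_Ioc, ← integral_indicator measurableSet_Ioc]
    congr 1
    ext u
    by_cases hu : u ∈ Ioc t θ
    · have : u ∈ Ioc t b := ⟨hu.1, hu.2.trans hθ.2⟩
      simp [indicator_of_mem hu, indicator_of_mem this, hu.2]
    · rw [indicator_of_notMem hu]
      by_cases hu' : u ∈ Ioc t b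
      · have : ¬ u ≤ θ := fun hh => hu ⟨hu'.1, hh⟩
        simp [indicator_of_mem hu', this]
      · rw [indicator_of_notMem hu']
  have h2 : ∀ u ∈ Ioc t b, k u * (∫ θ in u..b, g θ ∂F) =
      ∫ θ in Ioc t b, (if u ≤ θ then g θ * k u else 0) ∂F := by
    intro u hu
    rw [intervalIntegral.integral_of_le hu.2, ← integral_const_mul,
      ← integral_Icc_eq_integral_Ioc,
      ← integral_indicator measurableSet_Icc, ← integral_indicator measurableSet_Ioc]
    congr 1
    ext θ
    by_cases hθ : θ ∈ Icc u b
    · have : θ ∈ Ioc t b := ⟨hu.1.trans_le hθ.1, hθ.2⟩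
      simp [indicator_of_mem hθ, indicator_of_mem this, hθ.1, mul_comm]
    · rw [indicator_of_notMem hθ]
      by_cases hθ' : θ ∈ Ioc t b
      · have : ¬ u ≤ θ := fun hh => hθ ⟨hh, hθ'.2⟩
        simp [indicator_of_mem hθ', this]
      · rw [indicator_of_notMem hθ']
  rw [intervalIntegral.integral_of_le htb, intervalIntegral.integral_of_le htb,
    setIntegral_congr_fun measurableSet_Ioc h1, setIntegral_congr_fun measurableSet_Ioc h2]
  refine integral_integral_swap (f := fun θ u => if u ≤ θ then g θ * k u else 0) ?_
  have hint := Integrable.mul_prod hg.1 hk.1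
  have hS : MeasurableSet {z : ℝ × ℝ | z.2 ≤ z.1} := measurableSet_le measurable_snd measurable_fst
  refine (hint.indicator hS).congr (Eventually.of_forall fun z => ?_)
  by_cases hz : z.2 ≤ z.1 <;> simp [Function.uncurry, indicator, hz]

/-- If the primitive of `D` is nonnegative, so is the integral of `D` against a decreasing
nonnegative function. -/
lemma integral_mul_nonneg_of_antitone {g D : ℝ → ℝ} {t : ℝ} (hat : a ≤ t) (hg : Antitone g)
    (hg0 : ∀ z, 0 ≤ g z) (hD : IntervalIntegrable D F a t)
    (hS : ∀ u ∈ Icc a t, 0 ≤ ∫ z in a..u, D z ∂F) : 0 ≤ ∫ z in a..t, g z * D z ∂F := by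
  -- Layer-cake representation of `g`: by monotonicity every superlevel set is, up to an endpoint,
  -- an initial segment of `[a, t]`, over which `D` has a nonnegative integral.
  have h1 : ∀ z ∈ Ioc a t, g z * D z =
      ∫ v in Ioc 0 (g a), (if v ≤ g z then D z else 0) := by
    intro z hz
    have : ∀ v, (if v ≤ g z then D z else 0) = D z * (Iic (g z)).indicator 1 v := by
      intro v; by_cases hv : v ≤ g z <;> simp [indicator, hv]
    simp_rw [this]
    rw [integral_const_mul, integral_indicator_one measurableSet_Iic,
      measureReal_restrict_apply measurableSet_Iic, Iic_inter_Ioc_of_le (hg hz.1.le)]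
    simp [hg0 z, mul_comm]
  rw [intervalIntegral.integral_of_le hat, setIntegral_congr_fun measurableSet_Ioc h1]
  rw [integral_integral_swap (f := fun z v => if v ≤ g z then D z else 0)]
  · refine integral_nonneg fun v => ?_
    -- Including `a` keeps the set nonempty for levels `v` that `g` never reaches.
    set A : Set ℝ := {z | z ∈ Icc a t ∧ (z = a ∨ v ≤ g z)} with hA
    have haA : a ∈ A := ⟨⟨le_rfl, hat⟩, Or.inl rfl⟩
    have hbdd : BddAbove A := ⟨t, fun z hz => hz.1.2⟩
    have hac : a ≤ sSup A := le_csSup hbdd haA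
    have hct : sSup A ≤ t := csSup_le ⟨a, haA⟩ fun z hz => hz.1.2
    have hI : IntervalIntegrable (fun z => if v ≤ g z then D z else 0) F a t := by
      rw [intervalIntegrable_iff_integrableOn_Ioc_of_le hat]
      have hm : MeasurableSet {z | v ≤ g z} := measurableSet_le measurable_const hg.measurable
      refine (hD.1.indicator hm).congr (Eventually.of_forall fun z => ?_)
      by_cases hz : v ≤ g z <;> simp [indicator, hz]
    have e1 := intervalIntegral.integral_add_adjacent_intervals
      (hI.mono_set (by rw [uIcc_of_le hac, uIcc_of_le hat]; exact Icc_subset_Icc le_rfl hct))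
      (hI.mono_set (by rw [uIcc_of_le hct, uIcc_of_le hat]; exact Icc_subset_Icc hac le_rfl) :
        IntervalIntegrable _ F (sSup A) t)
    have e2 : ∫ z in a..sSup A, (if v ≤ g z then D z else 0) ∂F = ∫ z in a..sSup A, D z ∂F := by
      refine integral_congr_Ioo hac fun z hz => ?_
      obtain ⟨y, hy, hzy⟩ := exists_lt_of_lt_csSup ⟨a, haA⟩ hz.2
      rcases hy.2 with rfl | hvy
      · exact absurd (hz.1.trans hzy) (lt_irrefl _)
      · rw [if_pos (hvy.trans (hg hzy.le))]
    have e3 : ∫ z in sSup A..t, (if v ≤ g z then D z else 0) ∂F = ∫ z in sSup A..t, (0 : ℝ) ∂F := by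
      refine integral_congr_Ioo hct fun z hz => ?_
      rw [if_neg]
      intro hvz
      have : z ∈ A := ⟨⟨hac.trans hz.1.le, hz.2.le⟩, Or.inr hvz⟩
      exact absurd (le_csSup hbdd this) (not_le.2 hz.1)
    have := hS _ ⟨hac, hct⟩
    rw [← intervalIntegral.integral_of_le hat, ← e1, e2, e3]
    simpa using this
  · have hint : Integrable (fun z : ℝ × ℝ => D z.1)
        ((F.restrict (Ioc a t)).prod (volume.restrict (Ioc 0 (g a)))) := by
      have : IsFiniteMeasure ((volume : Measure ℝ).restrict (Ioc 0 (g a))) :=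
        ⟨by simp⟩
      exact hD.1.comp_fst _
    have hS : MeasurableSet {z : ℝ × ℝ | z.2 ≤ g z.1} :=
      measurableSet_le measurable_snd (hg.measurable.comp measurable_fst)
    refine (hint.indicator hS).congr (Eventually.of_forall fun z => ?_)
    by_cases hz : z.2 ≤ g z.1 <;> simp [Function.uncurry, indicator, hz]

/-- Strictly hump-shaped integrable weights. -/
structure Hump (a b : ℝ) (F : Measure ℝ) (w : ℝ → ℝ) (p : ℝ) : Prop where
  peak_mem : p ∈ Ioo a b
  nonneg : ∀ t ∈ Icc a b, 0 ≤ w t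
  increasing : StrictMonoOn w (Icc a p)
  decreasing : StrictAntiOn w (Icc p b)
  integrable : Integrable w F

/-- The mass of types above `t`. -/
def tailMass (b : ℝ) (F : Measure ℝ) (t : ℝ) : ℝ := ∫ _ in t..b, (1 : ℝ) ∂F

/-- The weight of types above `t`. -/
def tailWeight (b : ℝ) (F : Measure ℝ) (w : ℝ → ℝ) (t : ℝ) : ℝ := ∫ z in t..b, w z ∂F

/-- The excess weight of the types above `u`, relative to the average weight above `t` and scaled
by the mass of types above `t`. -/
def tailGap (b : ℝ) (F : Measure ℝ) (w : ℝ → ℝ) (t u : ℝ) : ℝ :=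
  tailMass b F t * tailWeight b F w u - tailMass b F u * tailWeight b F w t

lemma one_intervalIntegrable (u v : ℝ) : IntervalIntegrable (fun _ => (1 : ℝ)) F u v :=
  intervalIntegrable_const

lemma Hump.intervalIntegrable {w : ℝ → ℝ} {p : ℝ} (hw : Hump a b F w p) (u v : ℝ) :
    IntervalIntegrable w F u v := hw.integrable.intervalIntegrable

lemma continuous_tail {g : ℝ → ℝ} (hg : ∀ u v, IntervalIntegrable g F u v) (b : ℝ) :
    Continuous fun t => ∫ z in t..b, g z ∂F := by
  have := (intervalIntegral.continuous_primitive hg b).neg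
  refine this.congr fun t => ?_
  exact (intervalIntegral.integral_symm _ _).symm

lemma continuous_tailMass (b : ℝ) : Continuous (tailMass b F) :=
  continuous_tail (fun _ _ => one_intervalIntegrable _ _) b

lemma Hump.continuous_tailWeight {w : ℝ → ℝ} {p : ℝ} (hw : Hump a b F w p) (b' : ℝ) :
    Continuous (tailWeight b' F w) :=
  continuous_tail hw.intervalIntegrable b'

lemma FullLaw.tailMass_pos (hF : FullLaw a b F) {t : ℝ} (ht : t ∈ Ico a b) :
    0 < tailMass b F t :=
  hF.integral_pos ht.1 ht.2 le_rfl (one_intervalIntegrable _ _) fun _ _ => one_pos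

lemma tailMass_sub (u v : ℝ) : tailMass b F u - tailMass b F v = ∫ _ in u..v, (1 : ℝ) ∂F :=
  sub_eq_of_eq_add (intervalIntegral.integral_add_adjacent_intervals (one_intervalIntegrable _ _)
    (one_intervalIntegrable _ _)).symm

lemma Hump.tailWeight_sub {w : ℝ → ℝ} {p : ℝ} (hw : Hump a b F w p) (u v : ℝ) :
    tailWeight b F w u - tailWeight b F w v = ∫ z in u..v, w z ∂F :=
  sub_eq_of_eq_add (intervalIntegral.integral_add_adjacent_intervals (hw.intervalIntegrable _ _)
    (hw.intervalIntegrable _ _)).symm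

/-- Strict quasi-concavity, the form in which the hump shape enters the sign analysis of tail gaps.
-/
lemma Hump.min_lt {w : ℝ → ℝ} {p : ℝ} (hw : Hump a b F w p) {x y z : ℝ} (hx : a ≤ x) (hxy : x < y)
    (hyz : y < z) (hz : z ≤ b) : min (w x) (w z) < w y := by
  rcases le_total y p with h | h
  · exact min_lt_of_left_lt (hw.increasing ⟨hx, hxy.le.trans h⟩ ⟨hx.trans hxy.le, h⟩ hxy)
  · exact min_lt_of_right_lt (hw.decreasing ⟨h, hyz.le.trans hz⟩ ⟨h.trans hyz.le, hz⟩ hyz)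

/-- With `m` and `W` the mass and the weight above `t`, the gap at `u` is the integral over `[u, b]`
of the centred weight `m w - W`. It vanishes at `u = t` and at `u = b`. -/
lemma Hump.tailGap_sub {w : ℝ → ℝ} {p : ℝ} (hw : Hump a b F w p) (t u v : ℝ) :
    tailGap b F w t u - tailGap b F w t v =
      ∫ z in u..v, (tailMass b F t * w z - tailWeight b F w t) ∂F := by
  have h1 := hw.tailWeight_sub (b := b) u v
  have h2 := tailMass_sub (b := b) (F := F) u v
  rw [intervalIntegral.integral_sub ((hw.intervalIntegrable _ _).const_mul _)
    intervalIntegrable_const,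
    intervalIntegral.integral_const_mul, ← h1]
  have h3 : ∫ _ in u..v, tailWeight b F w t ∂F
      = tailWeight b F w t * (tailMass b F u - tailMass b F v) := by
    rw [h2, ← intervalIntegral.integral_const_mul]; simp
  rw [h3]; unfold tailGap; ring

lemma tailGap_self (w : ℝ → ℝ) (t : ℝ) : tailGap b F w t t = 0 := by unfold tailGap; ring

lemma tailGap_end (w : ℝ → ℝ) (t : ℝ) : tailGap b F w t b = 0 := by
  simp [tailGap, tailMass, tailWeight]

lemma Hump.gap_integrable {w : ℝ → ℝ} {p : ℝ} (hw : Hump a b F w p) (r k u v : ℝ) :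
    IntervalIntegrable (fun z => r * w z - k) F u v :=
  ((hw.intervalIntegrable _ _).const_mul _).sub intervalIntegrable_const

/-- Once nonpositive, the tail gap is negative. -/
lemma Hump.tailGap_neg {w : ℝ → ℝ} {p : ℝ} (hF : FullLaw a b F) (hw : Hump a b F w p)
    {t u v : ℝ} (ht : a ≤ t) (htu : t < u) (huv : u < v) (hv : v < b)
    (hu : tailGap b F w t u ≤ 0) : tailGap b F w t v < 0 := by
  -- If the gap were nonnegative at `v`, the centred weight would have a nonnegative integral over
  -- `(t, u)` and `(v, b)` and a nonpositive one over `(u, v)`. It is then nonnegative at some `x`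
  -- before `u` and some `y` after `v`, hence positive in between by quasi-concavity, a
  -- contradiction on `(u, v)`.
  by_contra! hcon
  have hm : 0 < tailMass b F t := hF.tailMass_pos ⟨ht, (htu.trans huv).trans hv⟩
  have i := hw.gap_integrable (tailMass b F t) (tailWeight b F w t)
  have h1 : 0 ≤ ∫ z in t..u, (tailMass b F t * w z - tailWeight b F w t) ∂F := by
    rw [← hw.tailGap_sub, tailGap_self]; linarith
  have h2 : ∫ z in u..v, (tailMass b F t * w z - tailWeight b F w t) ∂F ≤ 0 := by
    rw [← hw.tailGap_sub]; linarith
  have h3 : 0 ≤ ∫ z in v..b, (tailMass b F t * w z - tailWeight b F w t) ∂F := by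
    rw [← hw.tailGap_sub, tailGap_end]; linarith
  obtain ⟨x, hx, hx'⟩ : ∃ x ∈ Ioo t u, 0 ≤ tailMass b F t * w x - tailWeight b F w t := by
    by_contra! hc
    have := hF.integral_pos ht htu (huv.le.trans hv.le) (i t u).neg fun z hz => by
      have := hc z hz; simp only [Pi.neg_apply]; linarith
    simp only [Pi.neg_apply, intervalIntegral.integral_neg] at this
    linarith
  obtain ⟨y, hy, hy'⟩ : ∃ x ∈ Ioo v b, 0 ≤ tailMass b F t * w x - tailWeight b F w t := by
    by_contra! hc
    have := hF.integral_pos (ht.trans (htu.trans huv).le) hv le_rfl (i v b).neg fun z hz => by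
      have := hc z hz; simp only [Pi.neg_apply]; linarith
    simp only [Pi.neg_apply, intervalIntegral.integral_neg] at this
    linarith
  have := hF.integral_pos (ht.trans htu.le) huv hv.le (i u v) fun z hz => by
    have := hw.min_lt (ht.trans hx.1.le) (hx.2.trans hz.1) (hz.2.trans hy.1) hy.2.le
    rcases min_lt_iff.1 this with h | h
    · nlinarith
    · nlinarith
  linarith

/-- By `tailGap_neg` the sign of the gap changes at most once, from positive to negative. The
crossing is the supremum of the initial stretch of positivity, and it may be `t` or `b`. -/
lemma Hump.exists_crossing {w : ℝ → ℝ} {p : ℝ} (hF : FullLaw a b F) (hw : Hump a b F w p)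
    {t : ℝ} (ht : t ∈ Ico a b) : ∃ τ ∈ Icc t b, (∀ u ∈ Ioo t τ, 0 < tailGap b F w t u) ∧
      ∀ u ∈ Ioo τ b, tailGap b F w t u < 0 := by
  set A : Set ℝ := {x | x ∈ Icc t b ∧ ∀ u ∈ Ioo t x, 0 < tailGap b F w t u} with hA
  have htA : t ∈ A := ⟨⟨le_rfl, ht.2.le⟩, fun u hu => absurd hu.2 (not_lt.2 hu.1.le)⟩
  have hbdd : BddAbove A := ⟨b, fun z hz => hz.1.2⟩
  have h1 : t ≤ sSup A := le_csSup hbdd htA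
  refine ⟨sSup A, ⟨h1, csSup_le ⟨t, htA⟩ fun z hz => hz.1.2⟩, ?_, ?_⟩
  · intro u hu
    obtain ⟨y, hy, huy⟩ := exists_lt_of_lt_csSup ⟨t, htA⟩ hu.2
    exact hy.2 u ⟨hu.1, huy⟩
  · intro u hu
    have : u ∉ A := fun hh => absurd (le_csSup hbdd hh) (not_le.2 hu.1)
    have : ∃ v ∈ Ioo t u, tailGap b F w t v ≤ 0 := by
      by_contra! hc
      exact this ⟨⟨h1.trans hu.1.le, hu.2.le⟩, hc⟩
    obtain ⟨v, hv, hv'⟩ := this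
    exact hw.tailGap_neg hF ht.1 hv.1 hv.2 hu.2 hv'

/-- The largest type below the peak such that all lower weights are at most the average weight
above it. -/
lemma Hump.exists_max {w : ℝ → ℝ} {p : ℝ} (hF : FullLaw a b F) (hw : Hump a b F w p) :
    ∃ tm ∈ Icc a p, (∀ t ∈ Icc a tm, ∀ θ ∈ Ico a t, w θ * tailMass b F t ≤ tailWeight b F w t) ∧
      ∀ u ∈ Ioo tm b, tailGap b F w tm u ≤ 0 := by
  have hp := hw.peak_mem
  set E : Set ℝ := {t | t ∈ Icc a p ∧ ∀ θ ∈ Ico a t, w θ * tailMass b F t ≤ tailWeight b F w t}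
    with hE
  have haE : a ∈ E := ⟨⟨le_rfl, hp.1.le⟩, fun θ hθ => absurd hθ.2 (not_lt.2 hθ.1)⟩
  have hbdd : BddAbove E := ⟨p, fun z hz => hz.1.2⟩
  have hat : a ≤ sSup E := le_csSup hbdd haE
  have htp : sSup E ≤ p := csSup_le ⟨a, haE⟩ fun z hz => hz.1.2
  -- For fixed `θ` the condition is closed in `t`, because tail mass and tail weight are continuous,
  -- so it passes to the supremum.
  have htE : sSup E ∈ E := by
    refine ⟨⟨hat, htp⟩, fun θ hθ => ?_⟩
    have hmem : sSup E ∈ closure (E ∩ Ioi θ) := by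
      rw [mem_closure_iff_nhds]
      intro U hU
      obtain ⟨l, hl, hlU⟩ := exists_Ioc_subset_of_mem_nhds hU ⟨θ, hθ.2⟩
      obtain ⟨y, hy, hly⟩ := exists_lt_of_lt_csSup ⟨a, haE⟩ (max_lt hl hθ.2)
      exact ⟨y, hlU ⟨(le_max_left _ _).trans_lt hly, le_csSup hbdd hy⟩, hy,
        (le_max_right _ _).trans_lt hly⟩
    have hcl : IsClosed {t | w θ * tailMass b F t ≤ tailWeight b F w t} :=
      isClosed_le (continuous_const.mul (continuous_tailMass b)) (hw.continuous_tailWeight b)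
    exact hcl.closure_subset_iff.2 (fun t ht => ht.1.2 θ ⟨hθ.1, ht.2⟩) hmem
  refine ⟨sSup E, ⟨hat, htp⟩, fun t ht θ hθ => ?_, ?_⟩
  · have h1 := htE.2 θ ⟨hθ.1, hθ.2.trans_le ht.2⟩
    have h2 := hw.tailWeight_sub (b := b) t (sSup E)
    have h3 := tailMass_sub (b := b) (F := F) t (sSup E)
    -- Moving `t` down from the supremum only adds types whose weights exceed `w θ`.
    have h4 : ∫ _ in t..sSup E, w θ * 1 ∂F ≤ ∫ z in t..sSup E, w z ∂F := by
      refine integral_mono_Ioo ht.2 ((one_intervalIntegrable _ _).const_mul _)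
        (hw.intervalIntegrable _ _) fun z hz => ?_
      rw [mul_one]
      exact (hw.increasing ⟨hθ.1, hθ.2.le.trans (ht.2.trans htp)⟩
        ⟨ht.1.trans hz.1.le, hz.2.le.trans htp⟩ (hθ.2.trans hz.1)).le
    rw [intervalIntegral.integral_const_mul, ← h3, ← h2] at h4
    linarith
  -- A gap that is positive at `u` is positive on all of `(sSup E, u]`, so arbitrarily close above
  -- the supremum some type `y` has a below-average weight. If the supremum is the peak, weights
  -- fall from `y` on, which makes the gap at `u` negative. Otherwise `y` belongs to `E`: the mean
  -- above `y` exceeds the mean above the supremum, which exceeds `w y`.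
  · by_contra! hcon
    obtain ⟨u, hu, hu'⟩ := hcon
    set t := sSup E with ht
    have hm : 0 < tailMass b F t := hF.tailMass_pos ⟨hat, hu.1.trans hu.2⟩
    have i := hw.gap_integrable (tailMass b F t) (tailWeight b F w t)
    have hpos : ∀ v ∈ Ioc t u, 0 < tailGap b F w t v := by
      intro v hv
      rcases hv.2.eq_or_lt with rfl | hlt
      · exact hu'
      · by_contra! hc
        exact absurd hu' (not_lt.2 (hw.tailGap_neg hF hat hv.1 hlt hu.2 hc).le)
    have hlow : ∀ v ∈ Ioc t u, ∃ y ∈ Ioo t v, tailMass b F t * w y < tailWeight b F w t := by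
      intro v hv
      by_contra! hc
      have h1 : 0 ≤ ∫ z in t..v, (tailMass b F t * w z - tailWeight b F w t) ∂F :=
        integral_nonneg_Ioo hv.1.le fun z hz => sub_nonneg.2 (hc z hz)
      rw [← hw.tailGap_sub, tailGap_self] at h1
      linarith [hpos v hv]
    rcases htp.eq_or_lt with h | h
    · obtain ⟨y, hy, hy'⟩ := hlow u ⟨hu.1, le_rfl⟩
      have h1 := hF.integral_pos (hat.trans hu.1.le) hu.2 le_rfl (i u b).neg fun z hz => by
        have := hw.decreasing ⟨h ▸ hy.1.le, (hy.2.trans hu.2).le⟩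
          ⟨h ▸ (hu.1.trans hz.1).le, hz.2.le⟩ (hy.2.trans hz.1)
        simp only [Pi.neg_apply]
        nlinarith
      simp only [Pi.neg_apply, intervalIntegral.integral_neg] at h1
      rw [← hw.tailGap_sub, tailGap_end] at h1
      linarith
    · obtain ⟨y, hy, hy'⟩ := hlow (min u p) ⟨lt_min hu.1 h, min_le_left _ _⟩
      have hyu : y < u := hy.2.trans_le (min_le_left _ _)
      have hyp : y < p := hy.2.trans_le (min_le_right _ _)
      have hyE : y ∈ E := by
        refine ⟨⟨hat.trans hy.1.le, hyp.le⟩, fun θ hθ => ?_⟩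
        have h1 : w θ < w y :=
          hw.increasing ⟨hθ.1, hθ.2.le.trans hyp.le⟩ ⟨hat.trans hy.1.le, hyp.le⟩ hθ.2
        have h2 := hpos y ⟨hy.1, hyu.le⟩
        unfold tailGap at h2
        have h3 : 0 < tailMass b F y := hF.tailMass_pos ⟨hat.trans hy.1.le, hyu.trans hu.2⟩
        have h4 : tailMass b F t * (w θ * tailMass b F y) ≤
            tailMass b F t * tailWeight b F w y := by
          have : tailMass b F t * w θ ≤ tailWeight b F w t :=
            (mul_le_mul_of_nonneg_left h1.le hm.le).trans hy'.le
          nlinarith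
        exact le_of_mul_le_mul_left h4 hm
      exact absurd (le_csSup hbdd hyE) (not_le.2 hy.1)

end Law
end RatingDesign

/-! ### The median deviation, its budget deficit, and the choice of `t`, `τ` and `x` -/

namespace RatingDesign
open Filter Topology
noncomputable section Candidate
set_option linter.unusedSectionVars false

/-- The median of `q u`, `f u` and `x`. -/
def med (q f : ℝ → ℝ) (x u : ℝ) : ℝ := max (min (q u) (f u)) (min (max (q u) (f u)) x)

section Med
variable {q f : ℝ → ℝ} {x y u : ℝ}

lemma med_mono (hq : Monotone q) (hf : Monotone f) (x : ℝ) : Monotone (med q f x) :=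
  fun _ _ h => max_le_max (min_le_min (hq h) (hf h)) (min_le_min (max_le_max (hq h) (hf h)) le_rfl)

lemma med_nonneg (hq : 0 ≤ q u) (hf : 0 ≤ f u) : 0 ≤ med q f x u :=
  le_max_of_le_left (le_min hq hf)

lemma med_le_max : med q f x u ≤ max (q u) (f u) :=
  max_le ((min_le_left _ _).trans (le_max_left _ _)) (min_le_left _ _)

lemma med_le_med (h : x ≤ y) : med q f x u ≤ med q f y u :=
  max_le_max le_rfl (min_le_min le_rfl h)

lemma med_sub_le (h : x ≤ y) : med q f y u - med q f x u ≤ y - x := by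
  unfold med
  rcases max_cases (min (q u) (f u)) (min (max (q u) (f u)) y) with h1 | h1 <;>
  rcases max_cases (min (q u) (f u)) (min (max (q u) (f u)) x) with h2 | h2 <;>
  rcases min_cases (max (q u) (f u)) y with h3 | h3 <;>
  rcases min_cases (max (q u) (f u)) x with h4 | h4 <;> linarith

lemma le_med_of_le (h : q u ≤ x) : q u ≤ med q f x u :=
  le_max_of_le_right (le_min (le_max_left _ _) h)

lemma min_le_med : min (f u) x ≤ med q f x u :=
  le_max_of_le_right (min_le_min (le_max_right _ _) le_rfl)

lemma med_le_of_le (h : q u ≤ x) : med q f x u ≤ x :=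
  max_le ((min_le_left _ _).trans h) (min_le_right _ _)

lemma med_le_of_ge (h : x ≤ q u) : med q f x u ≤ q u :=
  max_le (min_le_left _ _) ((min_le_right _ _).trans h)

lemma le_med_of_ge (h : x ≤ q u) : x ≤ med q f x u :=
  le_max_of_le_right (le_min (le_max_of_le_left h) le_rfl)

lemma med_le : med q f x u ≤ max (f u) x :=
  max_le (le_max_of_le_left (min_le_right _ _)) (le_max_of_le_right (min_le_right _ _))

end Med

variable {a b : ℝ} {c h : ℝ → ℝ → ℝ} {f q w : ℝ → ℝ} {p : ℝ} {F : Measure ℝ}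
  [IsProbabilityMeasure F] [NullSingletonClass F]

/-- The median lies between `q u` and `f u`, and surplus is single-peaked at `f u`. -/
lemma Technology.surplus_le_med (T : Technology a b c h f) {x u : ℝ} (hq : 0 ≤ q u) :
    surplus c (q u) u ≤ surplus c (med q f x u) u := by
  unfold med
  rcases le_total (q u) (f u) with h1 | h1
  · rw [min_eq_left h1, max_eq_right h1]
    exact T.surplus_le_left hq (le_max_left _ _) (max_le h1 (min_le_left _ _))
  · rw [min_eq_right h1, max_eq_left h1]
    exact T.surplus_le_right (le_max_left _ _) (max_le h1 (min_le_left _ _))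

lemma Technology.med_eq_of_surplus_le (T : Technology a b c h f) {x u : ℝ} (hq : 0 ≤ q u)
    (hs : surplus c (med q f x u) u ≤ surplus c (q u) u) : med q f x u = q u := by
  unfold med at *
  rcases le_total (q u) (f u) with h1 | h1
  · rw [min_eq_left h1, max_eq_right h1] at *
    by_contra hne
    refine absurd hs (not_le.2 (T.s_lt_left u _ _ hq ?_ (max_le h1 (min_le_left _ _))))
    exact lt_of_le_of_ne (le_max_left _ _) (Ne.symm hne)
  · rw [min_eq_right h1, max_eq_left h1] at *
    by_contra hne
    refine absurd hs (not_le.2 (T.s_lt_right u _ _ (le_max_left _ _) ?_))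
    exact lt_of_le_of_ne (max_le h1 (min_le_left _ _)) hne

/-- The budget deficit of the types above `t` if type `t` gets its first-best profit and quality is
the median of `q`, the first best and `x`. -/
def deficit (b : ℝ) (c h : ℝ → ℝ → ℝ) (f q : ℝ → ℝ) (F : Measure ℝ) (t x : ℝ) : ℝ :=
  ∫ θ in t..b, (surplus c (f t) t + (∫ z in t..θ, h (med q f x z) z)
    - surplus c (med q f x θ) θ) ∂F

lemma continuous_rent (T : Technology a b c h f) (hq : Monotone q) (t : ℝ) :
    Continuous fun θ => ∫ z in t..θ, h (q z) z :=
  intervalIntegral.continuous_primitive (fun u v => T.rent_integrable hq u v) t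

/-- The constant is uniform in `t`. Together with continuity in `t` this gives the joint continuity
on which the compactness argument in `exists_candidate` relies. -/
lemma deficit_lipschitz (T : Technology a b c h f) (hq : Monotone q) (hq0 : ∀ u, 0 ≤ q u) :
    ∃ L, 0 ≤ L ∧ ∀ t ∈ Icc a b, ∀ x y, x ≤ y →
      |deficit b c h f q F t y - deficit b c h f q F t x| ≤ L * (y - x) := by
  obtain ⟨Kh, hKh0, hKh⟩ := T.h_lip (max (q b) (f b))
  obtain ⟨Kc, hKc0, hKc⟩ := T.c_lip (max (q b) (f b))
  refine ⟨Kh * (b - a) + (1 + Kc), by have := T.lt; nlinarith, fun t ht x y hxy => ?_⟩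
  have hm := fun x => med_mono hq T.f_mono x
  have hn : ∀ x u, 0 ≤ med q f x u := fun x u => med_nonneg (hq0 u) (T.f_pos u).le
  have hM : ∀ x, ∀ u ≤ b, med q f x u ≤ max (q b) (f b) := fun x u hu =>
    med_le_max.trans (max_le_max (hq hu) (T.f_mono hu))
  have hi : ∀ x, IntervalIntegrable (fun θ => surplus c (f t) t +
      (∫ z in t..θ, h (med q f x z) z) - surplus c (med q f x θ) θ) F t b := fun x =>
    ((continuous_const.add (continuous_rent T (hm x) t)).intervalIntegrable _ _).sub
      (T.surplus_integrable (hm x) F _ _)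
  unfold deficit
  rw [← intervalIntegral.integral_sub (hi y) (hi x)]
  have hb : ∀ θ ∈ Ioc t b, ‖(surplus c (f t) t + (∫ z in t..θ, h (med q f y z) z)
      - surplus c (med q f y θ) θ) - (surplus c (f t) t + (∫ z in t..θ, h (med q f x z) z)
      - surplus c (med q f x θ) θ)‖ ≤ (Kh * (b - a) + (1 + Kc)) * (y - x) := by
    intro θ hθ
    have hmm : med q f x θ ≤ med q f y θ := med_le_med hxy
    have e1 := hKc θ _ _ (hn x θ) hmm (hM y θ hθ.2)
    have e2 := T.c_mono θ _ _ (hn x θ) hmm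
    have e3 : med q f y θ - med q f x θ ≤ y - x := med_sub_le hxy
    have e4 : (∫ z in t..θ, h (med q f y z) z) - ∫ z in t..θ, h (med q f x z) z =
        ∫ z in t..θ, (h (med q f y z) z - h (med q f x z) z) :=
      (intervalIntegral.integral_sub (T.rent_integrable (hm y) _ _)
        (T.rent_integrable (hm x) _ _)).symm
    have e5 : 0 ≤ ∫ z in t..θ, (h (med q f y z) z - h (med q f x z) z) :=
      intervalIntegral.integral_nonneg hθ.1.le fun z _ =>
        sub_nonneg.2 (T.h_mono z _ _ (hn x z) (med_le_med hxy))
    have e6 : ∫ z in t..θ, (h (med q f y z) z - h (med q f x z) z) ≤ ∫ _ in t..θ, Kh * (y - x) := by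
      refine intervalIntegral.integral_mono_on hθ.1.le ((T.rent_integrable (hm y) _ _).sub
        (T.rent_integrable (hm x) _ _)) (by simp) fun z hz => ?_
      refine (hKh z _ _ (hn x z) (med_le_med hxy) (hM y z (hz.2.trans hθ.2))).trans ?_
      exact mul_le_mul_of_nonneg_left (med_sub_le hxy) hKh0
    rw [intervalIntegral.integral_const, smul_eq_mul] at e6
    have e7 : (θ - t) * (Kh * (y - x)) ≤ Kh * (b - a) * (y - x) := by
      have : θ - t ≤ b - a := by linarith [ht.1, hθ.2]
      have : 0 ≤ Kh * (y - x) := mul_nonneg hKh0 (by linarith)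
      nlinarith
    have e8 : Kc * (med q f y θ - med q f x θ) ≤ Kc * (y - x) :=
      mul_le_mul_of_nonneg_left e3 hKc0
    have e9 : 0 ≤ Kc * (y - x) := mul_nonneg hKc0 (by linarith)
    have e10 : 0 ≤ Kh * (b - a) * (y - x) := by
      have := T.lt
      exact mul_nonneg (mul_nonneg hKh0 (by linarith)) (by linarith)
    rw [Real.norm_eq_abs, abs_le]
    unfold surplus
    constructor <;> linarith
  refine (intervalIntegral.norm_integral_le_of_norm_le (g := fun _ =>
    (Kh * (b - a) + (1 + Kc)) * (y - x)) ht.2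
    (Eventually.of_forall fun θ hθ => hb θ hθ) intervalIntegrable_const).trans ?_
  rw [intervalIntegral.integral_of_le ht.2, setIntegral_const, smul_eq_mul]
  have : F.real (Ioc t b) ≤ 1 := measureReal_le_one
  have h0 : 0 ≤ (Kh * (b - a) + (1 + Kc)) * (y - x) := by
    have := T.lt
    exact mul_nonneg (by nlinarith) (by linarith)
  nlinarith

lemma deficit_continuous (T : Technology a b c h f) (hq : Monotone q) (x : ℝ) :
    Continuous fun t => deficit b c h f q F t x := by
  have hm := med_mono hq T.f_mono x
  have hP := continuous_rent T hm b
  have hi : ∀ u v, IntervalIntegrable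
      (fun θ => (∫ z in b..θ, h (med q f x z) z) - surplus c (med q f x θ) θ) F u v := fun u v =>
    (hP.intervalIntegrable _ _).sub (T.surplus_integrable hm F _ _)
  -- Measuring rents from the fixed type `b` confines the dependence on `t` to a factor and a limit
  -- of integration.
  have heq : ∀ t, deficit b c h f q F t x =
      (surplus c (f t) t - ∫ z in b..t, h (med q f x z) z) * tailMass b F t +
      ∫ θ in t..b, ((∫ z in b..θ, h (med q f x z) z) - surplus c (med q f x θ) θ) ∂F := by
    intro t
    unfold deficit tailMass
    rw [← intervalIntegral.integral_const_mul, ← intervalIntegral.integral_add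
      intervalIntegrable_const (hi t b)]
    refine intervalIntegral.integral_congr fun θ _ => ?_
    have : (∫ z in t..θ, h (med q f x z) z) =
        (∫ z in b..θ, h (med q f x z) z) - ∫ z in b..t, h (med q f x z) z :=
      (intervalIntegral.integral_interval_sub_left (T.rent_integrable hm _ _)
        (T.rent_integrable hm _ _)).symm
    simp only [this]; ring
  simp_rw [heq]
  have hs : Continuous fun t => surplus c (f t) t :=
    T.surplus_cont.comp (T.f_cont.prodMk continuous_id)
  exact ((hs.sub hP).mul (continuous_tailMass b)).add (continuous_tail hi b)

lemma deficit_continuousOn (T : Technology a b c h f) (hq : Monotone q) (hq0 : ∀ u, 0 ≤ q u) :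
    ContinuousOn (fun z : ℝ × ℝ => deficit b c h f q F z.1 z.2) (Icc a b ×ˢ univ) := by
  obtain ⟨L, hL0, hL⟩ := deficit_lipschitz (F := F) T hq hq0
  have h1 : ContinuousOn (fun z : ℝ × ℝ => deficit b c h f q F z.2 z.1) (univ ×ˢ Icc a b) := by
    refine continuousOn_prod_of_continuousOn_lipschitzOnWith _ ⟨L, hL0⟩
      (fun x _ => (deficit_continuous T hq x).continuousOn) fun t ht => ?_
    refine LipschitzOnWith.of_dist_le_mul fun x _ y _ => ?_
    rw [Real.dist_eq, Real.dist_eq]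
    rcases le_total x y with hxy | hxy
    · rw [abs_sub_comm, abs_sub_comm x y, abs_of_nonneg (sub_nonneg.2 hxy)]
      exact hL t ht x y hxy
    · rw [abs_of_nonneg (sub_nonneg.2 hxy)]
      exact hL t ht y x hxy
  exact h1.comp continuous_swap.continuousOn fun z hz => ⟨mem_univ _, hz.1⟩

/-- The candidate schedule's profits satisfy the envelope formula. -/
lemma rent_sub (T : Technology a b c h f) (hq : Monotone q) (k t u v : ℝ) :
    (k + ∫ z in t..v, h (q z) z) - (k + ∫ z in t..u, h (q z) z) = ∫ z in u..v, h (q z) z := by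
  have := intervalIntegral.integral_interval_sub_left (T.rent_integrable hq t v)
    (T.rent_integrable hq t u)
  linarith

/-- At the level `x = f t` the excess starts from zero at `t`, and quality stays between `f t` and
the first best, so the excess decreases and is nonpositive above `t`. -/
lemma deficit_nonpos (T : Technology a b c h f) (hq : Monotone q) (hq0 : ∀ u, 0 ≤ q u) {t : ℝ}
    (ht : t ∈ Icc a b) : deficit b c h f q F t (f t) ≤ 0 := by
  have hm := med_mono hq T.f_mono (f t)
  have h0 : med q f (f t) t = f t :=
    le_antisymm (med_le.trans (max_self _).le) ((min_self (f t)).ge.trans min_le_med)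
  unfold deficit
  rw [← neg_nonneg, ← intervalIntegral.integral_neg]
  refine integral_nonneg_Ioo ht.2 fun θ hθ => ?_
  have := (T.gap_antitone (U := fun θ => surplus c (f t) t + ∫ z in t..θ, h (med q f (f t) z) z)
    hm (fun u => med_nonneg (hq0 u) (T.f_pos u).le) (fun u _ v _ _ => rent_sub T hm _ t u v)
    (x := f t) ht ⟨ht.1.trans hθ.1.le, hθ.2.le⟩ hθ.1.le fun z hz =>
      ⟨(le_min (T.f_mono hz.1) le_rfl).trans min_le_med, med_le⟩).1
  simp only [h0, intervalIntegral.integral_same] at this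
  linarith

/-- The order relations between a quality level `x`, a type `τ` and the schedule `q` above `t`
under which replacing `q` by its median with the first best and `x` raises welfare. -/
structure Cut (b : ℝ) (F : Measure ℝ) (w q : ℝ → ℝ) (t τ x : ℝ) : Prop where
  left_le : t ≤ τ
  le_right : τ ≤ b
  gap_nonneg : ∀ u, t < u → u < τ → 0 ≤ tailGap b F w t u
  gap_nonpos : ∀ u, τ < u → u < b → tailGap b F w t u ≤ 0
  le_cut : ∀ u, t < u → u < τ → q u ≤ x
  cut_le : ∀ u, τ < u → u < b → x ≤ q u

lemma exists_cut (hF : FullLaw a b F) (hw : Hump a b F w p) (hq : Monotone q) {t : ℝ}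
    (ht : t ∈ Ico a b) : ∃ τ, τ ∈ Icc t b ∧ Cut b F w q t τ (q τ) := by
  obtain ⟨τ, hτ, h1, h2⟩ := hw.exists_crossing hF ht
  exact ⟨τ, hτ, hτ.1, hτ.2, fun u hu hu' => (h1 u ⟨hu, hu'⟩).le,
    fun u hu hu' => (h2 u ⟨hu, hu'⟩).le, fun u _ hu' => hq hu'.le, fun u hu _ => hq hu.le⟩

/-- The crossing type is unique. -/
lemma Cut.unique (hF : FullLaw a b F) (hw : Hump a b F w p) {t τ τ' x x' : ℝ} (ht : t ∈ Ico a b)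
    (h1 : Cut b F w q t τ x) (h2 : Cut b F w q t τ' x') : τ = τ' := by
  have key : ∀ {τ τ' x x' : ℝ}, Cut b F w q t τ x → Cut b F w q t τ' x' → τ' ≤ τ := by
    intro τ τ' x x' h1 h2
    by_contra! hlt
    obtain ⟨u, hu⟩ := exists_between hlt
    obtain ⟨v, hv⟩ := exists_between hu.2
    have e1 := h1.gap_nonpos u hu.1 (hu.2.trans_le h2.le_right)
    have e2 := hw.tailGap_neg hF ht.1 (h1.left_le.trans_lt hu.1) hv.1 (hv.2.trans_le h2.le_right) e1
    have e3 := h2.gap_nonneg v ((h1.left_le.trans_lt hu.1).trans hv.1) hv.2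
    linarith
  exact le_antisymm (key h2 h1) (key h1 h2)

/-- The admissible levels form an interval, so the intermediate value theorem in `x` stays among
them. -/
lemma Cut.convex {t τ x x' y : ℝ} (h1 : Cut b F w q t τ x) (h2 : Cut b F w q t τ x')
    (hy : y ∈ Icc x x') : Cut b F w q t τ y :=
  ⟨h1.left_le, h1.le_right, h1.gap_nonneg, h1.gap_nonpos,
    fun u hu hu' => (h1.le_cut u hu hu').trans hy.1,
    fun u hu hu' => hy.2.trans (h2.cut_le u hu hu')⟩

/-- `Cut` imposes weak inequalities under strict premises, and an implication from an open condition
to a closed one is closed. -/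
lemma isClosed_cut (hw : Hump a b F w p) :
    IsClosed {z : ℝ × ℝ × ℝ | Cut b F w q z.1 z.2.1 z.2.2} := by
  have hcont : ∀ u, Continuous fun z : ℝ × ℝ × ℝ => tailGap b F w z.1 u := fun u => by
    have h1 := continuous_tailMass (F := F) b
    have h2 := hw.continuous_tailWeight b
    unfold tailGap; fun_prop
  have heq : {z : ℝ × ℝ × ℝ | Cut b F w q z.1 z.2.1 z.2.2} =
      {z | z.1 ≤ z.2.1} ∩ {z | z.2.1 ≤ b} ∩
      (⋂ u, {z | z.1 < u → u < z.2.1 → 0 ≤ tailGap b F w z.1 u}) ∩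
      (⋂ u, {z | z.2.1 < u → u < b → tailGap b F w z.1 u ≤ 0}) ∩
      (⋂ u, {z | z.1 < u → u < z.2.1 → q u ≤ z.2.2}) ∩
      (⋂ u, {z | z.2.1 < u → u < b → z.2.2 ≤ q u}) := by
    ext z
    simp only [mem_ofPred_eq, mem_inter_iff, mem_iInter]
    exact ⟨fun h => ⟨⟨⟨⟨⟨h.1, h.2⟩, h.3⟩, h.4⟩, h.5⟩, h.6⟩,
      fun h => ⟨h.1.1.1.1.1, h.1.1.1.1.2, h.1.1.1.2, h.1.1.2, h.1.2, h.2⟩⟩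
  rw [heq]
  refine IsClosed.inter (IsClosed.inter (IsClosed.inter (IsClosed.inter (IsClosed.inter ?_ ?_)
    ?_) ?_) ?_) ?_
  · exact isClosed_le (by fun_prop) (by fun_prop)
  · exact isClosed_le (by fun_prop) (by fun_prop)
  · exact isClosed_iInter fun u => isClosed_imp (isOpen_lt (by fun_prop) (by fun_prop))
      (isClosed_imp (isOpen_lt (by fun_prop) (by fun_prop))
        (isClosed_le (by fun_prop) (hcont u)))
  · exact isClosed_iInter fun u => isClosed_imp (isOpen_lt (by fun_prop) (by fun_prop))
      (isClosed_imp (isOpen_lt (by fun_prop) (by fun_prop))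
        (isClosed_le (hcont u) (by fun_prop)))
  · exact isClosed_iInter fun u => isClosed_imp (isOpen_lt (by fun_prop) (by fun_prop))
      (isClosed_imp (isOpen_lt (by fun_prop) (by fun_prop))
        (isClosed_le (by fun_prop) (by fun_prop)))
  · exact isClosed_iInter fun u => isClosed_imp (isOpen_lt (by fun_prop) (by fun_prop))
      (isClosed_imp (isOpen_lt (by fun_prop) (by fun_prop))
        (isClosed_le (by fun_prop) (by fun_prop)))

/-- The deficit above `t` has to vanish with `f t ≤ x`, unless `t` is the lowest type, where a
negative deficit can be paid out to everyone. Neither `τ` nor `x` need depend continuously on `t`,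
so instead of following a path the proof covers `[a, tm]` by two closed sets, the projections of
admissible triples with too large and with too small a deficit, and uses connectedness. -/
lemma exists_candidate (T : Technology a b c h f) (hF : FullLaw a b F) (hw : Hump a b F w p)
    (hq : Monotone q) (hq0 : ∀ u, 0 ≤ q u) :
    ∃ t τ x, t ∈ Icc a p ∧ 0 ≤ x ∧
      (∀ θ ∈ Ico a t, w θ * tailMass b F t ≤ tailWeight b F w t) ∧ Cut b F w q t τ x ∧
      ((f t ≤ x ∧ deficit b c h f q F t x = 0) ∨
        (t = a ∧ (f a ≤ x → deficit b c h f q F a x ≤ 0))) := by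
  obtain ⟨tm, htm, hE, hgap⟩ := hw.exists_max hF
  have hpb := hw.peak_mem.2
  have hsub : Icc a tm ⊆ Icc a b := Icc_subset_Icc le_rfl (htm.2.trans hpb.le)
  have hIco : ∀ t ∈ Icc a tm, t ∈ Ico a b := fun t ht => ⟨ht.1, ht.2.trans_lt (htm.2.trans_lt hpb)⟩
  -- Compactness of the set of admissible triples makes its closed pieces project to closed sets of
  -- `t`.
  set R : Set (ℝ × ℝ × ℝ) := {z | Cut b F w q z.1 z.2.1 z.2.2} ∩
    (Icc a tm ×ˢ (Icc a b ×ˢ Icc 0 (max (q b) 0))) with hR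
  have hRc : IsCompact R := (isCompact_Icc.prod (isCompact_Icc.prod isCompact_Icc)).inter_left
    (isClosed_cut hw)
  have hKR : ContinuousOn (fun z : ℝ × ℝ × ℝ => deficit b c h f q F z.1 z.2.2) R :=
    (deficit_continuousOn T hq hq0).comp (by fun_prop : Continuous fun z : ℝ × ℝ × ℝ =>
      (z.1, z.2.2)).continuousOn fun z hz => ⟨hsub hz.2.1, mem_univ _⟩
  have hG1 : IsCompact (R ∩ ({z | f z.1 ≤ z.2.2} ∩
      (fun z => deficit b c h f q F z.1 z.2.2) ⁻¹' Ici 0)) := by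
    have h1 := hKR.preimage_isClosed_of_isClosed hRc.isClosed (isClosed_Ici (a := (0 : ℝ)))
    have h2 : IsClosed {z : ℝ × ℝ × ℝ | f z.1 ≤ z.2.2} :=
      isClosed_le (T.f_cont.comp continuous_fst) (by fun_prop)
    have : IsClosed (R ∩ ({z | f z.1 ≤ z.2.2} ∩
      (fun z => deficit b c h f q F z.1 z.2.2) ⁻¹' Ici 0)) := by
      convert h1.inter h2 using 1
      ext z; simp only [mem_inter_iff]; tauto
    exact hRc.of_isClosed_subset this inter_subset_left
  have hG2 : IsCompact (R ∩ ({z | z.2.2 ≤ f z.1} ∪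
      (fun z => deficit b c h f q F z.1 z.2.2) ⁻¹' Iic 0)) := by
    have h1 := hKR.preimage_isClosed_of_isClosed hRc.isClosed (isClosed_Iic (a := (0 : ℝ)))
    have h2 : IsClosed {z : ℝ × ℝ × ℝ | z.2.2 ≤ f z.1} :=
      isClosed_le (by fun_prop) (T.f_cont.comp continuous_fst)
    have : IsClosed (R ∩ ({z | z.2.2 ≤ f z.1} ∪
      (fun z => deficit b c h f q F z.1 z.2.2) ⁻¹' Iic 0)) := by
      convert h1.union (hRc.isClosed.inter h2) using 1
      ext z; simp only [mem_inter_iff, mem_union]; tauto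
    exact hRc.of_isClosed_subset this inter_subset_left
  set G1 := Prod.fst '' (R ∩ ({z | f z.1 ≤ z.2.2} ∩
      (fun z => deficit b c h f q F z.1 z.2.2) ⁻¹' Ici 0)) with hG1'
  set G2 := Prod.fst '' (R ∩ ({z | z.2.2 ≤ f z.1} ∪
      (fun z => deficit b c h f q F z.1 z.2.2) ⁻¹' Iic 0)) with hG2'
  have hmemR : ∀ t ∈ Icc a tm, ∃ τ x, (t, τ, x) ∈ R := by
    intro t ht
    obtain ⟨τ, hτ, hcut⟩ := exists_cut hF hw hq (hIco t ht)
    exact ⟨τ, q τ, hcut, ht, ⟨ht.1.trans hτ.1, hτ.2⟩, hq0 τ, le_max_of_le_left (hq hτ.2)⟩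
  by_cases haG : a ∈ G1
  · have hcover : Icc a tm ⊆ G1 ∪ G2 := by
      intro t ht
      obtain ⟨τ, x, hz⟩ := hmemR t ht
      rcases le_total x (f t) with h1 | h1
      · exact Or.inr ⟨_, ⟨hz, Or.inl h1⟩, rfl⟩
      · rcases le_total 0 (deficit b c h f q F t x) with h2 | h2
        · exact Or.inl ⟨_, ⟨hz, h1, h2⟩, rfl⟩
        · exact Or.inr ⟨_, ⟨hz, Or.inr h2⟩, rfl⟩
    -- No tail above `tm` has an above-average weight, so the crossing may be placed at `tm` itself
    -- and the level `0` is admissible.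
    have htmG : tm ∈ G2 := by
      refine ⟨(tm, tm, 0), ⟨⟨?_, ⟨htm.1, le_rfl⟩, ⟨htm.1, htm.2.trans hpb.le⟩, le_rfl,
        le_max_right _ _⟩, Or.inl (T.f_pos _).le⟩, rfl⟩
      exact ⟨le_rfl, htm.2.trans hpb.le, fun u h1 h2 => absurd (h1.trans h2) (lt_irrefl _),
        fun u h1 h2 => hgap u ⟨h1, h2⟩, fun u h1 h2 => absurd (h1.trans h2) (lt_irrefl _),
        fun u _ _ => hq0 u⟩
    obtain ⟨t, ht, ⟨⟨t1, τ1, x1⟩, ⟨hz1, hx1, hk1⟩, e1⟩, ⟨⟨t2, τ2, x2⟩, ⟨hz2, hk2⟩, e2⟩⟩ :=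
      isPreconnected_closed_iff.1 (isPreconnected_Icc (a := a) (b := tm)) G1 G2
        (hG1.image continuous_fst).isClosed (hG2.image continuous_fst).isClosed hcover
        ⟨a, ⟨le_rfl, htm.1⟩, haG⟩ ⟨tm, ⟨htm.1, le_rfl⟩, htmG⟩
    have e1' : t = t1 := e1.symm
    subst e1'
    have e2' : t = t2 := e2.symm
    subst e2'
    simp only [mem_preimage, mem_Ici] at hk1
    have hτ : τ2 = τ1 := Cut.unique hF hw (hIco t ht) hz2.1 hz1.1
    subst hτ
    have c1 : Cut b F w q t τ2 x1 := hz1.1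
    have c2 : Cut b F w q t τ2 x2 := hz2.1
    have hx1' : f t ≤ x1 := hx1
    -- A level below `f t` can be raised to `f t`: this stays admissible by convexity and has a
    -- nonpositive deficit.
    obtain ⟨x3, c3, hx3, hk3⟩ : ∃ x3, Cut b F w q t τ2 x3 ∧ f t ≤ x3 ∧
        deficit b c h f q F t x3 ≤ 0 := by
      rcases le_total x2 (f t) with h1 | h1
      · exact ⟨f t, c2.convex c1 ⟨h1, hx1'⟩, le_rfl, deficit_nonpos T hq hq0 (hsub ht)⟩
      · rcases hk2 with h2 | h2
        · have h2' : x2 ≤ f t := h2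
          have h2'' : x2 = f t := le_antisymm h2' h1
          exact ⟨f t, h2'' ▸ c2, le_rfl, deficit_nonpos T hq hq0 (hsub ht)⟩
        · exact ⟨x2, c2, h1, h2⟩
    have hcx : Continuous fun x => deficit b c h f q F t x :=
      ((deficit_continuousOn (F := F) T hq hq0).comp_continuous
        (Continuous.prodMk_right t) fun x => ⟨hsub ht, mem_univ _⟩)
    obtain ⟨x, hx, hx0⟩ : (0 : ℝ) ∈ (fun x => deficit b c h f q F t x) '' uIcc x3 x1 :=
      intermediate_value_uIcc hcx.continuousOn (by rw [uIcc_of_le (hk3.trans hk1)]; exact ⟨hk3, hk1⟩)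
    have hfx : f t ≤ x := (le_min hx3 hx1').trans hx.1
    refine ⟨t, τ2, x, ⟨ht.1, ht.2.trans htm.2⟩, (T.f_pos t).le.trans hfx, hE t ht, ?_,
      Or.inl ⟨hfx, hx0⟩⟩
    rcases le_total x3 x1 with h | h
    · rw [uIcc_of_le h] at hx; exact c3.convex c1 hx
    · rw [uIcc_of_ge h] at hx; exact c1.convex c3 hx
  -- Here every admissible level at `a` is below `f a` or has a negative deficit, so any admissible
  -- triple at `a` will do.
  · obtain ⟨τ, x, hz⟩ := hmemR a ⟨le_rfl, htm.1⟩
    refine ⟨a, τ, x, ⟨le_rfl, hw.peak_mem.1.le⟩, hz.2.2.2.1,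
      fun θ hθ => absurd hθ.2 (not_lt.2 hθ.1), hz.1, Or.inr ⟨rfl, fun hx => ?_⟩⟩
    by_contra! hc
    exact haG ⟨_, ⟨hz, hx, hc.le⟩, rfl⟩

end Candidate
end RatingDesign

/-! ### Schedules, plans, and the decomposition of welfare differences -/

namespace RatingDesign
open Filter Topology
noncomputable section Comparison
set_option linter.unusedSectionVars false

/-- The excess of the price over quality, for profits `U`. -/
def excess (c : ℝ → ℝ → ℝ) (q U : ℝ → ℝ) (θ : ℝ) : ℝ := U θ - surplus c (q θ) θ

/-- Increasing qualities and profits that are related by the envelope formula. -/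
structure Schedule (h : ℝ → ℝ → ℝ) (q U : ℝ → ℝ) : Prop where
  mono : Monotone q
  nonneg : ∀ u, 0 ≤ q u
  env : ∀ u v, U v - U u = ∫ z in u..v, h (q z) z

/-- Schedules that satisfy participation and majorization. -/
structure Plan (a b : ℝ) (c h : ℝ → ℝ → ℝ) (F : Measure ℝ) (q U : ℝ → ℝ) : Prop
    extends Schedule h q U where
  part : 0 ≤ U a
  slack : ∀ t ∈ Icc a b, 0 ≤ ∫ θ in a..t, excess c q U θ ∂F
  balance : ∫ θ in a..b, excess c q U θ ∂F = 0

/-- Plans that maximize weighted profits. -/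
structure OptimalPlan (a b : ℝ) (c h : ℝ → ℝ → ℝ) (F : Measure ℝ) (w q U : ℝ → ℝ) : Prop
    extends Plan a b c h F q U where
  optimal : ∀ q' U', Plan a b c h F q' U' →
    ∫ θ in a..b, w θ * U' θ ∂F ≤ ∫ θ in a..b, w θ * U θ ∂F

variable {a b : ℝ} {c h : ℝ → ℝ → ℝ} {f q U q' U' w : ℝ → ℝ} {p : ℝ} {F : Measure ℝ}
  [IsProbabilityMeasure F] [NullSingletonClass F]

lemma Schedule.of_rent (T : Technology a b c h f) (hq : Monotone q) (hq0 : ∀ u, 0 ≤ q u)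
    (k t : ℝ) : Schedule h q fun θ => k + ∫ z in t..θ, h (q z) z :=
  ⟨hq, hq0, fun u v => rent_sub T hq k t u v⟩

lemma Schedule.continuous (S : Schedule h q U) (T : Technology a b c h f) : Continuous U := by
  have : U = fun θ => U a + ∫ z in a..θ, h (q z) z := by
    ext θ; have := S.env a θ; linarith
  rw [this]
  exact continuous_const.add (continuous_rent T S.mono a)

lemma Schedule.excess_integrable (S : Schedule h q U) (T : Technology a b c h f) (u v : ℝ) :
    IntervalIntegrable (excess c q U) F u v :=
  ((S.continuous T).intervalIntegrable _ _).sub (T.surplus_integrable S.mono F _ _)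

lemma Schedule.excess_le (S : Schedule h q U) (T : Technology a b c h f) {x u v : ℝ}
    (hu : u ∈ Icc a b) (hv : v ∈ Icc a b) (huv : u ≤ v)
    (hx : ∀ z ∈ Icc u v, x ≤ q z ∧ q z ≤ max (f z) x) :
    excess c q U v ≤ excess c q U u :=
  (T.gap_antitone S.mono S.nonneg (fun u _ v _ _ => S.env u v) hu hv huv hx).1

lemma Schedule.excess_lt (S : Schedule h q U) (T : Technology a b c h f) {x u v : ℝ}
    (hu : u ∈ Icc a b) (hv : v ∈ Icc a b) (huv : u ≤ v)
    (hx : ∀ z ∈ Icc u v, x ≤ q z ∧ q z ≤ max (f z) x) (h1 : q u < f u) (h2 : q u < q v) :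
    excess c q U v < excess c q U u :=
  (T.gap_antitone S.mono S.nonneg (fun u _ v _ _ => S.env u v) hu hv huv hx).2 h1 h2

lemma Schedule.excess_nonneg (S : Schedule h q U) (T : Technology a b c h f) {x t v : ℝ}
    (ht : t ∈ Icc a b) (hv : v ∈ Icc a b) (htv : t ≤ v)
    (hx : ∀ z ∈ Ioc t v, min (f z) x ≤ q z ∧ q z ≤ x) (hxt : f t ≤ x)
    (hU : surplus c (f t) t ≤ U t) : 0 ≤ excess c q U v :=
  T.gap_nonneg S.mono S.nonneg (fun u _ v _ _ => S.env u v) ht hv htv hx hxt hU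

/-- A function that is first nonnegative in the mean, then nonnegative and finally decreasing has a
nonnegative primitive if its integral vanishes. -/
lemma primitive_nonneg {D : ℝ → ℝ} {t τ : ℝ} (ht : a ≤ t) (htτ : t ≤ τ)
    (hD : ∀ u v, IntervalIntegrable D F u v) (h0 : ∀ u ∈ Icc a t, 0 ≤ ∫ z in a..u, D z ∂F)
    (h1 : ∀ z ∈ Ioo t τ, 0 ≤ D z) (h2 : ∀ u ∈ Ioo τ b, ∀ v ∈ Ioo τ b, u ≤ v → D v ≤ D u)
    (hb : ∫ z in a..b, D z ∂F = 0) {u : ℝ} (hu : u ∈ Icc a b) : 0 ≤ ∫ z in a..u, D z ∂F := by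
  rcases le_total u t with hut | hut
  · exact h0 u ⟨hu.1, hut⟩
  have hadd : ∀ x y, (∫ z in a..x, D z ∂F) + ∫ z in x..y, D z ∂F = ∫ z in a..y, D z ∂F :=
    fun x y => intervalIntegral.integral_add_adjacent_intervals (hD _ _) (hD _ _)
  have hlow : ∀ v ∈ Icc t τ, 0 ≤ ∫ z in a..v, D z ∂F := by
    intro v hv
    rw [← hadd t v]
    exact add_nonneg (h0 t ⟨ht, le_rfl⟩)
      (integral_nonneg_Ioo hv.1 fun z hz => h1 z ⟨hz.1, hz.2.trans_le hv.2⟩)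
  rcases le_total u τ with huτ | huτ
  · exact hlow u ⟨hut, huτ⟩
  -- A negative primitive at some `u` beyond `τ` forces `D < 0` somewhere in `(τ, u)`, hence from
  -- `u` on, and the total could not return to zero.
  by_contra! hneg
  obtain ⟨z, hz, hz0⟩ : ∃ z ∈ Ioo τ u, D z < 0 := by
    by_contra! hcon
    have := integral_nonneg_Ioo (F := F) huτ hcon
    have := hadd τ u
    have := hlow τ ⟨htτ, le_rfl⟩
    linarith
  have h3 : 0 ≤ ∫ z in u..b, - D z ∂F := integral_nonneg_Ioo hu.2 fun y hy => by
    have := h2 z ⟨hz.1, hz.2.trans_le hu.2⟩ y ⟨huτ.trans_lt hy.1, hy.2⟩ (hz.2.trans hy.1).le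
    linarith
  rw [intervalIntegral.integral_neg] at h3
  have := hadd u b
  linarith

/-- A criterion for schedules to satisfy majorization. -/
lemma Schedule.plan (S : Schedule h q U) (T : Technology a b c h f) {t τ x : ℝ} (ht : a ≤ t)
    (htτ : t ≤ τ) (hτ : τ ≤ b) (hpart : 0 ≤ U a)
    (h0 : ∀ u ∈ Icc a t, 0 ≤ ∫ z in a..u, excess c q U z ∂F)
    (h1 : ∀ z ∈ Ioo t τ, min (f z) x ≤ q z ∧ q z ≤ x)
    (h2 : ∀ z ∈ Ioo τ b, x ≤ q z ∧ q z ≤ max (f z) x)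
    (hst : t = τ ∨ (f t ≤ x ∧ surplus c (f t) t ≤ U t))
    (hb : ∫ z in a..b, excess c q U z ∂F = 0) : Plan a b c h F q U := by
  refine ⟨S, hpart, fun u hu => ?_, hb⟩
  refine primitive_nonneg ht htτ (S.excess_integrable T) h0 (fun z hz => ?_)
    (fun u hu v hv huv => ?_) hb hu
  · rcases hst with rfl | ⟨h3, h4⟩
    · exact absurd (hz.1.trans hz.2) (lt_irrefl _)
    · exact S.excess_nonneg T ⟨ht, htτ.trans hτ⟩ ⟨ht.trans hz.1.le, hz.2.le.trans hτ⟩ hz.1.le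
        (fun y hy => h1 y ⟨hy.1, hy.2.trans_lt hz.2⟩) h3 h4
  · have haτ := ht.trans htτ
    exact S.excess_le T ⟨haτ.trans hu.1.le, hu.2.le⟩ ⟨haτ.trans hv.1.le, hv.2.le⟩ huv
      fun z hz => h2 z ⟨hu.1.trans_le hz.1, hz.2.trans_lt hv.2⟩

/-- The difference in welfare between two schedules with the same total excess. -/
lemma welfare_sub (T : Technology a b c h f) (hw : Hump a b F w p) (S' : Schedule h q' U')
    (S : Schedule h q U) (hD : ∫ θ in a..b, excess c q' U' θ ∂F = ∫ θ in a..b, excess c q U θ ∂F)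
    {t : ℝ} (ht : t ≤ b) :
    tailMass b F t * (∫ θ in a..b, w θ * U' θ ∂F - ∫ θ in a..b, w θ * U θ ∂F) =
      (∫ θ in a..t, (tailMass b F t * w θ - tailWeight b F w t) * (U' θ - U θ) ∂F) +
      tailWeight b F w t * (∫ θ in a..b, (surplus c (q' θ) θ - surplus c (q θ) θ) ∂F) +
      ∫ u in t..b, (h (q' u) u - h (q u) u) * tailGap b F w t u := by
  set m := tailMass b F t
  set W := tailWeight b F w t
  have hc := S.continuous T
  have hc' := S'.continuous T
  have iU : ∀ {V : ℝ → ℝ}, Continuous V → ∀ u v, IntervalIntegrable (fun θ => w θ * V θ) F u v :=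
    fun hV u v => (hw.intervalIntegrable u v).mul_continuousOn hV.continuousOn
  have iG : ∀ u v, IntervalIntegrable (fun θ => U' θ - U θ) F u v :=
    fun u v => (hc'.sub hc).intervalIntegrable _ _
  have is : ∀ u v, IntervalIntegrable (fun θ => surplus c (q' θ) θ - surplus c (q θ) θ) F u v :=
    fun u v => (T.surplus_integrable S'.mono F _ _).sub (T.surplus_integrable S.mono F _ _)
  have ig : ∀ u v, IntervalIntegrable (fun θ => (m * w θ - W) * (U' θ - U θ)) F u v :=
    fun u v => (hw.gap_integrable m W u v).mul_continuousOn (hc'.sub hc).continuousOn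
  -- With equal total excess, total profits differ exactly as total surplus does.
  have e1 : ∫ θ in a..b, (U' θ - U θ) ∂F =
      ∫ θ in a..b, (surplus c (q' θ) θ - surplus c (q θ) θ) ∂F := by
    have h1 : ∫ θ in a..b, ((U' θ - U θ) - (surplus c (q' θ) θ - surplus c (q θ) θ)) ∂F =
        ∫ θ in a..b, (excess c q' U' θ - excess c q U θ) ∂F :=
      intervalIntegral.integral_congr fun θ _ => by simp only [excess]; ring
    rw [intervalIntegral.integral_sub (S'.excess_integrable T _ _) (S.excess_integrable T _ _), hD,
      intervalIntegral.integral_sub (iG _ _) (is _ _)] at h1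
    linarith
  have e2 : m * (∫ θ in a..b, w θ * U' θ ∂F - ∫ θ in a..b, w θ * U θ ∂F) =
      (∫ θ in a..b, (m * w θ - W) * (U' θ - U θ) ∂F) + W * ∫ θ in a..b, (U' θ - U θ) ∂F := by
    rw [← intervalIntegral.integral_sub (iU hc' _ _) (iU hc _ _),
      ← intervalIntegral.integral_const_mul, ← intervalIntegral.integral_const_mul,
      ← intervalIntegral.integral_add (ig _ _)
        ((iG _ _).const_mul _)]
    exact intervalIntegral.integral_congr fun θ _ => by ring
  -- Above `t` the centred weight integrates to zero, so the constant `U' t - U t` drops out.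
  -- Exchanging the integrals then attaches to each marginal rent the centred weight of all types
  -- above it.
  have e3 : ∫ θ in t..b, (m * w θ - W) * (U' θ - U θ) ∂F =
      ∫ u in t..b, (h (q' u) u - h (q u) u) * tailGap b F w t u := by
    have ik := (T.rent_integrable S'.mono t b).sub (T.rent_integrable S.mono t b)
    have h0 : ∫ θ in t..b, (m * w θ - W) ∂F = 0 := by
      rw [← hw.tailGap_sub, tailGap_self, tailGap_end, sub_zero]
    have h1 : ∀ u, ∫ θ in u..b, (m * w θ - W) ∂F = tailGap b F w t u := by
      intro u; rw [← hw.tailGap_sub, tailGap_end, sub_zero]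
    have h2 : ∀ θ, (m * w θ - W) * (U' θ - U θ) = (m * w θ - W) * (U' t - U t) +
        (m * w θ - W) * ∫ u in t..θ, (h (q' u) u - h (q u) u) := by
      intro θ
      rw [intervalIntegral.integral_sub (T.rent_integrable S'.mono t θ)
        (T.rent_integrable S.mono t θ), ← S'.env, ← S.env]; ring
    simp_rw [h2]
    rw [intervalIntegral.integral_add ((hw.gap_integrable m W _ _).mul_const _),
      intervalIntegral.integral_mul_const, h0, zero_mul, zero_add,
      integral_mul_primitive ht (hw.gap_integrable m W _ _) ik]
    · simp_rw [h1]
    · refine (hw.gap_integrable m W _ _).mul_continuousOn (Continuous.continuousOn ?_)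
      exact intervalIntegral.continuous_primitive (fun u v =>
        (T.rent_integrable S'.mono u v).sub (T.rent_integrable S.mono u v)) t
  rw [e2, e1, ← intervalIntegral.integral_add_adjacent_intervals (ig a t) (ig t b), e3]
  ring

lemma Hump.pos {p : ℝ} (hw : Hump a b F w p) {θ : ℝ} (hθ : θ ∈ Ioo a b) : 0 < w θ := by
  have hab := hθ.1.trans hθ.2
  have := hw.min_lt le_rfl hθ.1 hθ.2 le_rfl
  have h1 := hw.nonneg a ⟨le_rfl, hab.le⟩
  have h2 := hw.nonneg b ⟨hab.le, le_rfl⟩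
  exact (le_min h1 h2).trans_lt this

lemma Hump.tailWeight_pos (hF : FullLaw a b F) (hw : Hump a b F w p) {t : ℝ} (ht : t ∈ Ico a b) :
    0 < tailWeight b F w t :=
  hF.integral_pos ht.1 ht.2 le_rfl (hw.intervalIntegrable _ _) fun _ hz =>
    hw.pos ⟨ht.1.trans_lt hz.1, hz.2⟩

/-- A monotone function that is dominated by a continuous one on a dense set is dominated
everywhere. -/
lemma le_of_dense (hq : Monotone q) {g : ℝ → ℝ} (hg : Continuous g) {u v : ℝ}
    (hd : ∀ u' v', u ≤ u' → u' < v' → v' ≤ v → ∃ z ∈ Ioo u' v', q z ≤ g z) {θ : ℝ}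
    (hθ : θ ∈ Ico u v) : q θ ≤ g θ := by
  by_contra! hlt
  obtain ⟨ε, hε, hb⟩ := Metric.isOpen_iff.1 (isOpen_lt hg (continuous_const (y := q θ))) θ hlt
  obtain ⟨z, hz, hzq⟩ := hd θ (min v (θ + ε)) hθ.1 (lt_min hθ.2 (by linarith)) (min_le_left _ _)
  have h1 : g z < q θ := hb (by
    rw [Metric.mem_ball, Real.dist_eq, abs_of_pos (sub_pos.2 hz.1)]
    linarith [(lt_min_iff.1 hz.2).2])
  have := hq hz.1.le
  linarith

lemma ge_of_dense (hq : Monotone q) {g : ℝ → ℝ} (hg : Continuous g) {u v : ℝ}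
    (hd : ∀ u' v', u ≤ u' → u' < v' → v' ≤ v → ∃ z ∈ Ioo u' v', g z ≤ q z) {θ : ℝ}
    (hθ : θ ∈ Ioc u v) : g θ ≤ q θ := by
  by_contra! hlt
  obtain ⟨ε, hε, hb⟩ := Metric.isOpen_iff.1 (isOpen_lt (continuous_const (y := q θ)) hg) θ hlt
  obtain ⟨z, hz, hzq⟩ := hd (max u (θ - ε)) θ (le_max_left _ _) (max_lt hθ.1 (by linarith)) hθ.2
  have h1 : q θ < g z := hb (by
    rw [Metric.mem_ball, Real.dist_eq, abs_of_neg (sub_neg.2 hz.2)]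
    linarith [(max_lt_iff.1 hz.1).2])
  have := hq hz.2.le
  linarith

end Comparison
end RatingDesign

/-! ### Feasibility of the median deviation -/

namespace RatingDesign
open Filter Topology
noncomputable section Improvement
set_option linter.unusedSectionVars false

variable {a b : ℝ} {c h : ℝ → ℝ → ℝ} {f q U q' U' w : ℝ → ℝ} {p : ℝ} {F : Measure ℝ}
  [IsProbabilityMeasure F] [NullSingletonClass F]

/-- The schedule that is first best (capped at `x`) up to `t`, and the median of `q`, the first best
and `x` above `t`. -/
def candidate (q f : ℝ → ℝ) (t x θ : ℝ) : ℝ := if θ ≤ t then min (f θ) x else med q f x θ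

/-- Profits under the schedule `candidate q f t x` that exhaust the budget above `t`. -/
def candidateProfit (b : ℝ) (c h : ℝ → ℝ → ℝ) (F : Measure ℝ) (q f : ℝ → ℝ) (t x θ : ℝ) : ℝ :=
  (surplus c (f t) t - deficit b c h f q F t x) + ∫ z in t..θ, h (candidate q f t x z) z

lemma candidate_of_lt {t x θ : ℝ} (hθ : t < θ) : candidate q f t x θ = med q f x θ :=
  if_neg (not_le.2 hθ)

lemma candidate_mono (T : Technology a b c h f) (hq : Monotone q) (t x : ℝ) :
    Monotone (candidate q f t x) := by
  intro u v huv
  unfold candidate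
  split_ifs with h1 h2 h2
  · exact min_le_min (T.f_mono huv) le_rfl
  · exact (min_le_min (T.f_mono huv) le_rfl).trans min_le_med
  · exact absurd (huv.trans h2) h1
  · exact med_mono hq T.f_mono x huv

lemma candidate_nonneg (T : Technology a b c h f) (hq0 : ∀ u, 0 ≤ q u) {t x : ℝ} (hx : 0 ≤ x)
    (u : ℝ) : 0 ≤ candidate q f t x u := by
  unfold candidate
  split_ifs
  · exact le_min (T.f_pos u).le hx
  · exact med_nonneg (hq0 u) (T.f_pos u).le

lemma candidate_schedule (T : Technology a b c h f) (hq : Monotone q) (hq0 : ∀ u, 0 ≤ q u)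
    {t x : ℝ} (hx : 0 ≤ x) :
    Schedule h (candidate q f t x) (candidateProfit b c h F q f t x) :=
  Schedule.of_rent T (candidate_mono T hq t x) (candidate_nonneg T hq0 hx) _ _

lemma candidate_of_le (T : Technology a b c h f) {t x θ : ℝ} (hx : f t ≤ x) (hθ : θ ≤ t) :
    candidate q f t x θ = f θ := by
  rw [candidate, if_pos hθ, min_eq_left ((T.f_mono hθ).trans hx)]

lemma candidateProfit_of_le (T : Technology a b c h f) {t x θ : ℝ} (hx : f t ≤ x)
    (ht : t ∈ Icc a b) (hθ : θ ∈ Icc a t) : candidateProfit b c h F q f t x θ =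
      surplus c (f θ) θ - deficit b c h f q F t x := by
  have h1 : ∫ z in θ..t, h (candidate q f t x z) z = ∫ z in θ..t, h (f z) z := by
    refine intervalIntegral.integral_congr fun z hz => ?_
    rw [uIcc_of_le hθ.2] at hz
    simp only [candidate_of_le T hx hz.2]
  have h2 := T.firstBest_envelope ⟨hθ.1, hθ.2.trans ht.2⟩ ht hθ.2
  rw [candidateProfit, intervalIntegral.integral_symm, h1, ← h2]
  ring

lemma candidate_balance (T : Technology a b c h f) (hF : FullLaw a b F) (hq : Monotone q)
    (hq0 : ∀ u, 0 ≤ q u) {t x : ℝ} (hx0 : 0 ≤ x) (ht : t ∈ Icc a b)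
    (hx : (f t ≤ x ∧ deficit b c h f q F t x = 0) ∨ t = a) :
    ∫ θ in a..b, excess c (candidate q f t x) (candidateProfit b c h F q f t x) θ ∂F = 0 := by
  have S := candidate_schedule (b := b) (F := F) T hq hq0 (t := t) hx0
  rw [← intervalIntegral.integral_add_adjacent_intervals (S.excess_integrable T a t)
    (S.excess_integrable T t b)]
  have h1 : ∫ θ in a..t, excess c (candidate q f t x) (candidateProfit b c h F q f t x) θ ∂F
      = 0 := by
    rcases hx with ⟨h2, h3⟩ | rfl
    · rw [integral_congr_Ioo (k := fun _ => 0) ht.1]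
      · simp
      · intro θ hθ
        rw [excess, candidateProfit_of_le T h2 ht ⟨hθ.1.le, hθ.2.le⟩, candidate_of_le T h2 hθ.2.le,
          h3]
        ring
    · simp
  have hm := med_mono hq T.f_mono x
  have h2 : ∫ θ in t..b, excess c (candidate q f t x) (candidateProfit b c h F q f t x) θ ∂F =
      ∫ θ in t..b, ((surplus c (f t) t + (∫ z in t..θ, h (med q f x z) z)
        - surplus c (med q f x θ) θ) - deficit b c h f q F t x) ∂F := by
    refine integral_congr_Ioo ht.2 fun θ hθ => ?_
    have : ∫ z in t..θ, h (candidate q f t x z) z = ∫ z in t..θ, h (med q f x z) z := by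
      refine intervalIntegral.integral_congr_uIoo fun z hz => ?_
      rw [uIoo_of_le hθ.1.le] at hz
      simp only [candidate_of_lt hz.1]
    simp only [excess, candidateProfit, this, candidate_of_lt hθ.1]
    ring
  -- Above `t` the total excess is the deficit minus the deficit times the mass of the types above
  -- `t`. This is zero if the deficit is zero, and also if `t = a`, where that mass is one.
  rw [h1, h2, intervalIntegral.integral_sub, intervalIntegral.integral_const', zero_add]
  · change deficit b c h f q F t x - _ = 0
    rcases hx with ⟨_, h3⟩ | rfl
    · rw [h3]; simp
    · have h4 : F (Ioc t b) = 1 := by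
        have h5 : F (Icc t b) = 1 := (prob_compl_eq_zero_iff measurableSet_Icc).1 hF.compl_null
        rwa [← measure_congr Ioc_ae_eq_Icc] at h5
      simp [Measure.real, h4, Ioc_eq_empty (not_lt.2 ht.2)]
  · exact ((continuous_const.add (continuous_rent T hm t)).intervalIntegrable _ _).sub
      (T.surplus_integrable hm F _ _)
  · exact intervalIntegrable_const

/-- If `f t ≤ x`, types up to `t` have a constant nonnegative excess, and `Schedule.plan` handles
the rest. If `x < f t`, then `t = a` and the excess decreases on all of `(a, b)`; a negative profit
at `a` would make every excess negative, against the balanced budget. -/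
lemma candidate_plan (T : Technology a b c h f) (hF : FullLaw a b F) (hq : Monotone q)
    (hq0 : ∀ u, 0 ≤ q u) {t τ x : ℝ} (hx0 : 0 ≤ x) (ht : t ∈ Icc a b) (hcut : Cut b F w q t τ x)
    (hx : (f t ≤ x ∧ deficit b c h f q F t x = 0) ∨
        (t = a ∧ (f a ≤ x → deficit b c h f q F a x ≤ 0))) :
    Plan a b c h F (candidate q f t x) (candidateProfit b c h F q f t x) := by
  have S := candidate_schedule (b := b) (F := F) T hq hq0 (t := t) hx0
  have hbal := candidate_balance T hF hq hq0 hx0 ht (hx.imp_right And.left)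
  rcases le_or_gt (f t) x with hfx | hfx
  · have hd : deficit b c h f q F t x ≤ 0 := by
      rcases hx with h1 | ⟨rfl, h1⟩
      · exact h1.2.le
      · exact h1 hfx
    refine S.plan T ht.1 hcut.left_le hcut.le_right (x := x) ?_ ?_ ?_ ?_ (Or.inr ⟨hfx, ?_⟩) hbal
    · rw [candidateProfit_of_le T hfx ht ⟨le_rfl, ht.1⟩]
      linarith [T.surplus_firstBest_nonneg a]
    · intro u hu
      refine integral_nonneg_Ioo hu.1 fun z hz => ?_
      have hzt := hz.2.le.trans hu.2
      rw [excess, candidateProfit_of_le T hfx ht ⟨hz.1.le, hzt⟩, candidate_of_le T hfx hzt]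
      linarith
    · intro z hz
      rw [candidate_of_lt hz.1]
      exact ⟨min_le_med, med_le_of_le (hcut.le_cut z hz.1 hz.2)⟩
    · intro z hz
      rw [candidate_of_lt (hcut.left_le.trans_lt hz.1)]
      exact ⟨le_med_of_ge (hcut.cut_le z hz.1 hz.2), med_le⟩
    · rw [candidateProfit_of_le T hfx ht ⟨ht.1, le_rfl⟩]
      linarith
  · obtain rfl : t = a := by
      rcases hx with h1 | h1
      · exact absurd h1.1 (not_le.2 hfx)
      · exact h1.1
    have hshape : ∀ z ∈ Ioo t b, x ≤ candidate q f t x z ∧ candidate q f t x z ≤ max (f z) x := by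
      intro z hz
      rw [candidate_of_lt hz.1]
      exact ⟨(le_min (hfx.le.trans (T.f_mono hz.1.le)) le_rfl).trans min_le_med, med_le⟩
    refine S.plan T le_rfl le_rfl ht.2 (x := x) ?_ ?_ ?_ hshape (Or.inl rfl) hbal
    · by_contra! hneg
      have hc := S.continuous T
      obtain ⟨ε, hε, hball⟩ := Metric.isOpen_iff.1 (isOpen_lt hc continuous_const) t hneg
      have hsmall : ∀ z ∈ Ioo t b, z < t + ε →
          excess c (candidate q f t x) (candidateProfit b c h F q f t x) z < 0 := by
        intro z hz hzε
        have h1 : candidateProfit b c h F q f t x z < 0 := hball (by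
          rw [Metric.mem_ball, Real.dist_eq, abs_of_pos (sub_pos.2 hz.1)]; linarith)
        have h2 : 0 ≤ surplus c (candidate q f t x z) z := by
          refine T.surplus_nonneg (S.nonneg z) ((hshape z hz).2.trans (max_le le_rfl ?_))
          exact hfx.le.trans (T.f_mono hz.1.le)
        rw [excess]; linarith
      have hneg : ∀ z ∈ Ioo t b,
          excess c (candidate q f t x) (candidateProfit b c h F q f t x) z < 0 := by
        intro z hz
        rcases lt_or_ge z (t + ε) with h1 | h1
        · exact hsmall z hz h1
        · have h2 : t + ε / 2 ∈ Ioo t b := ⟨by linarith, by linarith [hz.2]⟩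
          refine (S.excess_le T ⟨h2.1.le, h2.2.le⟩ ⟨hz.1.le, hz.2.le⟩ (by linarith)
            fun y hy => hshape y ⟨h2.1.trans_le hy.1, hy.2.trans_lt hz.2⟩).trans_lt
            (hsmall _ h2 (by linarith))
      have := hF.integral_pos le_rfl T.lt le_rfl ((S.excess_integrable T t b).neg)
        (fun z hz => neg_pos.2 (hneg z hz))
      simp only [Pi.neg_apply, intervalIntegral.integral_neg] at this
      linarith
    · intro u hu
      rw [le_antisymm hu.2 hu.1]; simp
    · intro z hz; exact absurd (hz.1.trans hz.2) (lt_irrefl _)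

/-- The form of optimal schedules. -/
structure Pattern (a b : ℝ) (c : ℝ → ℝ → ℝ) (f q U : ℝ → ℝ) (t τ x : ℝ) : Prop where
  le_left : a ≤ t
  left_le : t ≤ τ
  le_right : τ ≤ b
  first_best : ∀ θ ∈ Ioo a t, q θ = f θ
  excess_eq : ∀ θ ∈ Ioo a t, excess c q U θ = 0
  below : ∀ z ∈ Ioo t τ, min (f z) x ≤ q z ∧ q z ≤ x
  above : ∀ z ∈ Ioo τ b, x ≤ q z ∧ q z ≤ max (f z) x
  start : t = τ ∨ (f t ≤ x ∧ surplus c (f t) t ≤ U t)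

end Improvement
end RatingDesign

/-! ### Welfare comparison of an optimal plan with the median deviation -/

namespace RatingDesign
open Filter Topology
noncomputable section OptimalPattern
set_option linter.unusedSectionVars false

variable {a b : ℝ} {c h : ℝ → ℝ → ℝ} {f q U q' U' w : ℝ → ℝ} {p : ℝ} {F : Measure ℝ}
  [IsProbabilityMeasure F] [NullSingletonClass F]

lemma intervalIntegrable_mul_comp {k : ℝ × ℝ → ℝ} (hk : Continuous k) (hq : Monotone q)
    {g : ℝ → ℝ} {u v : ℝ} (huv : u ≤ v) (hg : IntervalIntegrable g F u v) :
    IntervalIntegrable (fun z => g z * k (q z, z)) F u v := by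
  obtain ⟨B, hB⟩ := exists_bound_comp hk hq u v
  have hm : Measurable fun z => k (q z, z) :=
    hk.measurable.comp (hq.measurable.prodMk measurable_id)
  rw [intervalIntegrable_iff_integrableOn_Ioc_of_le huv] at *
  refine Integrable.mul_bdd (c := B) hg hm.aestronglyMeasurable ?_
  filter_upwards [ae_restrict_mem measurableSet_Ioc] with z hz
  exact hB z ⟨hz.1.le, hz.2⟩

/-- Below `t` the factor is nonnegative and decreasing, while the primitive of the excess is
nonnegative by majorization. The clamp and the truncation in `g` only extend the factor to a
nonnegative antitone function on the line. -/
lemma Hump.excess_integral_nonneg (hw : Hump a b F w p) (S : Plan a b c h F q U)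
    (T : Technology a b c h f) {t : ℝ} (ht : t ∈ Icc a p)
    (hE : ∀ θ ∈ Ico a t, w θ * tailMass b F t ≤ tailWeight b F w t) (hm : 0 ≤ tailMass b F t) :
    0 ≤ ∫ θ in a..t, (tailWeight b F w t - tailMass b F t * w θ) * excess c q U θ ∂F := by
  set g : ℝ → ℝ := fun θ => max 0 (tailWeight b F w t - tailMass b F t * w (max a (min θ p)))
  have hg : Antitone g := by
    intro u v huv
    refine max_le_max le_rfl (sub_le_sub_left (mul_le_mul_of_nonneg_left ?_ hm) _)
    refine hw.increasing.monotoneOn ?_ ?_ (max_le_max le_rfl (min_le_min huv le_rfl))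
    · exact ⟨le_max_left _ _, max_le hw.peak_mem.1.le (min_le_right _ _)⟩
    · exact ⟨le_max_left _ _, max_le hw.peak_mem.1.le (min_le_right _ _)⟩
  have h1 := integral_mul_nonneg_of_antitone ht.1 hg (fun z => le_max_left _ _)
    (S.excess_integrable (F := F) T a t)
    (fun u hu => S.slack u ⟨hu.1, hu.2.trans (ht.2.trans hw.peak_mem.2.le)⟩)
  refine h1.trans_eq (integral_congr_Ioo ht.1 fun θ hθ => ?_)
  have h2 : max a (min θ p) = θ := by
    rw [min_eq_left (hθ.2.le.trans ht.2), max_eq_right hθ.1.le]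
  have h3 := hE θ ⟨hθ.1.le, hθ.2⟩
  simp only [g, h2]
  rw [max_eq_right (by linarith)]

/-- All terms in the welfare comparison of an optimal plan with its candidate improvement vanish. -/
lemma OptimalPlan.comparison (O : OptimalPlan a b c h F w q U) (T : Technology a b c h f)
    (hF : FullLaw a b F) (hw : Hump a b F w p) {t τ x : ℝ} (hx0 : 0 ≤ x) (ht : t ∈ Icc a p)
    (hE : ∀ θ ∈ Ico a t, w θ * tailMass b F t ≤ tailWeight b F w t) (hcut : Cut b F w q t τ x)
    (hx : (f t ≤ x ∧ deficit b c h f q F t x = 0) ∨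
        (t = a ∧ (f a ≤ x → deficit b c h f q F a x ≤ 0))) :
    ∫ θ in a..t, w θ * (surplus c (f θ) θ - surplus c (q θ) θ) ∂F ≤ 0 ∧
    ∫ θ in a..t, (tailWeight b F w t - tailMass b F t * w θ) * excess c q U θ ∂F ≤ 0 ∧
    ∫ θ in t..b, (surplus c (med q f x θ) θ - surplus c (q θ) θ) ∂F ≤ 0 := by
  have hpb := hw.peak_mem.2
  have htb : t ∈ Icc a b := ⟨ht.1, ht.2.trans hpb.le⟩
  have htb' : t ∈ Ico a b := ⟨ht.1, ht.2.trans_lt hpb⟩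
  have P := candidate_plan T hF O.mono O.nonneg hx0 htb hcut hx
  have hm := hF.tailMass_pos htb'
  have hW := hw.tailWeight_pos hF htb'
  set m := tailMass b F t
  set W := tailWeight b F w t
  have hbal := P.balance
  have hopt := O.optimal _ _ P
  have key := welfare_sub T hw P.toSchedule O.toSchedule (hbal.trans O.balance.symm) htb.2
  set q₁ := candidate q f t x with hq₁
  set U₁ := candidateProfit b c h F q f t x with hU₁
  have hmed := med_mono O.mono T.f_mono x
  have is : ∀ u v, IntervalIntegrable (fun θ => surplus c (q₁ θ) θ - surplus c (q θ) θ) F u v :=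
    fun u v => (T.surplus_integrable P.mono F _ _).sub (T.surplus_integrable O.mono F _ _)
  have n1 : 0 ≤ ∫ θ in a..t, w θ * (surplus c (f θ) θ - surplus c (q θ) θ) ∂F :=
    integral_nonneg_Ioo ht.1 fun θ hθ => mul_nonneg (hw.nonneg θ ⟨hθ.1.le, hθ.2.le.trans htb.2⟩)
      (sub_nonneg.2 (T.surplus_le_firstBest (O.nonneg θ)))
  have n2 := hw.excess_integral_nonneg O.toPlan T ht hE hm.le
  have n3 : 0 ≤ ∫ θ in t..b, (surplus c (med q f x θ) θ - surplus c (q θ) θ) ∂F :=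
    integral_nonneg_Ioo htb.2 fun θ _ => sub_nonneg.2 (T.surplus_le_med (O.nonneg θ))
  -- The median is at least `q` before the crossing and at most `q` after it, so every change of
  -- rents has the sign of the tail gap. The order at `τ` itself is unknown, but a single type is
  -- null.
  have n4 : 0 ≤ ∫ u in t..b, (h (q₁ u) u - h (q u) u) * tailGap b F w t u := by
    have : ∀ᵐ u ∂(volume : Measure ℝ), u ≠ τ := by simp [ae_iff]
    rw [intervalIntegral.integral_of_le htb.2]
    refine integral_nonneg_of_ae ?_
    filter_upwards [ae_restrict_mem_Ioo (F := volume) t b, ae_restrict_of_ae this] with u hu huτ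
    rw [hq₁, candidate_of_lt hu.1]
    rcases lt_or_gt_of_ne huτ with h1 | h1
    · exact mul_nonneg (sub_nonneg.2 (T.h_mono u _ _ (O.nonneg u)
        (le_med_of_le (hcut.le_cut u hu.1 h1)))) (hcut.gap_nonneg u hu.1 h1)
    · exact mul_nonneg_of_nonpos_of_nonpos (sub_nonpos.2 (T.h_mono u _ _
        (med_nonneg (O.nonneg u) (T.f_pos u).le) (med_le_of_ge (hcut.cut_le u h1 hu.2))))
        (hcut.gap_nonpos u h1 hu.2)
  have e1 : ∫ θ in a..b, (surplus c (q₁ θ) θ - surplus c (q θ) θ) ∂F =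
      (∫ θ in a..t, (surplus c (q₁ θ) θ - surplus c (q θ) θ) ∂F) +
      ∫ θ in t..b, (surplus c (med q f x θ) θ - surplus c (q θ) θ) ∂F := by
    rw [← intervalIntegral.integral_add_adjacent_intervals (is a t) (is t b)]
    congr 1
    refine integral_congr_Ioo htb.2 fun θ hθ => ?_
    rw [hq₁, candidate_of_lt hθ.1]
  -- If the deficit is zero, the deviation pays first-best surplus below `t`, so `U₁ - U` is the
  -- surplus gained minus the excess of the given plan. If `t = a`, all terms are empty integrals.
  have e2 : (∫ θ in a..t, (m * w θ - W) * (U₁ θ - U θ) ∂F) +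
      W * (∫ θ in a..t, (surplus c (q₁ θ) θ - surplus c (q θ) θ) ∂F) =
      m * (∫ θ in a..t, w θ * (surplus c (f θ) θ - surplus c (q θ) θ) ∂F) +
      ∫ θ in a..t, (W - m * w θ) * excess c q U θ ∂F := by
    rcases hx with ⟨hfx, hd⟩ | ⟨rfl, -⟩
    · have hc := O.continuous T
      have hc1 := P.continuous T
      have i0 := hw.intervalIntegrable (F := F) a t
      have i1 : IntervalIntegrable (fun θ => W - m * w θ) F a t :=
        intervalIntegrable_const.sub (i0.const_mul m)
      have j1 := intervalIntegrable_mul_comp T.surplus_cont T.f_mono ht.1 i0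
      have j2 := intervalIntegrable_mul_comp T.surplus_cont O.mono ht.1 i0
      have j3 := (intervalIntegrable_mul_comp T.surplus_cont O.mono ht.1 i1)
      have j4 := i1.mul_continuousOn (g := U) hc.continuousOn
      have j5 : IntervalIntegrable
          (fun θ => w θ * (surplus c (f θ) θ - surplus c (q θ) θ)) F a t :=
        (j1.sub j2).congr (fun z _ => by simp only; ring)
      have j6 : IntervalIntegrable (fun θ => (W - m * w θ) * excess c q U θ) F a t :=
        (j4.sub j3).congr (fun z _ => by simp only [excess]; ring)
      have j7 : IntervalIntegrable (fun θ => (m * w θ - W) * (U₁ θ - U θ)) F a t :=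
        (hw.gap_integrable m W _ _).mul_continuousOn (hc1.sub hc).continuousOn
      rw [← intervalIntegral.integral_const_mul, ← intervalIntegral.integral_const_mul,
        ← intervalIntegral.integral_add j7 ((is _ _).const_mul _),
        ← intervalIntegral.integral_add (j5.const_mul _) j6]
      refine integral_congr_Ioo ht.1 fun θ hθ => ?_
      rw [hU₁, candidateProfit_of_le T hfx htb ⟨hθ.1.le, hθ.2.le⟩, hq₁,
        candidate_of_le T hfx hθ.2.le, hd, excess]
      ring
    · simp
  have hle : m * (∫ θ in a..b, w θ * U₁ θ ∂F - ∫ θ in a..b, w θ * U θ ∂F) ≤ 0 :=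
    mul_nonpos_of_nonneg_of_nonpos hm.le (by linarith)
  rw [e1] at key
  have t1 := mul_nonneg hm.le n1
  have t3 := mul_nonneg hW.le n3
  refine ⟨?_, by linarith, ?_⟩
  · by_contra! hpos
    have := mul_pos hm hpos
    linarith
  · by_contra! hpos
    have := mul_pos hW hpos
    linarith

end OptimalPattern
end RatingDesign

/-! ### The pattern of an optimal plan -/

namespace RatingDesign
open Filter Topology
noncomputable section OptimalPattern
set_option linter.unusedSectionVars false

variable {a b : ℝ} {c h : ℝ → ℝ → ℝ} {f q U q' U' w : ℝ → ℝ} {p : ℝ} {F : Measure ℝ}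
  [IsProbabilityMeasure F] [NullSingletonClass F]

lemma med_eq {x u : ℝ} (h1 : min (f u) x ≤ q u)
    (h3 : q u ≤ x ∨ x ≤ q u ∧ (q u ≤ f u ∨ q u ≤ x)) : med q f x u = q u := by
  rcases le_total (q u) (f u) with h4 | h4
  · rw [med, min_eq_left h4, max_eq_right h4, max_eq_left h1]
  · rw [med, min_eq_right h4, max_eq_left h4]
    rcases h3 with h3 | ⟨h3, h5 | h5⟩
    · rw [min_eq_left h3, max_eq_right h4]
    · rw [min_eq_right h3, le_antisymm h5 h4]
      exact max_eq_left (h3.trans h5)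
    · rw [min_eq_left h5, max_eq_right h4]

/-- If first-best surplus is attained almost everywhere, quality is first best. -/
lemma first_best_of_integral (T : Technology a b c h f) (hF : FullLaw a b F) (hq : Monotone q)
    (hq0 : ∀ u, 0 ≤ q u) {k : ℝ → ℝ} {t : ℝ} (ht : t ∈ Icc a b)
    (hk : IntervalIntegrable k F a t) (hk0 : ∀ θ ∈ Ioo a t, 0 < k θ)
    (hint : ∫ θ in a..t, k θ * (surplus c (f θ) θ - surplus c (q θ) θ) ∂F ≤ 0) :
    ∀ θ ∈ Ioo a t, q θ = f θ := by
  have j : IntervalIntegrable (fun θ => k θ * (surplus c (f θ) θ - surplus c (q θ) θ)) F a t :=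
    ((intervalIntegrable_mul_comp T.surplus_cont T.f_mono ht.1 hk).sub
      (intervalIntegrable_mul_comp T.surplus_cont hq ht.1 hk)).congr
        (fun z _ => by simp only; ring)
  have hd : ∀ u' v', a ≤ u' → u' < v' → v' ≤ t → ∃ z ∈ Ioo u' v', q z = f z := by
    intro u' v' h1 h2 h3
    obtain ⟨z, hz, hz0⟩ := hF.exists_eq_zero le_rfl ht.2 h1 h2 h3 j (fun z hz =>
      mul_nonneg (hk0 z hz).le (sub_nonneg.2 (T.surplus_le_firstBest (hq0 z)))) hint
    refine ⟨z, hz, T.eq_firstBest (hq0 z) ?_⟩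
    rcases mul_eq_zero.1 hz0 with h4 | h4
    · exact absurd h4 (hk0 z ⟨h1.trans_lt hz.1, hz.2.trans_le h3⟩).ne'
    · linarith
  intro θ hθ
  refine le_antisymm (le_of_dense hq T.f_cont (u := a) (v := t) (fun u' v' h1 h2 h3 => ?_)
    ⟨hθ.1.le, hθ.2⟩) (ge_of_dense hq T.f_cont (u := a) (v := t) (fun u' v' h1 h2 h3 => ?_)
    ⟨hθ.1, hθ.2.le⟩)
  · obtain ⟨z, hz, h4⟩ := hd u' v' h1 h2 h3; exact ⟨z, hz, h4.le⟩
  · obtain ⟨z, hz, h4⟩ := hd u' v' h1 h2 h3; exact ⟨z, hz, h4.ge⟩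

/-- The excess is constant where quality is first best. -/
lemma Schedule.excess_const (S : Schedule h q U) (T : Technology a b c h f) {t u v : ℝ}
    (hfb : ∀ θ ∈ Ioo a t, q θ = f θ) (htb : t ≤ b) (hu : u ∈ Ioo a t) (hv : v ∈ Ioo a t) :
    excess c q U u = excess c q U v := by
  have key : ∀ u v, u ∈ Ioo a t → v ∈ Ioo a t → u ≤ v → excess c q U u = excess c q U v := by
    intro u v hu hv huv
    have h1 := T.firstBest_envelope ⟨hu.1.le, hu.2.le.trans htb⟩ ⟨hv.1.le, hv.2.le.trans htb⟩ huv
    have h2 := S.env u v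
    have h3 : ∫ z in u..v, h (q z) z = ∫ z in u..v, h (f z) z := by
      refine intervalIntegral.integral_congr fun z hz => ?_
      rw [uIcc_of_le huv] at hz
      simp only [hfb z ⟨hu.1.trans_le hz.1, hz.2.trans_lt hv.2⟩]
    rw [excess, excess, hfb u hu, hfb v hv]
    linarith
  rcases le_total u v with h1 | h1
  · exact key u v hu hv h1
  · exact (key v u hv hu h1).symm

/-- Vanishing terms in the comparison identify `q` with the median deviation on a dense set, and
monotonicity extends the resulting bounds to the open intervals. `σ` is the crossing of the tail
gap. It may differ from `τ` only if `x < f a` and `t = a`: the shape required above `τ` then holds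
on all of `(a, b)`, and `τ` is reset to `a`. -/
lemma OptimalPlan.exists_pattern (O : OptimalPlan a b c h F w q U) (T : Technology a b c h f)
    (hF : FullLaw a b F) (hw : Hump a b F w p) :
    ∃ t τ σ x, t ∈ Icc a p ∧ (∀ θ ∈ Ico a t, w θ * tailMass b F t ≤ tailWeight b F w t) ∧
      Cut b F w q t σ x ∧ Pattern a b c f q U t τ x ∧ (τ = σ ∨ (t = a ∧ τ = a)) := by
  obtain ⟨t, τ, x, ht, hx0, hE, hcut, hx⟩ := exists_candidate T hF hw O.mono O.nonneg
  obtain ⟨i1, i2, i3⟩ := O.comparison T hF hw hx0 ht hE hcut hx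
  have hpb := hw.peak_mem.2
  have htb : t ∈ Icc a b := ⟨ht.1, ht.2.trans hpb.le⟩
  have htb' : t ∈ Ico a b := ⟨ht.1, ht.2.trans_lt hpb⟩
  have hm := hF.tailMass_pos htb'
  have hmed := med_mono O.mono T.f_mono x
  have hfb : ∀ θ ∈ Ioo a t, q θ = f θ :=
    first_best_of_integral T hF O.mono O.nonneg htb (hw.intervalIntegrable _ _)
      (fun θ hθ => hw.pos ⟨hθ.1, hθ.2.trans_le htb.2⟩) i1
  have hex : ∀ θ ∈ Ioo a t, excess c q U θ = 0 := by
    intro θ₀ hθ₀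
    have hat : a < t := hθ₀.1.trans hθ₀.2
    have hcst : ∀ θ ∈ Ioo a t, excess c q U θ = excess c q U θ₀ := fun θ hθ =>
      O.excess_const T hfb htb.2 hθ hθ₀
    have iD := O.excess_integrable (F := F) T a t
    -- A constant negative excess violates majorization at `t`. A constant positive one makes the
    -- second term of the comparison positive, since `w` increases strictly below `t`.
    rcases lt_trichotomy (excess c q U θ₀) 0 with h1 | h1 | h1
    · have := hF.integral_pos le_rfl hat htb.2 iD.neg fun z hz => by
        simp only [Pi.neg_apply, hcst z hz]; linarith
      simp only [Pi.neg_apply, intervalIntegral.integral_neg] at this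
      have := O.slack t htb
      linarith
    · exact h1
    · have iw : IntervalIntegrable (fun θ => tailWeight b F w t - tailMass b F t * w θ) F a t :=
        intervalIntegrable_const.sub ((hw.intervalIntegrable _ _).const_mul _)
      have j : IntervalIntegrable (fun θ =>
          (tailWeight b F w t - tailMass b F t * w θ) * excess c q U θ) F a t :=
        ((iw.mul_continuousOn (g := U) (O.continuous T).continuousOn).sub
          (intervalIntegrable_mul_comp T.surplus_cont O.mono ht.1 iw)).congr
          (fun z _ => by simp only [excess]; ring)
      refine absurd i2 (not_le.2 (hF.integral_pos le_rfl hat htb.2 j fun z hz => ?_))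
      rw [hcst z hz]
      refine mul_pos ?_ h1
      obtain ⟨y, hy⟩ := exists_between hz.2
      have h2 := hE y ⟨hz.1.le.trans hy.1.le, hy.2⟩
      have h3 : w z < w y := hw.increasing ⟨hz.1.le, hz.2.le.trans ht.2⟩
        ⟨hz.1.le.trans hy.1.le, hy.2.le.trans ht.2⟩ hy.1
      nlinarith
  have is : IntervalIntegrable (fun θ => surplus c (med q f x θ) θ - surplus c (q θ) θ) F t b :=
    (T.surplus_integrable hmed F _ _).sub (T.surplus_integrable O.mono F _ _)
  have hd : ∀ u' v', t ≤ u' → u' < v' → v' ≤ b → ∃ z ∈ Ioo u' v', med q f x z = q z := by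
    intro u' v' h1 h2 h3
    obtain ⟨z, hz, hz0⟩ := hF.exists_eq_zero ht.1 le_rfl h1 h2 h3 is (fun z _ =>
      sub_nonneg.2 (T.surplus_le_med (O.nonneg z))) i3
    exact ⟨z, hz, T.med_eq_of_surplus_le (O.nonneg z) (by linarith)⟩
  have hbelow : ∀ z ∈ Ioo t τ, min (f z) x ≤ q z ∧ q z ≤ x := by
    refine fun z hz => ⟨?_, hcut.le_cut z hz.1 hz.2⟩
    refine ge_of_dense O.mono (g := fun z => min (f z) x) (T.f_cont.min continuous_const)
      (u := t) (v := τ) (fun u' v' h1 h2 h3 => ?_) ⟨hz.1, hz.2.le⟩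
    obtain ⟨y, hy, h4⟩ := hd u' v' h1 h2 (h3.trans hcut.le_right)
    exact ⟨y, hy, min_le_med.trans h4.le⟩
  have habove : ∀ z ∈ Ioo τ b, x ≤ q z ∧ q z ≤ max (f z) x := by
    refine fun z hz => ⟨hcut.cut_le z hz.1 hz.2, ?_⟩
    refine le_of_dense O.mono (g := fun z => max (f z) x) (T.f_cont.max continuous_const)
      (u := τ) (v := b) (fun u' v' h1 h2 h3 => ?_) ⟨hz.1.le, hz.2⟩
    obtain ⟨y, hy, h4⟩ := hd u' v' (hcut.left_le.trans h1) h2 h3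
    exact ⟨y, hy, h4.ge.trans med_le⟩
  rcases le_or_gt (f t) x with hfx | hfx
  · refine ⟨t, τ, τ, x, ht, hE, hcut, ⟨ht.1, hcut.left_le, hcut.le_right, hfb, hex, hbelow, habove,
      Or.inr ⟨hfx, ?_⟩⟩, Or.inl rfl⟩
    have P := candidate_plan T hF O.mono O.nonneg hx0 htb hcut hx
    have hdn : deficit b c h f q F t x ≤ 0 := by
      rcases hx with h1 | ⟨rfl, h1⟩
      · exact h1.2.le
      · exact h1 hfx
    set q₁ := candidate q f t x with hq₁
    set U₁ := candidateProfit b c h F q f t x with hU₁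
    have hmq : ∀ z ∈ Ioo t b, z ≠ τ → q₁ z = q z := by
      intro z hz hzτ
      rw [hq₁, candidate_of_lt hz.1]
      rcases lt_or_gt_of_ne hzτ with h1 | h1
      · have := hbelow z ⟨hz.1, h1⟩
        exact med_eq this.1 (Or.inl this.2)
      · have := habove z ⟨h1, hz.2⟩
        exact med_eq ((min_le_right _ _).trans this.1) (Or.inr ⟨this.1, le_max_iff.1 this.2⟩)
    -- Above `t` qualities agree except perhaps at `τ`, so profits differ by a constant, which the
    -- balanced budgets make zero. The profit of `t` is therefore that of the deviation, which is at
    -- least first best.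
    have hG : ∀ θ ∈ Ioo t b, U₁ θ - U θ = U₁ t - U t := by
      intro θ hθ
      have h1 := P.env t θ
      have h2 := O.env t θ
      have hne : ∀ᵐ u ∂(volume : Measure ℝ), u ≠ τ := by simp [ae_iff]
      have h3 : ∫ z in t..θ, h (q₁ z) z = ∫ z in t..θ, h (q z) z := by
        rw [intervalIntegral.integral_of_le hθ.1.le, intervalIntegral.integral_of_le hθ.1.le]
        refine integral_congr_ae ?_
        filter_upwards [ae_restrict_mem_Ioo (F := volume) t θ, ae_restrict_of_ae hne] with z hz hzτ
        rw [hmq z ⟨hz.1, hz.2.trans hθ.2⟩ hzτ]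
      linarith
    have iD := O.excess_integrable (F := F) T
    have iD₁ := P.excess_integrable (F := F) T
    have hsum : ∫ θ in t..b, (excess c q₁ U₁ θ - excess c q U θ) ∂F = 0 := by
      have h1 := intervalIntegral.integral_add_adjacent_intervals (iD a t) (iD t b)
      have h2 := intervalIntegral.integral_add_adjacent_intervals (iD₁ a t) (iD₁ t b)
      have h3 : ∫ θ in a..t, excess c q U θ ∂F = ∫ θ in a..t, (0 : ℝ) ∂F :=
        integral_congr_Ioo ht.1 hex
      have h4 : 0 ≤ ∫ θ in a..t, excess c q₁ U₁ θ ∂F := P.slack t htb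
      have h5 : ∫ θ in a..t, excess c q₁ U₁ θ ∂F = 0 := by
        rcases hx with ⟨h6, h7⟩ | ⟨rfl, -⟩
        · rw [integral_congr_Ioo (k := fun _ => 0) ht.1]
          · simp
          · intro θ hθ
            rw [excess, hU₁, candidateProfit_of_le T hfx htb ⟨hθ.1.le, hθ.2.le⟩, hq₁,
              candidate_of_le T hfx hθ.2.le, h7]
            ring
        · simp
      rw [intervalIntegral.integral_zero] at h3
      have h6 := O.balance
      have h7 := P.balance
      rw [intervalIntegral.integral_sub (iD₁ t b) (iD t b)]
      linarith
    have hne : ∀ᵐ u ∂F, u ≠ τ := by simp [ae_iff]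
    have hcs : ∫ θ in t..b, (excess c q₁ U₁ θ - excess c q U θ) ∂F =
        ∫ θ in t..b, (U₁ t - U t) * 1 ∂F := by
      rw [intervalIntegral.integral_of_le htb.2, intervalIntegral.integral_of_le htb.2]
      refine integral_congr_ae ?_
      filter_upwards [ae_restrict_mem_Ioo (F := F) t b, ae_restrict_of_ae hne] with z hz hzτ
      rw [excess, excess, hmq z hz hzτ, ← hG z hz]
      ring
    rw [hsum, intervalIntegral.integral_const_mul] at hcs
    have hU : U₁ t - U t = 0 := (mul_eq_zero.1 hcs.symm).resolve_right hm.ne'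
    rw [hU₁, candidateProfit_of_le T hfx htb ⟨ht.1, le_rfl⟩] at hU
    linarith
  · have hta : t = a := by
      rcases hx with h1 | h1
      · exact absurd h1.1 (not_le.2 hfx)
      · exact h1.1
    refine ⟨t, t, τ, x, ht, hE, hcut, ⟨ht.1, le_rfl, htb.2, hfb, hex,
      fun z hz => absurd (hz.1.trans hz.2) (lt_irrefl _), ?_, Or.inl rfl⟩, Or.inr ⟨hta, hta⟩⟩
    have hxf : ∀ z, t ≤ z → x ≤ f z := fun z hz => hfx.le.trans (T.f_mono hz)
    intro z hz
    constructor
    · refine ge_of_dense O.mono (g := fun _ => x) continuous_const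
        (u := t) (v := b) (fun u' v' h1 h2 h3 => ?_) ⟨hz.1, hz.2.le⟩
      obtain ⟨y, hy, h4⟩ := hd u' v' h1 h2 h3
      exact ⟨y, hy, (le_min (hxf y (h1.trans hy.1.le)) le_rfl).trans (min_le_med.trans h4.le)⟩
    · refine le_of_dense O.mono (g := fun z => max (f z) x) (T.f_cont.max continuous_const)
        (u := t) (v := b) (fun u' v' h1 h2 h3 => ?_) ⟨hz.1.le, hz.2⟩
      obtain ⟨y, hy, h4⟩ := hd u' v' h1 h2 h3
      exact ⟨y, hy, h4.ge.trans med_le⟩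

end OptimalPattern
end RatingDesign

/-! ### Rating systems with one generic signal -/

namespace RatingDesign
open Filter Topology
noncomputable section Rating
set_option linter.unusedSectionVars false

instance : MeasurableSingletonClass Signal := by
  refine ⟨fun s => ?_⟩
  rcases s with x | x
  · rw [← image_singleton]; exact (measurableSet_singleton x).inl_image
  · rw [← image_singleton]; exact (measurableSet_singleton x).inr_image

lemma isProbabilityMeasure_mixSignal {r : ℝ} (hr : r ∈ Icc (0 : ℝ) 1) (x : ℝ) :
    IsProbabilityMeasure (mixSignal r x) := by
  refine ⟨?_⟩
  simp only [mixSignal, Measure.coe_add, Measure.coe_smul, Pi.add_apply, Pi.smul_apply,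
    measure_univ, smul_eq_mul, mul_one]
  rw [← ENNReal.ofReal_add hr.1 (sub_nonneg.2 hr.2)]
  simp

lemma integral_mixSignal {r : ℝ} (hr : r ∈ Icc (0 : ℝ) 1) (x : ℝ) (g : Signal → ℝ) :
    ∫ s, g s ∂(mixSignal r x) = r * g (Sum.inl x) + (1 - r) * g (Sum.inr ()) := by
  have h : ∀ s : Signal, Integrable g (Measure.dirac s) := fun s => integrable_dirac (by simp)
  rw [mixSignal, integral_add_measure ((h _).smul_measure (by simp))
    ((h _).smul_measure (by simp)), integral_smul_measure, integral_smul_measure, integral_dirac,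
    integral_dirac, ENNReal.toReal_ofReal hr.1, ENNReal.toReal_ofReal (sub_nonneg.2 hr.2)]
  simp

lemma mixSignal_one (x : ℝ) : mixSignal 1 x = Measure.dirac (Sum.inl x) := by
  simp [mixSignal]

/-- The rating system that announces quality `x` with probability `α x`. -/
def mixKernel (α : ℝ → ℝ) (hα : Measurable α) : Kernel ℝ Signal where
  toFun x := mixSignal (α x) x
  measurable' := by
    refine Measure.measurable_of_measurable_coe _ fun s hs => ?_
    have h1 : ∀ x, mixSignal (α x) x s =
        ENNReal.ofReal (α x) * (Sum.inl ⁻¹' s : Set ℝ).indicator 1 x +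
        ENNReal.ofReal (1 - α x) * s.indicator 1 (Sum.inr () : Signal) := by
      intro x
      simp only [mixSignal, Measure.coe_add, Measure.coe_smul, Pi.add_apply, Pi.smul_apply,
        Measure.dirac_apply' _ hs, smul_eq_mul]
      rfl
    simp_rw [h1]
    have h2 : Measurable ((Sum.inl ⁻¹' s : Set ℝ).indicator (1 : ℝ → ENNReal)) :=
      measurable_one.indicator (measurable_inl hs)
    exact (hα.ennreal_ofReal.mul h2).add
      (((measurable_const.sub hα).ennreal_ofReal).mul measurable_const)

variable {q qbar : ℝ → ℝ} {a b : ℝ} {F : Measure ℝ} [IsProbabilityMeasure F]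

lemma isMarkovKernel_mixKernel {α : ℝ → ℝ} (hα : Measurable α) (h01 : ∀ x, α x ∈ Icc (0 : ℝ) 1) :
    IsMarkovKernel (mixKernel α hα) :=
  ⟨fun x => isProbabilityMeasure_mixSignal (h01 x) x⟩

/-- The price function of a signal: announced quality, or `P` for the generic signal. -/
def signalPrice (lo hi P : ℝ) : Signal → ℝ := Sum.elim (fun x => max lo (min x hi)) fun _ => P

/-- An announced quality is its own conditional expectation, so the only requirement is `hbal`: the
mean quality behind the generic signal is `P`. The clamp in `signalPrice` is almost surely inert and
only keeps prices bounded. -/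
lemma isPrice_mixKernel {α : ℝ → ℝ} (hα : Measurable α) (h01 : ∀ x, α x ∈ Icc (0 : ℝ) 1)
    (hq : Measurable q) {lo hi P : ℝ} (hlo : ∀ᵐ θ ∂F, q θ ∈ Icc lo hi)
    (hbal : ∫ θ, (1 - α (q θ)) * (P - q θ) ∂F = 0) :
    IsPrice F q (mixKernel α hα) (signalPrice lo hi P) := by
  have hmark := isMarkovKernel_mixKernel hα h01
  have hprob : IsProbabilityMeasure (F.map q) := Measure.isProbabilityMeasure_map hq.aemeasurable
  have hPm : Measurable (signalPrice lo hi P) :=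
    Measurable.sumElim (measurable_const.max (measurable_id.min measurable_const))
      measurable_const
  have hsupp : ∀ᵐ x ∂(F.map q), x ∈ Icc lo hi :=
    (ae_map_iff hq.aemeasurable measurableSet_Icc).2 hlo
  have hbd : ∀ x ∈ Icc lo hi, ‖x‖ ≤ max |lo| |hi| := fun x hx => abs_le_max_abs_abs hx.1 hx.2
  set J := (F.map q) ⊗ₘ (mixKernel α hα)
  have hfst : Integrable (fun z : ℝ × Signal => z.1) J := by
    have h1 : Integrable (fun x : ℝ => x) (J.map Prod.fst) := by
      have : J.map Prod.fst = F.map q := Measure.fst_compProd _ _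
      rw [this]
      refine Integrable.of_bound measurable_id.aestronglyMeasurable (max |lo| |hi|) ?_
      filter_upwards [hsupp] with x hx using hbd x hx
    exact (integrable_map_measure measurable_id.aestronglyMeasurable
      measurable_fst.aemeasurable).1 h1
  have hsnd : Integrable (fun z : ℝ × Signal => signalPrice lo hi P z.2) J := by
    refine Integrable.of_bound (hPm.comp measurable_snd).aestronglyMeasurable
      (max (max |lo| |hi|) (max |lo| |P|)) (Eventually.of_forall fun z => ?_)
    rcases z with ⟨x, y | y⟩
    · change |max lo (min y hi)| ≤ _
      rcases max_cases lo (min y hi) with h1 | h1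
      · rw [h1.1]; exact le_max_of_le_left (le_max_left _ _)
      · refine le_max_of_le_left (abs_le_max_abs_abs (le_max_left _ _) ?_)
        rw [h1.1]; exact min_le_right _ _
    · exact le_max_of_le_right (le_max_right _ _)
  refine ⟨hPm, ?_⟩
  have hm : MeasurableSpace.comap Prod.snd (inferInstance : MeasurableSpace Signal) ≤
      (inferInstance : MeasurableSpace (ℝ × Signal)) := measurable_snd.comap_le
  refine ae_eq_condExp_of_forall_setIntegral_eq hm hfst (fun s _ _ => hsnd.integrableOn) ?_ ?_
  · rintro s ⟨B, hB, rfl⟩ _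
    have hs : (Prod.snd ⁻¹' B : Set (ℝ × Signal)) = univ ×ˢ B := by
      ext z; simp
    have key : ∀ k : ℝ × Signal → ℝ, Integrable k J → ∫ z in (univ ×ˢ B), k z ∂J =
        ∫ x, (α x * B.indicator (fun s => k (x, s)) (Sum.inl x) +
          (1 - α x) * B.indicator (fun s => k (x, s)) (Sum.inr ())) ∂(F.map q) := by
      intro k hk
      rw [Measure.setIntegral_compProd MeasurableSet.univ hB hk.integrableOn, Measure.restrict_univ]
      refine integral_congr_ae (Eventually.of_forall fun x => ?_)
      simp only
      rw [← integral_indicator hB]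
      exact integral_mixSignal (h01 x) x _
    have hint : ∀ k : ℝ × Signal → ℝ, Integrable k J → Integrable (fun x =>
        α x * B.indicator (fun s => k (x, s)) (Sum.inl x) +
          (1 - α x) * B.indicator (fun s => k (x, s)) (Sum.inr ())) (F.map q) := by
      intro k hk
      have h0 : Integrable ((univ ×ˢ B).indicator k)
          ((Kernel.const Unit (F.map q) ⊗ₖ Kernel.prodMkLeft Unit (mixKernel α hα)) ()) :=
        hk.indicator (MeasurableSet.univ.prod hB)
      have h1 := h0.integral_compProd
      refine h1.congr (Eventually.of_forall fun x => ?_)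
      have h2 : (fun s => (univ ×ˢ B).indicator k (x, s)) = B.indicator fun s => k (x, s) := by
        ext s
        by_cases hsB : s ∈ B
        · rw [indicator_of_mem hsB, indicator_of_mem (mk_mem_prod (mem_univ x) hsB)]
        · rw [indicator_of_notMem hsB, indicator_of_notMem fun hh => hsB hh.2]
      simp only [h2]
      exact integral_mixSignal (h01 x) x _
    have hint' : ∀ k : ℝ × Signal → ℝ, Integrable k J → Integrable (fun θ =>
        α (q θ) * B.indicator (fun s => k (q θ, s)) (Sum.inl (q θ)) +
          (1 - α (q θ)) * B.indicator (fun s => k (q θ, s)) (Sum.inr ())) F := fun k hk =>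
      (integrable_map_measure (hint k hk).aestronglyMeasurable hq.aemeasurable).1 (hint k hk)
    rw [hs, key _ hsnd, key _ hfst, integral_map hq.aemeasurable, integral_map hq.aemeasurable]
    · rw [← sub_eq_zero, ← integral_sub]
      -- For a set `B` of signals, announcements contribute the same to both sides. What remains is
      -- the generic signal's term, which `hbal` annihilates.
      · have h2 : ∀ᵐ θ ∂F, (α (q θ) * B.indicator (fun s => signalPrice lo hi P s)
            (Sum.inl (q θ)) + (1 - α (q θ)) * B.indicator (fun s => signalPrice lo hi P s)
            (Sum.inr ())) - (α (q θ) * B.indicator (fun _ => q θ) (Sum.inl (q θ)) +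
            (1 - α (q θ)) * B.indicator (fun _ => q θ) (Sum.inr ())) =
            B.indicator (fun _ => (1 : ℝ)) (Sum.inr ()) * ((1 - α (q θ)) * (P - q θ)) := by
          filter_upwards [hlo] with θ hθ
          have h3 : signalPrice lo hi P (Sum.inl (q θ)) = q θ := by
            change max lo (min (q θ) hi) = q θ
            rw [min_eq_left hθ.2, max_eq_right hθ.1]
          have h4 : signalPrice lo hi P (Sum.inr ()) = P := rfl
          simp only [indicator, h3, h4]
          split_ifs <;> ring
        rw [integral_congr_ae h2, integral_const_mul, hbal, mul_zero]
      · exact hint' _ hsnd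
      · exact hint' _ hfst
    · exact (hint _ hfst).aestronglyMeasurable
    · exact (hint _ hsnd).aestronglyMeasurable
  · exact ((hPm.comp (comap_measurable Prod.snd)).stronglyMeasurable).aestronglyMeasurable

/-- Signaled qualities that lie between quality and a pooling quality `P` are implemented by a
rating system that either reveals quality or sends one generic signal. -/
lemma exists_rating [NullSingletonClass F] (hab : a ≤ b) (hF : F (Icc a b)ᶜ = 0) (hq : Monotone q)
    (hqb : MonotoneOn qbar (Icc a b))
    (hfun : ∀ θ ∈ Ioo a b, ∀ θ' ∈ Ioo a b, q θ = q θ' → qbar θ = qbar θ') {P : ℝ}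
    (hP : ∀ θ ∈ Ioo a b, (q θ < qbar θ → qbar θ ≤ P) ∧ (qbar θ < q θ → P ≤ qbar θ))
    (hbal : ∫ θ in a..b, (qbar θ - q θ) ∂F = 0) {r : ℝ} (hr : r ∈ Icc (0 : ℝ) 1) :
    ∃ (α : ℝ → ℝ) (hα : Measurable α), (∀ x, α x ∈ Icc (0 : ℝ) 1) ∧
      Implements a b F q qbar (mixKernel α hα) ∧
      (∀ θ ∈ Ioo a b, q θ ≠ P → qbar θ = q θ → α (q θ) = 1) ∧
      (∀ θ ∈ Ioo a b, qbar θ ≠ q θ → α (q θ) < 1) ∧ α P = r := by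
  -- The supremum `β` of these sets expresses the price as a monotone, hence measurable, function of
  -- quality. Adding `qbar a` keeps the sets nonempty when `y` lies below all qualities.
  set A : ℝ → Set ℝ := fun y => insert (qbar a) (qbar '' {θ | θ ∈ Ioo a b ∧ q θ ≤ y}) with hA
  have hne : ∀ y, (A y).Nonempty := fun y => insert_nonempty _ _
  have hbd : ∀ y, BddAbove (A y) := by
    refine fun y => ⟨qbar b, ?_⟩
    rintro _ (rfl | ⟨θ, hθ, rfl⟩)
    · exact hqb ⟨le_rfl, hab⟩ ⟨hab, le_rfl⟩ hab
    · exact hqb ⟨hθ.1.1.le, hθ.1.2.le⟩ ⟨hab, le_rfl⟩ hθ.1.2.le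
  set β : ℝ → ℝ := fun y => sSup (A y) with hβ
  have hβm : Monotone β := fun x y hxy => csSup_le_csSup (hbd y) (hne x)
    (insert_subset_insert (image_mono fun θ hθ => ⟨hθ.1, hθ.2.trans hxy⟩))
  have hβq : ∀ θ ∈ Ioo a b, β (q θ) = qbar θ := by
    intro θ hθ
    have hθI : θ ∈ Icc a b := ⟨hθ.1.le, hθ.2.le⟩
    refine le_antisymm (csSup_le (hne _) ?_)
      (le_csSup (hbd _) (Or.inr ⟨θ, ⟨hθ, le_rfl⟩, rfl⟩))
    rintro _ (rfl | ⟨θ', hθ', rfl⟩)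
    · exact hqb ⟨le_rfl, hab⟩ hθI hθ.1.le
    · rcases le_total θ' θ with h | h
      · exact hqb ⟨hθ'.1.1.le, hθ'.1.2.le⟩ hθI h
      · exact (hfun θ' hθ'.1 θ hθ (le_antisymm hθ'.2 (hq h))).le
  -- The weight for which a mixture of `y` and `P` equals the price `β y`. At `y = P` every weight
  -- gives the same mixture, so the value there can be prescribed.
  set α : ℝ → ℝ := fun y => if y = P then r else max 0 (min 1 ((β y - P) / (y - P))) with hαd
  have hα : Measurable α := by
    refine Measurable.ite (measurableSet_singleton P) measurable_const ?_
    exact measurable_const.max (measurable_const.min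
      ((hβm.measurable.sub measurable_const).div (measurable_id.sub measurable_const)))
  have h01 : ∀ x, α x ∈ Icc (0 : ℝ) 1 := by
    intro x
    simp only [hαd]
    split_ifs
    · exact hr
    · exact ⟨le_max_left _ _, max_le zero_le_one (min_le_left _ _)⟩
  have hval : ∀ θ ∈ Ioo a b, q θ ≠ P → α (q θ) = (qbar θ - P) / (q θ - P) := by
    intro θ hθ hne
    obtain ⟨h1, h2⟩ := hP θ hθ
    simp only [hαd, if_neg hne, hβq θ hθ]
    have h3 : 0 ≤ (qbar θ - P) / (q θ - P) ∧ (qbar θ - P) / (q θ - P) ≤ 1 := by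
      rcases lt_trichotomy (q θ) (qbar θ) with h4 | h4 | h4
      · have h5 := h1 h4
        have h6 : q θ - P < 0 := by linarith
        exact ⟨div_nonneg_of_nonpos (by linarith) h6.le, (div_le_one_of_neg h6).2 (by linarith)⟩
      · rw [← h4, div_self (sub_ne_zero.2 hne)]; exact ⟨zero_le_one, le_rfl⟩
      · have h5 := h2 h4
        have h6 : 0 < q θ - P := by linarith
        exact ⟨div_nonneg (by linarith) h6.le, (div_le_one h6).2 (by linarith)⟩
    rw [min_eq_right h3.2, max_eq_right h3.1]
  have hPq : ∀ θ ∈ Ioo a b, q θ = P → qbar θ = P := by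
    intro θ hθ h0
    obtain ⟨h1, h2⟩ := hP θ hθ
    rcases lt_trichotomy (q θ) (qbar θ) with h4 | h4 | h4
    · linarith [h1 h4]
    · rw [← h4, h0]
    · linarith [h2 h4]
  have hprice : ∀ θ ∈ Ioo a b, α (q θ) * q θ + (1 - α (q θ)) * P = qbar θ := by
    intro θ hθ
    by_cases h0 : q θ = P
    · rw [hPq θ hθ h0, h0]; ring
    · rw [hval θ hθ h0]
      field_simp [sub_ne_zero.2 h0]
      ring
  have hmem : ∀ᵐ θ ∂F, θ ∈ Ioo a b := by
    have h1 : ∀ᵐ θ ∂F, θ ∈ Icc a b := by rw [ae_iff]; exact hF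
    have h2 : ∀ᵐ θ ∂F, θ ≠ a := by simp [ae_iff]
    have h3 : ∀ᵐ θ ∂F, θ ≠ b := by simp [ae_iff]
    filter_upwards [h1, h2, h3] with θ e1 e2 e3
    exact ⟨lt_of_le_of_ne e1.1 (Ne.symm e2), lt_of_le_of_ne e1.2 e3⟩
  have hqI : ∀ θ ∈ Ioo a b, q θ ∈ Icc (q a) (q b) := fun θ hθ => ⟨hq hθ.1.le, hq hθ.2.le⟩
  refine ⟨α, hα, h01, ⟨signalPrice (q a) (q b) P, isPrice_mixKernel hα h01 hq.measurable ?_ ?_,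
    ?_⟩, ?_, ?_, ?_⟩
  · filter_upwards [hmem] with θ hθ using hqI θ hθ
  · rw [← hbal, intervalIntegral.integral_of_le hab, ← integral_Icc_eq_integral_Ioc,
      Measure.restrict_eq_self_of_ae_mem (by filter_upwards [hmem] with θ hθ using ⟨hθ.1.le, hθ.2.le⟩)]
    refine integral_congr_ae ?_
    filter_upwards [hmem] with θ hθ
    rw [← hprice θ hθ]; ring
  · intro θ hθ
    change _ = ∫ s, _ ∂(mixSignal (α (q θ)) (q θ))
    rw [integral_mixSignal (h01 _), ← hprice θ hθ]
    have h1 := hqI θ hθ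
    simp only [signalPrice, Sum.elim_inl, Sum.elim_inr]
    rw [min_eq_left h1.2, max_eq_right h1.1]
  · intro θ hθ h0 h1
    rw [hval θ hθ h0, h1, div_self (sub_ne_zero.2 h0)]
  · intro θ hθ h1
    have h0 : q θ ≠ P := fun h0 => h1 ((hPq θ hθ h0).trans h0.symm)
    refine lt_of_le_of_ne (h01 _).2 fun h2 => h1 ?_
    have := hprice θ hθ
    rw [h2] at this
    linarith
  · simp [hαd]

end Rating
end RatingDesign

/-! ### Single crossing of price and quality -/

namespace RatingDesign
open Filter Topology
noncomputable section SingleCrossing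
set_option linter.unusedSectionVars false

variable {a b : ℝ} {c h : ℝ → ℝ → ℝ} {f q U w : ℝ → ℝ} {p t τ x : ℝ} {F : Measure ℝ}

lemma Pattern.excess_nonneg (P : Pattern a b c f q U t τ x) (S : Schedule h q U)
    (T : Technology a b c h f) {θ : ℝ} (hθ : θ ∈ Ioo a τ) : 0 ≤ excess c q U θ := by
  rcases lt_trichotomy θ t with h1 | rfl | h1
  · exact (P.excess_eq θ ⟨hθ.1, h1⟩).ge
  · rcases P.start with h2 | ⟨_, h2⟩
    · exact absurd hθ.2 (h2 ▸ lt_irrefl _)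
    · have := T.surplus_le_firstBest (u := θ) (S.nonneg θ)
      rw [excess]; linarith
  · rcases P.start with h2 | ⟨h2, h3⟩
    · rw [h2] at h1; exact absurd (hθ.2.trans h1) (lt_irrefl _)
    · exact S.excess_nonneg T ⟨P.le_left, P.left_le.trans P.le_right⟩
        ⟨hθ.1.le, hθ.2.le.trans P.le_right⟩ h1.le
        (fun z hz => P.below z ⟨hz.1, hz.2.trans_lt hθ.2⟩) h2 h3

lemma Pattern.excess_antitone (P : Pattern a b c f q U t τ x) (S : Schedule h q U)
    (T : Technology a b c h f) {u v : ℝ} (hu : u ∈ Ioo τ b) (hv : v ∈ Ioo τ b) (huv : u ≤ v) :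
    excess c q U v ≤ excess c q U u := by
  have haτ := P.le_left.trans P.left_le
  exact S.excess_le T ⟨haτ.trans hu.1.le, hu.2.le⟩ ⟨haτ.trans hv.1.le, hv.2.le⟩ huv
    fun z hz => P.above z ⟨hu.1.trans_le hz.1, hz.2.trans_lt hv.2⟩

/-- The excess is nonnegative before `τ` and antitone after it. The type `τ` itself needs care,
because the pattern leaves its quality free. -/
lemma Pattern.single_crossing (P : Pattern a b c f q U t τ x) (S : Schedule h q U)
    (T : Technology a b c h f) {u v : ℝ} (hu : a < u) (hv : v < b) (huv : u < v)
    (hneg : excess c q U u < 0) : excess c q U v < 0 := by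
  rcases lt_trichotomy u τ with h1 | rfl | h1
  · exact absurd (P.excess_nonneg S T ⟨hu, h1⟩) (not_le.2 hneg)
  · have hub : u ∈ Icc a b := ⟨hu.le, P.le_right⟩
    -- In the first case quality is at least first best just below `τ`, so the excess at `τ` is
    -- nonnegative. In the second case quality is at most first best above `τ`, so the excess
    -- decreases from `τ` itself.
    by_cases hcase : t = u ∨ f u ≤ x
    · exfalso
      obtain ⟨s, hs, hU, hfq⟩ : ∃ s ∈ Ico a u, surplus c (f s) s ≤ U s ∧
          ∀ z ∈ Ioo s u, f z ≤ q z := by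
        rcases P.left_le.eq_or_lt with h1 | h1
        · obtain ⟨s, hs⟩ := exists_between hu
          have hst : s ∈ Ioo a t := ⟨hs.1, h1 ▸ hs.2⟩
          refine ⟨s, ⟨hs.1.le, hs.2⟩, ?_, fun z hz => ?_⟩
          · have := P.excess_eq s hst
            rw [excess, P.first_best s hst] at this
            linarith
          · exact (P.first_best z ⟨hs.1.trans hz.1, h1 ▸ hz.2⟩).ge
        · have hx : f u ≤ x := hcase.resolve_left h1.ne
          refine ⟨t, ⟨P.le_left, h1⟩, (P.start.resolve_left h1.ne).2, fun z hz => ?_⟩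
          have := (P.below z hz).1
          rwa [min_eq_left ((T.f_mono hz.2.le).trans hx)] at this
      have hqu : f u ≤ q u := by
        refine ge_of_dense S.mono T.f_cont (u := s) (v := u) (fun u' v' h1 h2 h3 => ?_)
          ⟨hs.2, le_rfl⟩
        obtain ⟨z, hz⟩ := exists_between h2
        exact ⟨z, hz, hfq z ⟨h1.trans_lt hz.1, hz.2.trans_le h3⟩⟩
      have := S.excess_nonneg T (x := q u) ⟨hs.1, hs.2.le.trans hub.2⟩ hub hs.2.le
        (fun z hz => ⟨?_, S.mono hz.2⟩) ((T.f_mono hs.2.le).trans hqu) hU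
      · linarith
      · rcases hz.2.eq_or_lt with rfl | h1
        · exact min_le_right _ _
        · exact (min_le_left _ _).trans (hfq z ⟨hz.1, h1⟩)
    · push Not at hcase
      have hab : ∀ z ∈ Ioo u b, q z ≤ f z := by
        intro z hz
        have := (P.above z hz).2
        rwa [max_eq_left (hcase.2.le.trans (T.f_mono hz.1.le))] at this
      refine (S.excess_le T (x := q u) hub ⟨(hu.trans huv).le, hv.le⟩ huv.le fun z hz => ?_).trans_lt
        hneg
      refine ⟨S.mono hz.1, ?_⟩
      rcases hz.1.eq_or_lt with rfl | h1
      · exact le_max_right _ _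
      · exact le_max_of_le_left (hab z ⟨h1, hz.2.trans_lt hv⟩)
  · exact (P.excess_antitone S T ⟨h1, huv.trans hv⟩ ⟨h1.trans huv, hv⟩ huv.le).trans_lt hneg

/-- A price that separates the positive from the negative excesses. -/
lemma exists_pooling_price {D g : ℝ → ℝ} (hg : MonotoneOn g (Icc a b))
    (hD : ∀ u v, a < u → v < b → u < v → D u < 0 → D v < 0) :
    ∃ P, ∀ θ ∈ Ioo a b, (0 < D θ → g θ ≤ P) ∧ (D θ < 0 → P ≤ g θ) := by
  rcases le_or_gt b a with hab | hab
  · exact ⟨0, fun θ hθ => absurd (hθ.1.trans hθ.2) (not_lt.2 hab)⟩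
  have hI : ∀ θ ∈ Ioo a b, θ ∈ Icc a b := fun θ hθ => ⟨hθ.1.le, hθ.2.le⟩
  set A : Set ℝ := insert (g a) (g '' {θ | θ ∈ Ioo a b ∧ 0 < D θ}) with hA
  have hbd : BddAbove A := by
    refine ⟨g b, ?_⟩
    rintro _ (rfl | ⟨θ, hθ, rfl⟩)
    · exact hg ⟨le_rfl, hab.le⟩ ⟨hab.le, le_rfl⟩ hab.le
    · exact hg (hI θ hθ.1) ⟨hab.le, le_rfl⟩ hθ.1.2.le
  refine ⟨sSup A, fun θ hθ => ⟨fun h => le_csSup hbd (Or.inr ⟨θ, ⟨hθ, h⟩, rfl⟩), fun h => ?_⟩⟩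
  refine csSup_le (insert_nonempty _ _) ?_
  rintro _ (rfl | ⟨θ', hθ', rfl⟩)
  · exact hg ⟨le_rfl, hab.le⟩ (hI θ hθ) hθ.1.le
  · refine hg (hI θ' hθ'.1) (hI θ hθ) ?_
    by_contra! hlt
    exact absurd (hD θ θ' hθ.1 hθ'.1.2 hlt h) (not_lt.2 hθ'.2.le)

end SingleCrossing
end RatingDesign

/-! ### Lowering excessive qualities: first-order gains, second-order losses -/

namespace RatingDesign
open Filter Topology
noncomputable section Lowering
set_option linter.unusedSectionVars false

/-- Strict submodularity of the cost function. -/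
structure StrictTechnology (a b : ℝ) (c h : ℝ → ℝ → ℝ) (f : ℝ → ℝ) : Prop
    extends Technology a b c h f where
  h_strict : ∀ m M, 0 < m → ∃ κ, 0 < κ ∧
    ∀ u x y, m ≤ x → x ≤ y → y ≤ M → κ * (y - x) ≤ h y u - h x u
  f_strict : StrictMonoOn f (Icc a b)

variable {a b : ℝ} {c h : ℝ → ℝ → ℝ} {f q U w : ℝ → ℝ} {p t e y δ : ℝ} {F : Measure ℝ}
  [IsProbabilityMeasure F] [NullSingletonClass F]

/-- The excess of quality over `y`, for types up to `e`. -/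
def overshoot (q : ℝ → ℝ) (y e θ : ℝ) : ℝ := if θ ≤ e then max 0 (q θ - y) else 0

/-- The schedule `q`, shrunk towards `y` where it exceeds `y`, for types up to `e`. -/
def lowered (q : ℝ → ℝ) (δ y e θ : ℝ) : ℝ := q θ - δ * overshoot q y e θ

lemma overshoot_nonneg (θ : ℝ) : 0 ≤ overshoot q y e θ := by
  unfold overshoot; split_ifs
  · exact le_max_left _ _
  · exact le_rfl

lemma overshoot_pos_iff {θ : ℝ} : 0 < overshoot q y e θ ↔ θ ≤ e ∧ y < q θ := by
  unfold overshoot; split_ifs with h1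
  · simp [h1]
  · simp [h1]

lemma overshoot_eq {θ : ℝ} (hθ : 0 < overshoot q y e θ) : overshoot q y e θ = q θ - y := by
  obtain ⟨h1, h2⟩ := overshoot_pos_iff.1 hθ
  rw [overshoot, if_pos h1, max_eq_right (by linarith)]

lemma lowered_le (hδ : 0 ≤ δ) (θ : ℝ) : lowered q δ y e θ ≤ q θ := by
  have := mul_nonneg hδ (overshoot_nonneg (q := q) (y := y) (e := e) θ)
  unfold lowered; linarith

lemma le_lowered (hδ : δ ≤ 1) {θ : ℝ} (hθ : θ ≤ e ∧ y < q θ) : y ≤ lowered q δ y e θ := by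
  have h1 := overshoot_pos_iff.2 hθ
  have h2 := overshoot_eq h1
  have h3 := mul_le_mul_of_nonneg_right hδ h1.le
  unfold lowered; linarith

lemma lowered_eq {θ : ℝ} (hθ : ¬ (θ ≤ e ∧ y < q θ)) : lowered q δ y e θ = q θ := by
  have h1 : overshoot q y e θ = 0 :=
    le_antisymm (not_lt.1 fun h => hθ (overshoot_pos_iff.1 h)) (overshoot_nonneg θ)
  unfold lowered; rw [h1]; ring

lemma lowered_mono (hq : Monotone q) (h0 : 0 ≤ δ) (h1 : δ ≤ 1) : Monotone (lowered q δ y e) := by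
  intro u v huv
  have hquv := hq huv
  by_cases hv : v ≤ e ∧ y < q v
  · by_cases hu : u ≤ e ∧ y < q u
    · have e1 := overshoot_eq (overshoot_pos_iff.2 hu)
      have e2 := overshoot_eq (overshoot_pos_iff.2 hv)
      unfold lowered
      rw [e1, e2]
      nlinarith
    · rw [lowered_eq hu]
      have : q u ≤ y := not_lt.1 fun h => hu ⟨huv.trans hv.1, h⟩
      exact this.trans (le_lowered h1 hv)
  · rw [lowered_eq hv]
    exact (lowered_le h0 u).trans hquv

lemma lowered_nonneg (hq0 : ∀ u, 0 ≤ q u) (hy : 0 ≤ y) (h1 : δ ≤ 1) (u : ℝ) :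
    0 ≤ lowered q δ y e u := by
  by_cases hu : u ≤ e ∧ y < q u
  · exact hy.trans (le_lowered h1 hu)
  · rw [lowered_eq hu]; exact hq0 u

lemma measurable_overshoot (hq : Monotone q) : Measurable (overshoot q y e) :=
  Measurable.ite measurableSet_Iic (measurable_const.max (hq.measurable.sub measurable_const))
    measurable_const

lemma overshoot_le (hq : Monotone q) (hq0 : ∀ u, 0 ≤ q u) (hy : 0 ≤ y) {θ : ℝ} (hθ : θ ≤ b) :
    overshoot q y e θ ≤ q b := by
  unfold overshoot; split_ifs
  · exact max_le (hq0 b) (by linarith [hq hθ])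
  · exact hq0 b

/-- The effect of lowering qualities on total surplus above `t`. -/
def surplusGain (b : ℝ) (c : ℝ → ℝ → ℝ) (F : Measure ℝ) (q q' : ℝ → ℝ) (t : ℝ) : ℝ :=
  ∫ θ in t..b, (surplus c (q' θ) θ - surplus c (q θ) θ) ∂F

/-- The effect of a change of qualities on the budget of the types above `t`. -/
def budgetGain (b : ℝ) (c h : ℝ → ℝ → ℝ) (F : Measure ℝ) (q q' : ℝ → ℝ) (t : ℝ) : ℝ :=
  surplusGain b c F q q' t - ∫ u in t..b, (h (q' u) u - h (q u) u) * tailMass b F u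

/-- The effect of a change of qualities on welfare. -/
def welfareGain (b : ℝ) (c h : ℝ → ℝ → ℝ) (F : Measure ℝ) (w q q' : ℝ → ℝ) (t : ℝ) : ℝ :=
  tailWeight b F w t * surplusGain b c F q q' t +
    ∫ u in t..b, (h (q' u) u - h (q u) u) * tailGap b F w t u

/-- Lowering excessive qualities, where this redistributes rents towards higher weights, has
first-order benefits and second-order costs. -/
lemma StrictTechnology.lowering (T : StrictTechnology a b c h f) (hF : FullLaw a b F)
    (hw : Hump a b F w p) (hq : Monotone q) (hq0 : ∀ u, 0 ≤ q u) {d : ℝ} (ht : t ∈ Ico a b)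
    (htd : t ≤ d) (hde : d < e) (heb : e ≤ b) (hy : 0 < y) (hd : ∀ u ∈ Ioo d e, y < q u)
    (hover : ∀ u ∈ Ioo t b, u ≤ e → y < q u → f u ≤ q u ∧ tailGap b F w t u < 0) :
    ∃ η K δ₀, 0 < η ∧ 0 ≤ K ∧ 0 < δ₀ ∧ ∀ δ, 0 < δ → δ ≤ δ₀ → δ ≤ 1 →
      0 ≤ budgetGain b c h F q (lowered q δ y e) t ∧
      budgetGain b c h F q (lowered q δ y e) t ≤ K * δ ∧
      η * δ ≤ welfareGain b c h F w q (lowered q δ y e) t := by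
  set φ := overshoot q y e with hφ
  have hm := hF.tailMass_pos ht
  have hW := hw.tailWeight_pos hF ht
  set m := tailMass b F t with hmdef
  set W := tailWeight b F w t with hWdef
  set M := q b with hM
  obtain ⟨κ, hκ, hκh⟩ := T.h_strict y M hy
  obtain ⟨Kh, hKh0, hKh⟩ := T.h_lip M
  obtain ⟨Kc, hKc0, hKc⟩ := T.c_lip M
  obtain ⟨L, hL0, hL⟩ := T.s_quad M
  have hM0 : 0 ≤ M := hq0 b
  have hgapc : Continuous (tailGap b F w t) := by
    have h1 := continuous_tailMass (F := F) b
    have h2 := hw.continuous_tailWeight b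
    unfold tailGap; fun_prop
  have hmc := continuous_tailMass (F := F) b
  have hφI : IntervalIntegrable φ volume t b := by
    rw [intervalIntegrable_iff_integrableOn_Ioc_of_le ht.2.le]
    refine Measure.integrableOn_of_bounded (M := M) (by simp)
      (measurable_overshoot hq).aestronglyMeasurable ?_
    filter_upwards [ae_restrict_mem measurableSet_Ioc] with u hu
    rw [Real.norm_eq_abs, abs_of_nonneg (overshoot_nonneg u)]
    exact overshoot_le hq hq0 hy.le hu.2
  have i0 : IntervalIntegrable (fun u => φ u * (- tailGap b F w t u)) volume t b :=
    hφI.mul_continuousOn hgapc.neg.continuousOn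
  have i1 : IntervalIntegrable (fun u => φ u * tailMass b F u) volume t b :=
    hφI.mul_continuousOn hmc.continuousOn
  have hmu : ∀ u ∈ Ioo t b, 0 < tailMass b F u := fun u hu =>
    hF.tailMass_pos ⟨ht.1.trans hu.1.le, hu.2⟩
  have hφd : ∀ u ∈ Ioo d e, 0 < φ u := fun u hu => overshoot_pos_iff.2 ⟨hu.2.le, hd u hu⟩
  have pos : ∀ g : ℝ → ℝ, IntervalIntegrable (fun u => φ u * g u) volume t b →
      (∀ u ∈ Ioo t b, 0 < φ u → 0 < g u) → 0 < ∫ u in t..b, φ u * g u := by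
    intro g hg hpos
    have hnn : ∀ u ∈ Ioo t b, 0 ≤ φ u * g u := by
      intro u hu
      rcases (overshoot_nonneg (q := q) (y := y) (e := e) u).eq_or_lt with h1 | h1
      · rw [hφ, ← h1, zero_mul]
      · exact (mul_pos h1 (hpos u hu h1)).le
    have hmono : ∀ u v, t ≤ u → u ≤ v → v ≤ b →
        IntervalIntegrable (fun u => φ u * g u) volume u v := fun u v h1 h2 h3 =>
      hg.mono_set (by rw [uIcc_of_le h2, uIcc_of_le ht.2.le]; exact Icc_subset_Icc h1 h3)
    rw [← intervalIntegral.integral_add_adjacent_intervals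
      (hmono t d le_rfl htd (hde.le.trans heb)) (hmono d b htd (hde.le.trans heb) le_rfl),
      ← intervalIntegral.integral_add_adjacent_intervals
      (hmono d e htd hde.le heb) (hmono e b (htd.trans hde.le) heb le_rfl)]
    have h1 : 0 ≤ ∫ u in t..d, φ u * g u := integral_nonneg_Ioo htd fun u hu =>
      hnn u ⟨hu.1, hu.2.trans (hde.trans_le heb)⟩
    have h2 : 0 ≤ ∫ u in e..b, φ u * g u := integral_nonneg_Ioo heb fun u hu =>
      hnn u ⟨htd.trans_lt (hde.trans hu.1), hu.2⟩
    have h3 : 0 < ∫ u in d..e, φ u * g u :=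
      intervalIntegral.intervalIntegral_pos_of_pos_on (hmono d e htd hde.le heb) (fun u hu =>
        mul_pos (hφd u hu) (hpos u ⟨htd.trans_lt hu.1, hu.2.trans_le heb⟩ (hφd u hu))) hde
    linarith
  have hc0 := pos _ i0 fun u hu h1 => by
    obtain ⟨h2, h3⟩ := overshoot_pos_iff.1 h1
    exact neg_pos.2 (hover u hu h2 h3).2
  have hc1 := pos _ i1 fun u hu _ => hmu u hu
  set c0 := ∫ u in t..b, φ u * (- tailGap b F w t u) with hc0def
  set c1 := ∫ u in t..b, φ u * tailMass b F u with hc1def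
  set A := L * M ^ 2 * m with hA
  have hA0 : 0 ≤ A := by positivity
  -- Changed rents yield at least `κ c0 δ` in welfare and `κ c1 δ` in the budget, while surplus
  -- falls by at most `A δ ^ 2`. The two bounds on `δ` keep the welfare value of this loss below
  -- half the former, and the loss itself below the latter.
  refine ⟨κ * c0 / 2, Kc * M * m + Kh * c1, min (κ * c0 / 2 / (W * A + 1)) (κ * c1 / (A + 1)),
    by positivity, by positivity, lt_min (by positivity) (by positivity), fun δ hδ hδ0 hδ1 => ?_⟩
  have hlm : Monotone (lowered q δ y e) := lowered_mono hq hδ.le hδ1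
  have hl0 := lowered_nonneg (e := e) hq0 hy.le hδ1
  have is : IntervalIntegrable (fun θ => surplus c (lowered q δ y e θ) θ - surplus c (q θ) θ) F t b :=
    (T.surplus_integrable hlm F _ _).sub (T.surplus_integrable hq F _ _)
  have ih : IntervalIntegrable (fun u => h (lowered q δ y e u) u - h (q u) u) volume t b :=
    (T.rent_integrable hlm _ _).sub (T.rent_integrable hq _ _)
  have hlow : ∀ u, q u - lowered q δ y e u = δ * φ u := fun u => by unfold lowered; ring
  have hrent : ∀ u ∈ Ioo t b, κ * δ * φ u ≤ h (q u) u - h (lowered q δ y e u) u ∧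
      h (q u) u - h (lowered q δ y e u) u ≤ Kh * δ * φ u := by
    intro u hu
    by_cases hu' : u ≤ e ∧ y < q u
    · have h1 := hκh u _ _ (le_lowered hδ1 hu') (lowered_le hδ.le u) (hq hu.2.le)
      have h2 := hKh u _ _ (hl0 u) (lowered_le hδ.le u) (hq hu.2.le)
      rw [hlow] at h1 h2
      constructor <;> linarith
    · have h1 := hlow u
      rw [lowered_eq hu'] at h1 ⊢
      have h2 : δ * φ u = 0 := by linarith
      rw [mul_assoc, mul_assoc, h2]
      simp
  have hs : ∀ u ∈ Ioo t b, - (L * M ^ 2 * δ ^ 2) ≤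
      surplus c (lowered q δ y e u) u - surplus c (q u) u ∧
      surplus c (lowered q δ y e u) u - surplus c (q u) u ≤ Kc * M * δ := by
    intro u hu
    have hφM : φ u ≤ M := overshoot_le hq hq0 hy.le hu.2.le
    have hφ0 : 0 ≤ φ u := overshoot_nonneg u
    have hδφ : δ * φ u ≤ δ * M := mul_le_mul_of_nonneg_left hφM hδ.le
    have hδφ0 : 0 ≤ δ * φ u := mul_nonneg hδ.le hφ0
    constructor
    · have hpos : 0 ≤ L * M ^ 2 * δ ^ 2 := by positivity
      by_cases hu' : u ≤ e ∧ y < q u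
      · have hfq := (hover u hu hu'.1 hu'.2).1
        -- Quality starts at or above the first best. Lowering it either stays above, which does not
        -- reduce surplus, or falls short by at most `δ M`, which costs only a quadratic amount.
        rcases le_total (f u) (lowered q δ y e u) with h1 | h1
        · have := T.surplus_le_right h1 (lowered_le hδ.le u)
          linarith
        · have h2 := hL u _ (hl0 u) ((lowered_le hδ.le u).trans (hq hu.2.le))
          have h3 := T.surplus_le_firstBest (u := u) (hq0 u)
          have h4 : (lowered q δ y e u - f u) ^ 2 ≤ (δ * M) ^ 2 := by
            have := hlow u
            rw [← neg_sq]
            exact pow_le_pow_left₀ (by linarith) (by linarith) 2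
          have h5 := mul_le_mul_of_nonneg_left h4 hL0
          simp only [surplus] at *
          nlinarith
      · rw [lowered_eq hu']; linarith
    · have h1 := hKc u _ _ (hl0 u) (lowered_le hδ.le u) (hq hu.2.le)
      rw [hlow] at h1
      have h2 := mul_le_mul_of_nonneg_left hδφ hKc0
      have h3 := hlow u
      unfold surplus
      linarith
  have hσ1 : - (A * δ ^ 2) ≤ surplusGain b c F q (lowered q δ y e) t := by
    have := integral_mono_Ioo ht.2.le intervalIntegrable_const is fun u hu => (hs u hu).1
    refine le_trans (le_of_eq ?_) this
    have h1 : ∫ _ in t..b, -(L * M ^ 2 * δ ^ 2) ∂F =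
        -(L * M ^ 2 * δ ^ 2) * ∫ _ in t..b, (1 : ℝ) ∂F := by
      rw [← intervalIntegral.integral_const_mul]; simp
    rw [h1, hA, hmdef, tailMass]; ring
  have hσ2 : surplusGain b c F q (lowered q δ y e) t ≤ Kc * M * m * δ := by
    have := integral_mono_Ioo ht.2.le is intervalIntegrable_const fun u hu => (hs u hu).2
    refine le_trans this (le_of_eq ?_)
    have h1 : ∫ _ in t..b, (Kc * M * δ) ∂F = (Kc * M * δ) * ∫ _ in t..b, (1 : ℝ) ∂F := by
      rw [← intervalIntegral.integral_const_mul]; simp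
    rw [h1, hmdef, tailMass]; ring
  have im : IntervalIntegrable (fun u => (h (lowered q δ y e u) u - h (q u) u) * tailMass b F u)
      volume t b := ih.mul_continuousOn hmc.continuousOn
  have hB1 : ∫ u in t..b, (h (lowered q δ y e u) u - h (q u) u) * tailMass b F u ≤
      - (κ * δ) * c1 := by
    rw [hc1def, ← intervalIntegral.integral_const_mul]
    refine integral_mono_Ioo ht.2.le im (i1.const_mul _) fun u hu => ?_
    have := mul_le_mul_of_nonneg_right (hrent u hu).1 (hmu u hu).le
    linarith
  have hB2 : - (Kh * δ) * c1 ≤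
      ∫ u in t..b, (h (lowered q δ y e u) u - h (q u) u) * tailMass b F u := by
    rw [hc1def, ← intervalIntegral.integral_const_mul]
    refine integral_mono_Ioo ht.2.le (i1.const_mul _) im fun u hu => ?_
    have := mul_le_mul_of_nonneg_right (hrent u hu).2 (hmu u hu).le
    linarith
  have hV : κ * δ * c0 ≤
      ∫ u in t..b, (h (lowered q δ y e u) u - h (q u) u) * tailGap b F w t u := by
    rw [hc0def, ← intervalIntegral.integral_const_mul]
    refine integral_mono_Ioo ht.2.le (i0.const_mul _) (ih.mul_continuousOn hgapc.continuousOn)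
      fun u hu => ?_
    by_cases hu' : u ≤ e ∧ y < q u
    · have := mul_le_mul_of_nonneg_right (hrent u hu).1 (neg_pos.2 (hover u hu hu'.1 hu'.2).2).le
      linarith
    · have h1 := hlow u
      rw [lowered_eq hu'] at h1 ⊢
      have h2 : φ u = 0 := by
        rcases mul_eq_zero.1 (show δ * φ u = 0 by linarith) with h3 | h3
        · exact absurd h3 hδ.ne'
        · exact h3
      rw [h2]; simp
  have hδ2 : δ * (W * A + 1) ≤ κ * c0 / 2 := by
    rw [← le_div_iff₀ (by positivity)]; exact hδ0.trans (min_le_left _ _)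
  have hδ3 : δ * (A + 1) ≤ κ * c1 := by
    rw [← le_div_iff₀ (by positivity)]; exact hδ0.trans (min_le_right _ _)
  unfold budgetGain welfareGain
  refine ⟨?_, ?_, ?_⟩
  · nlinarith
  · nlinarith
  · have := mul_le_mul_of_nonneg_left hσ1 hW.le
    nlinarith

end Lowering
end RatingDesign

/-! ### Distributing the budget gain -/

namespace RatingDesign
open Filter Topology
noncomputable section Perturbation
set_option linter.unusedSectionVars false

variable {a b : ℝ} {c h : ℝ → ℝ → ℝ} {f q q' U w : ℝ → ℝ} {p t τ x e y δ : ℝ} {F : Measure ℝ}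
  [IsProbabilityMeasure F] [NullSingletonClass F]

/-- The budget gain is the total rise of prices net of the rise of profits. -/
lemma budgetGain_eq (T : Technology a b c h f) (hq : Monotone q) (hq' : Monotone q') (ht : t ≤ b) :
    budgetGain b c h F q q' t =
      ∫ θ in t..b, ((surplus c (q' θ) θ - surplus c (q θ) θ) -
        ∫ u in t..θ, (h (q' u) u - h (q u) u)) ∂F := by
  have ih : ∀ u v, IntervalIntegrable (fun u => h (q' u) u - h (q u) u) volume u v := fun u v =>
    (T.rent_integrable hq' _ _).sub (T.rent_integrable hq _ _)
  have is : IntervalIntegrable (fun θ => surplus c (q' θ) θ - surplus c (q θ) θ) F t b :=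
    (T.surplus_integrable hq' F _ _).sub (T.surplus_integrable hq F _ _)
  have h1 := integral_mul_primitive (F := F) (g := fun _ => 1) ht intervalIntegrable_const (ih t b)
  rw [intervalIntegral.integral_sub is
    ((intervalIntegral.continuous_primitive ih t).intervalIntegrable _ _)]
  simp only [one_mul] at h1
  rw [h1]; rfl

/-- An optimal plan cannot be improved by lowering qualities and distributing the gain equally. -/
lemma OptimalPlan.not_lowering_bottom (O : OptimalPlan a b c h F w q U)
    (T : StrictTechnology a b c h f) (hF : FullLaw a b F) (hw : Hump a b F w p)
    (haτ : a ≤ τ) (hτb : τ ≤ b)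
    (hst : a = τ ∨ (f a ≤ x ∧ surplus c (f a) a ≤ U a)) (hy0 : 0 ≤ y) (hδ0 : 0 ≤ δ) (hδ1 : δ ≤ 1)
    (hbelow : ∀ z ∈ Ioo a τ, min (f z) x ≤ lowered q δ y e z ∧ lowered q δ y e z ≤ x)
    (habove : ∀ z ∈ Ioo τ b, x ≤ lowered q δ y e z ∧ lowered q δ y e z ≤ max (f z) x)
    (hG : 0 ≤ budgetGain b c h F q (lowered q δ y e) a) :
    welfareGain b c h F w q (lowered q δ y e) a ≤ 0 := by
  have hab := T.lt
  have hm := hF.tailMass_pos (t := a) ⟨le_rfl, hab⟩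
  have hlm : Monotone (lowered q δ y e) := lowered_mono O.mono hδ0 hδ1
  have hl0 := lowered_nonneg (e := e) O.nonneg hy0 hδ1
  set q₁ := lowered q δ y e
  set G := budgetGain b c h F q q₁ a with hGdef
  set m := tailMass b F a with hmdef
  have hk : 0 ≤ G / m := div_nonneg hG hm.le
  -- The gain is paid out equally per head, and an equal transfer leaves incentives unchanged.
  set U₁ : ℝ → ℝ := fun θ => (U a + G / m) + ∫ z in a..θ, h (q₁ z) z with hU₁
  have S : Schedule h q₁ U₁ := Schedule.of_rent T.toTechnology hlm hl0 _ _
  have hU₁a : U₁ a = U a + G / m := by simp [hU₁]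
  have ih : ∀ u v, IntervalIntegrable (fun u => h (q₁ u) u - h (q u) u) volume u v := fun u v =>
    (T.rent_integrable hlm _ _).sub (T.rent_integrable O.mono _ _)
  have hD : ∀ θ, excess c q₁ U₁ θ = excess c q U θ + (G / m -
      ((surplus c (q₁ θ) θ - surplus c (q θ) θ) - ∫ u in a..θ, (h (q₁ u) u - h (q u) u))) := by
    intro θ
    have h1 := O.env a θ
    rw [intervalIntegral.integral_sub (T.rent_integrable hlm _ _) (T.rent_integrable O.mono _ _)]
    simp only [excess, hU₁]
    linarith
  have ib : IntervalIntegrable (fun θ => (surplus c (q₁ θ) θ - surplus c (q θ) θ) -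
      ∫ u in a..θ, (h (q₁ u) u - h (q u) u)) F a b :=
    ((T.surplus_integrable hlm F _ _).sub (T.surplus_integrable O.mono F _ _)).sub
      ((intervalIntegral.continuous_primitive ih a).intervalIntegrable _ _)
  have hbal : ∫ θ in a..b, excess c q₁ U₁ θ ∂F = 0 := by
    simp_rw [hD]
    rw [intervalIntegral.integral_add (O.excess_integrable T.toTechnology _ _)
      (intervalIntegrable_const.sub ib), O.balance, intervalIntegral.integral_sub
      intervalIntegrable_const ib, ← budgetGain_eq T.toTechnology O.mono hlm hab.le]
    have h1 : ∫ _ in a..b, G / m ∂F = G / m * ∫ _ in a..b, (1 : ℝ) ∂F := by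
      rw [← intervalIntegral.integral_const_mul]; simp
    rw [h1]
    change 0 + (G / m * m - G) = 0
    field_simp
    ring
  have P : Plan a b c h F q₁ U₁ := by
    refine S.plan T.toTechnology le_rfl haτ hτb (x := x) (by linarith [O.part]) ?_ hbelow habove
      ?_ hbal
    · intro u hu
      rw [le_antisymm hu.2 hu.1]; simp
    · refine hst.imp_right fun h1 => ⟨h1.1, ?_⟩
      linarith [h1.2]
  have key := welfare_sub T.toTechnology hw S O.toSchedule (hbal.trans O.balance.symm) hab.le
  have hle := O.optimal _ _ P
  rw [intervalIntegral.integral_same, zero_add] at key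
  unfold welfareGain surplusGain
  rw [← key]
  exact mul_nonpos_of_nonneg_of_nonpos hm.le (by linarith)

/-- The rents from raising qualities of the types in `[u, t]` to the first best of type `t`. -/
def raiseRent (h : ℝ → ℝ → ℝ) (f : ℝ → ℝ) (t u : ℝ) : ℝ :=
  ∫ z in u..t, (h (f t) z - h (f z) z)

lemma raise_integrable (T : Technology a b c h f) (t u v : ℝ) :
    IntervalIntegrable (fun z => h (f t) z - h (f z) z) volume u v :=
  (T.rent_integrable (q := fun _ => f t) monotone_const u v).sub (T.rent_integrable T.f_mono u v)

lemma raiseRent_continuous (T : Technology a b c h f) (t : ℝ) : Continuous (raiseRent h f t) := by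
  have := (intervalIntegral.continuous_primitive (raise_integrable T t) t).neg
  refine this.congr fun u => ?_
  exact (intervalIntegral.integral_symm _ _).symm

lemma StrictTechnology.raiseRent_pos (T : StrictTechnology a b c h f) {u : ℝ} (hu : a ≤ u)
    (hut : u < t) (ht : t ≤ b) : 0 < raiseRent h f t u := by
  obtain ⟨κ, hκ, hκh⟩ := T.h_strict (f a) (f t) (T.f_pos a)
  refine intervalIntegral.intervalIntegral_pos_of_pos_on (raise_integrable T.toTechnology t u t)
    (fun z hz => ?_) hut
  have h1 : f z < f t := T.f_strict ⟨hu.trans hz.1.le, hz.2.le.trans ht⟩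
    ⟨hu.trans hut.le, ht⟩ hz.2
  have := hκh z _ _ (T.f_mono (hu.trans hz.1.le)) h1.le le_rfl
  nlinarith

/-- The loss of surplus from raising qualities equals the rents left to be earned. -/
lemma raise_loss (T : Technology a b c h f) {θ : ℝ} (ht : t ∈ Icc a b) (hθ : θ ∈ Icc a t) :
    surplus c (f θ) θ - surplus c (f t) θ = raiseRent h f t θ := by
  have hθb : θ ∈ Icc a b := ⟨hθ.1, hθ.2.trans ht.2⟩
  have h1 := T.firstBest_envelope hθb ht hθ.2
  have h2 := T.ftc (f t) (T.f_pos t).le θ hθb t ht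
  rw [raiseRent, intervalIntegral.integral_sub (T.rent_integrable (q := fun _ => f t)
    monotone_const _ _) (T.rent_integrable T.f_mono _ _), ← h2, ← h1]
  unfold surplus
  ring

/-- The schedule `q'`, raised to the first best of `t` for types above `u`. -/
def raised (q' f : ℝ → ℝ) (t u θ : ℝ) : ℝ := if θ < u then q' θ else max (q' θ) (f t)

lemma raised_mono (hq : Monotone q') (u : ℝ) : Monotone (raised q' f t u) := by
  intro θ θ' hθ
  unfold raised
  split_ifs with h1 h2 h2
  · exact hq hθ
  · exact (hq hθ).trans (le_max_left _ _)
  · exact absurd (hθ.trans_lt h2) h1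
  · exact max_le_max (hq hθ) le_rfl

/-- An optimal plan cannot be improved by lowering qualities and distributing the gain to the types
above `u`. -/
lemma OptimalPlan.not_lowering_raise (O : OptimalPlan a b c h F w q U)
    (T : StrictTechnology a b c h f) (hF : FullLaw a b F) (hw : Hump a b F w p) {u : ℝ}
    (hu : u ∈ Ioc a t) (htb : t < b) (htτ : t ≤ τ) (hτb : τ ≤ b)
    (hfb : ∀ θ ∈ Ioo a t, q θ = f θ) (hex : ∀ θ ∈ Ioo a t, excess c q U θ = 0)
    (hst : t = τ ∨ (f t ≤ x ∧ surplus c (f t) t ≤ U t)) (hy0 : f t ≤ y) (hδ0 : 0 ≤ δ) (hδ1 : δ ≤ 1)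
    (hbelow : ∀ z ∈ Ioo t τ, min (f z) x ≤ lowered q δ y e z ∧ lowered q δ y e z ≤ x)
    (habove : ∀ z ∈ Ioo τ b, x ≤ lowered q δ y e z ∧ lowered q δ y e z ≤ max (f z) x)
    (hG : raiseRent h f t u * tailMass b F u = budgetGain b c h F q (lowered q δ y e) t) :
    welfareGain b c h F w q (lowered q δ y e) t ≤
      tailWeight b F w t * (raiseRent h f t u * (tailMass b F u - tailMass b F t)) := by
  have hat : a < t := hu.1.trans_le hu.2
  have htI : t ∈ Icc a b := ⟨hat.le, htb.le⟩
  have hm := hF.tailMass_pos ⟨hat.le, htb⟩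
  have hW := hw.tailWeight_pos hF ⟨hat.le, htb⟩
  have hlm : Monotone (lowered q δ y e) := lowered_mono O.mono hδ0 hδ1
  have hl0 := lowered_nonneg (e := e) O.nonneg ((T.f_pos t).le.trans hy0) hδ1
  set q₂ := lowered q δ y e with hq₂
  set m := tailMass b F t with hmdef
  set W := tailWeight b F w t with hWdef
  set B := raiseRent h f t u with hB
  have hB0 : 0 ≤ B := intervalIntegral.integral_nonneg hu.2 fun z hz =>
    sub_nonneg.2 (T.h_mono z _ _ (T.f_pos z).le (T.f_mono hz.2))
  set q₁ := raised q₂ f t u with hq₁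
  have hq₁m : Monotone q₁ := raised_mono hlm u
  have hq₁0 : ∀ z, 0 ≤ q₁ z := by
    intro z; rw [hq₁]; unfold raised; split_ifs
    · exact hl0 z
    · exact le_max_of_le_left (hl0 z)
  have e1 : ∀ z ∈ Ioo a t, q₂ z = f z := by
    intro z hz
    rw [hq₂, lowered_eq, hfb z hz]
    rintro ⟨_, h1⟩
    rw [hfb z hz] at h1
    exact absurd (hy0.trans_lt h1) (not_lt.2 (T.f_mono hz.2.le))
  have e2 : ∀ z ∈ Ioo a u, q₁ z = q z := by
    intro z hz
    have hz' : z ∈ Ioo a t := ⟨hz.1, hz.2.trans_le hu.2⟩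
    rw [hq₁, raised, if_pos hz.2, e1 z hz', hfb z hz']
  have e3 : ∀ z ∈ Ioo u t, q₁ z = f t := by
    intro z hz
    rw [hq₁, raised, if_neg (not_lt.2 hz.1.le), e1 z ⟨hu.1.trans hz.1, hz.2⟩,
      max_eq_right (T.f_mono hz.2.le)]
  have hqt : ∀ z, t ≤ z → f t ≤ q z := by
    intro z hz
    refine le_trans (ge_of_dense O.mono T.f_cont (u := a) (v := t) (fun u' v' h1 h2 h3 => ?_)
      ⟨hat, le_rfl⟩) (O.mono hz)
    obtain ⟨z, hz⟩ := exists_between h2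
    exact ⟨z, hz, (hfb z ⟨h1.trans_lt hz.1, hz.2.trans_le h3⟩).ge⟩
  have e4 : ∀ z, t ≤ z → q₁ z = q₂ z := by
    intro z hz
    have h1 : f t ≤ q₂ z := by
      by_cases h2 : z ≤ e ∧ y < q z
      · exact hy0.trans (le_lowered hδ1 h2)
      · rw [hq₂, lowered_eq h2]; exact hqt z hz
    rw [hq₁, raised, if_neg (not_lt.2 (hu.2.trans hz)), max_eq_left h1]
  -- A transfer to the types above `t` alone would break the envelope formula at `t`. Raising the
  -- qualities of `(u, t)` to `f t` creates the rent `B` that all types above `t` then receive.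
  set U₁ : ℝ → ℝ := fun θ => U a + ∫ z in a..θ, h (q₁ z) z with hU₁
  have S : Schedule h q₁ U₁ := Schedule.of_rent T.toTechnology hq₁m hq₁0 _ _
  have hU₁a : U₁ a = U a := by simp [hU₁]
  have congrI : ∀ {g k : ℝ → ℝ} {r s : ℝ}, r ≤ s → (∀ z ∈ Ioo r s, g z = k z) →
      ∫ z in r..s, h (g z) z = ∫ z in r..s, h (k z) z := by
    intro g k r s hrs hgk
    refine intervalIntegral.integral_congr_uIoo fun z hz => ?_
    rw [uIoo_of_le hrs] at hz
    simp only [hgk z hz]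
  have d1 : ∀ θ ∈ Icc a u, U₁ θ = U θ := by
    intro θ hθ
    have h1 := O.env a θ
    have h2 := congrI hθ.1 (fun z hz => e2 z ⟨hz.1, hz.2.trans_le hθ.2⟩)
    simp only [hU₁, h2]; linarith
  have d2 : ∀ θ ∈ Icc u t, U₁ θ = U θ + (B - raiseRent h f t θ) := by
    intro θ hθ
    have h1 := O.env u θ
    have h2 := S.env u θ
    have h3 := d1 u ⟨hu.1.le, le_rfl⟩
    have h4 := congrI hθ.1 (g := q₁) (k := fun _ => f t) fun z hz =>
      e3 z ⟨hz.1, hz.2.trans_le hθ.2⟩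
    have h5 := congrI hθ.1 (g := q) (k := f) fun z hz =>
      hfb z ⟨hu.1.trans hz.1, hz.2.trans_le hθ.2⟩
    have h6 : B - raiseRent h f t θ = ∫ z in u..θ, (h (f t) z - h (f z) z) := by
      rw [hB, raiseRent, raiseRent, ← intervalIntegral.integral_add_adjacent_intervals
        (raise_integrable T.toTechnology t u θ) (raise_integrable T.toTechnology t θ t)]
      ring
    rw [h6, intervalIntegral.integral_sub (T.rent_integrable (q := fun _ => f t)
      monotone_const _ _) (T.rent_integrable T.f_mono _ _)]
    linarith
  have d3 : U₁ t = U t + B := by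
    rw [d2 t ⟨hu.2, le_rfl⟩]; simp [raiseRent]
  have ih : ∀ r s, IntervalIntegrable (fun u => h (q₂ u) u - h (q u) u) volume r s := fun r s =>
    (T.rent_integrable hlm _ _).sub (T.rent_integrable O.mono _ _)
  have d4 : ∀ θ, t ≤ θ → U₁ θ = U θ + B + ∫ z in t..θ, (h (q₂ z) z - h (q z) z) := by
    intro θ hθ
    have h1 := O.env t θ
    have h2 := S.env t θ
    have h4 := congrI hθ (g := q₁) (k := q₂) fun z hz => e4 z hz.1.le
    rw [intervalIntegral.integral_sub (T.rent_integrable hlm _ _) (T.rent_integrable O.mono _ _)]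
    linarith
  have x1 : ∀ θ ∈ Ioo a u, excess c q₁ U₁ θ = 0 := by
    intro θ hθ
    rw [← hex θ ⟨hθ.1, hθ.2.trans_le hu.2⟩, excess, excess, e2 θ hθ, d1 θ ⟨hθ.1.le, hθ.2.le⟩]
  -- The part of `B` that is earned only above `θ` equals the surplus lost by raising `θ` to `f t`
  -- (`raise_loss`), so the excess is the full `B` throughout `(u, t)`.
  have x2 : ∀ θ ∈ Ioo u t, excess c q₁ U₁ θ = B := by
    intro θ hθ
    have hθt : θ ∈ Ioo a t := ⟨hu.1.trans hθ.1, hθ.2⟩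
    have h1 := hex θ hθt
    have h2 := raise_loss T.toTechnology htI ⟨hθt.1.le, hθ.2.le⟩
    rw [excess, hfb θ hθt] at h1
    rw [excess, e3 θ hθ, d2 θ ⟨hθ.1.le, hθ.2.le⟩]
    linarith
  have x3 : ∀ θ, t ≤ θ → excess c q₁ U₁ θ = excess c q U θ + (B -
      ((surplus c (q₂ θ) θ - surplus c (q θ) θ) - ∫ z in t..θ, (h (q₂ z) z - h (q z) z))) := by
    intro θ hθ
    rw [excess, excess, e4 θ hθ, d4 θ hθ]; ring
  have iD := S.excess_integrable (F := F) T.toTechnology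
  have const : ∀ (k r s : ℝ), ∫ _ in r..s, k ∂F = k * (tailMass b F r - tailMass b F s) := by
    intro k r s
    rw [tailMass_sub, ← intervalIntegral.integral_const_mul]; simp
  have s0 : ∀ v ∈ Icc a u, ∫ θ in a..v, excess c q₁ U₁ θ ∂F = 0 := by
    intro v hv
    rw [integral_congr_Ioo (k := fun _ => 0) hv.1 fun θ hθ => x1 θ ⟨hθ.1, hθ.2.trans_le hv.2⟩]
    simp
  have s1 : ∫ θ in u..t, excess c q₁ U₁ θ ∂F = B * (tailMass b F u - m) := by
    rw [integral_congr_Ioo hu.2 x2, const]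
  have s2 : ∫ θ in t..b, excess c q₁ U₁ θ ∂F = B * m - budgetGain b c h F q q₂ t := by
    have ib : IntervalIntegrable (fun θ => (surplus c (q₂ θ) θ - surplus c (q θ) θ) -
        ∫ u in t..θ, (h (q₂ u) u - h (q u) u)) F t b :=
      ((T.surplus_integrable hlm F _ _).sub (T.surplus_integrable O.mono F _ _)).sub
        ((intervalIntegral.continuous_primitive ih t).intervalIntegrable _ _)
    have iE := O.excess_integrable (F := F) T.toTechnology
    have h0 : ∫ θ in a..t, excess c q U θ ∂F = 0 := by
      rw [integral_congr_Ioo hat.le hex]; simp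
    have h1 := intervalIntegral.integral_add_adjacent_intervals (iE a t) (iE t b)
    have h2 := O.balance
    rw [integral_congr_Ioo htb.le fun θ hθ => x3 θ hθ.1.le,
      intervalIntegral.integral_add (iE _ _) (intervalIntegrable_const.sub ib),
      intervalIntegral.integral_sub intervalIntegrable_const ib,
      ← budgetGain_eq T.toTechnology O.mono hlm htb.le, const]
    have h3 : tailMass b F b = 0 := by simp [tailMass]
    rw [h3, ← hmdef]
    linarith
  have hbal : ∫ θ in a..b, excess c q₁ U₁ θ ∂F = 0 := by
    rw [← intervalIntegral.integral_add_adjacent_intervals (iD a t) (iD t b),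
      ← intervalIntegral.integral_add_adjacent_intervals (iD a u) (iD u t),
      s0 u ⟨hu.1.le, le_rfl⟩, s1, s2, ← hG]
    ring
  have P : Plan a b c h F q₁ U₁ := by
    refine S.plan T.toTechnology hat.le htτ hτb (x := x) (by rw [hU₁a]; exact O.part) ?_ ?_ ?_
      ?_ hbal
    · intro v hv
      rcases le_total v u with h1 | h1
      · exact (s0 v ⟨hv.1, h1⟩).ge
      · rw [← intervalIntegral.integral_add_adjacent_intervals (iD a u) (iD u v),
          s0 u ⟨hu.1.le, le_rfl⟩, zero_add]
        exact integral_nonneg_Ioo h1 fun θ hθ => (x2 θ ⟨hθ.1, hθ.2.trans_le hv.2⟩).symm ▸ hB0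
    · intro z hz; rw [e4 z hz.1.le]; exact hbelow z hz
    · intro z hz; rw [e4 z (htτ.trans hz.1.le)]; exact habove z hz
    · refine hst.imp_right fun h1 => ⟨h1.1, ?_⟩
      rw [d3]; linarith [h1.2]
  have key := welfare_sub T.toTechnology hw S O.toSchedule (hbal.trans O.balance.symm) htb.le
  have hle := O.optimal _ _ P
  have is : ∀ r s, IntervalIntegrable (fun θ => surplus c (q₁ θ) θ - surplus c (q θ) θ) F r s :=
    fun r s => (T.surplus_integrable hq₁m F _ _).sub (T.surplus_integrable O.mono F _ _)
  have ig : ∀ r s, IntervalIntegrable (fun θ => (m * w θ - W) * (U₁ θ - U θ)) F r s :=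
    fun r s => (hw.gap_integrable m W r s).mul_continuousOn
      ((S.continuous T.toTechnology).sub (O.continuous T.toTechnology)).continuousOn
  have k1 : ∫ θ in a..b, (surplus c (q₁ θ) θ - surplus c (q θ) θ) ∂F =
      (∫ θ in a..t, (surplus c (q₁ θ) θ - surplus c (q θ) θ) ∂F) + surplusGain b c F q q₂ t := by
    rw [← intervalIntegral.integral_add_adjacent_intervals (is a t) (is t b), surplusGain]
    congr 1
    exact integral_congr_Ioo htb.le fun θ hθ => by rw [e4 θ hθ.1.le]
  have k2 : ∫ z in t..b, (h (q₁ z) z - h (q z) z) * tailGap b F w t z =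
      ∫ z in t..b, (h (q₂ z) z - h (q z) z) * tailGap b F w t z := by
    refine intervalIntegral.integral_congr_uIoo fun z hz => ?_
    rw [uIoo_of_le htb.le] at hz
    simp only [e4 z hz.1.le]
  -- On `(u, t)` the integrand equals `m w (B - raiseRent h f t θ) - W B`, whose first term is
  -- nonnegative; below `u` it is zero.
  have k3 : - (W * (B * (tailMass b F u - m))) ≤
      (∫ θ in a..t, (m * w θ - W) * (U₁ θ - U θ) ∂F) +
      W * ∫ θ in a..t, (surplus c (q₁ θ) θ - surplus c (q θ) θ) ∂F := by
    rw [← intervalIntegral.integral_const_mul, ← intervalIntegral.integral_add (ig _ _)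
      ((is _ _).const_mul _)]
    have hI : ∀ r s, IntervalIntegrable (fun θ => (m * w θ - W) * (U₁ θ - U θ) +
      W * (surplus c (q₁ θ) θ - surplus c (q θ) θ)) F r s := fun r s =>
        (ig r s).add ((is r s).const_mul _)
    rw [← intervalIntegral.integral_add_adjacent_intervals (hI a u) (hI u t)]
    have h1 : ∫ θ in a..u, ((m * w θ - W) * (U₁ θ - U θ) +
        W * (surplus c (q₁ θ) θ - surplus c (q θ) θ)) ∂F = 0 := by
      rw [integral_congr_Ioo (k := fun _ => 0) hu.1.le]
      · simp
      · intro θ hθ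
        rw [e2 θ hθ, d1 θ ⟨hθ.1.le, hθ.2.le⟩]; ring
    have h2 := integral_mono_Ioo hu.2 (g := fun _ => - (W * B)) intervalIntegrable_const (hI u t)
      fun θ hθ => by
        have hθt : θ ∈ Ioo a t := ⟨hu.1.trans hθ.1, hθ.2⟩
        have h3 := raise_loss T.toTechnology htI ⟨hθt.1.le, hθ.2.le⟩
        have h4 : 0 ≤ B - raiseRent h f t θ := by
          have := x2 θ hθ
          have h5 := hex θ hθt
          rw [excess, e3 θ hθ] at this
          rw [excess, hfb θ hθt] at h5
          have h6 := d2 θ ⟨hθ.1.le, hθ.2.le⟩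
          have h7 : raiseRent h f t θ ≤ B := by
            rw [hB, raiseRent, raiseRent, ← intervalIntegral.integral_add_adjacent_intervals
              (raise_integrable T.toTechnology t u θ) (raise_integrable T.toTechnology t θ t)]
            have : 0 ≤ ∫ z in u..θ, (h (f t) z - h (f z) z) :=
              intervalIntegral.integral_nonneg hθ.1.le fun z hz =>
                sub_nonneg.2 (T.h_mono z _ _ (T.f_pos z).le (T.f_mono (hz.2.trans hθ.2.le)))
            linarith
          linarith
        have h5 := hw.nonneg θ ⟨hθt.1.le, hθ.2.le.trans htb.le⟩
        rw [e3 θ hθ, hfb θ hθt, d2 θ ⟨hθ.1.le, hθ.2.le⟩]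
        have h6 : 0 ≤ m * w θ * (B - raiseRent h f t θ) := by positivity
        have h7 : surplus c (f t) θ - surplus c (f θ) θ = - raiseRent h f t θ := by linarith
        rw [h7]
        linarith
    rw [const] at h2
    linarith
  rw [k1, k2] at key
  have hle' : m * (∫ θ in a..b, w θ * U₁ θ ∂F - ∫ θ in a..b, w θ * U θ ∂F) ≤ 0 :=
    mul_nonpos_of_nonneg_of_nonpos hm.le (by linarith)
  unfold welfareGain
  linarith

end Perturbation
end RatingDesign

/-! ### Optimal qualities cannot be profitably lowered -/

namespace RatingDesign
open Filter Topology
noncomputable section Perturbation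
set_option linter.unusedSectionVars false

variable {a b : ℝ} {c h : ℝ → ℝ → ℝ} {f q q' U w : ℝ → ℝ} {p t τ x e y δ : ℝ} {F : Measure ℝ}
  [IsProbabilityMeasure F] [NullSingletonClass F]

/-- In an optimal plan, qualities cannot be profitably lowered. -/
lemma OptimalPlan.not_lowerable (O : OptimalPlan a b c h F w q U)
    (T : StrictTechnology a b c h f) (hF : FullLaw a b F) (hw : Hump a b F w p)
    (ht : t ∈ Ico a b) (htτ : t ≤ τ) (hτb : τ ≤ b)
    (hfb : ∀ θ ∈ Ioo a t, q θ = f θ) (hex : ∀ θ ∈ Ioo a t, excess c q U θ = 0)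
    (hst : t = τ ∨ (f t ≤ x ∧ surplus c (f t) t ≤ U t))
    (hbelow : ∀ z ∈ Ioo t τ, min (f z) x ≤ q z ∧ q z ≤ x)
    (habove : ∀ z ∈ Ioo τ b, x ≤ q z ∧ q z ≤ max (f z) x)
    (hy : f t ≤ y)
    (hyb : ∀ z ∈ Ioo t τ, z ≤ e → y < q z → min (f z) x ≤ y)
    (hya : ∀ z ∈ Ioo τ b, z ≤ e → y < q z → x ≤ y)
    (hlow : ∃ η K δ₀, 0 < η ∧ 0 ≤ K ∧ 0 < δ₀ ∧ ∀ δ, 0 < δ → δ ≤ δ₀ → δ ≤ 1 →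
      0 ≤ budgetGain b c h F q (lowered q δ y e) t ∧
      budgetGain b c h F q (lowered q δ y e) t ≤ K * δ ∧
      η * δ ≤ welfareGain b c h F w q (lowered q δ y e) t) : False := by
  have hy0 : 0 < y := (T.f_pos t).trans_le hy
  have hm := hF.tailMass_pos ht
  have hW := hw.tailWeight_pos hF ht
  obtain ⟨η, K, δ₀, hη, hK, hδ₀, hlow⟩ := hlow
  have hb' : ∀ δ, 0 ≤ δ → δ ≤ 1 → ∀ z ∈ Ioo t τ,
      min (f z) x ≤ lowered q δ y e z ∧ lowered q δ y e z ≤ x := by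
    intro δ h0 h1 z hz
    refine ⟨?_, (lowered_le h0 z).trans (hbelow z hz).2⟩
    by_cases h2 : z ≤ e ∧ y < q z
    · exact (hyb z hz h2.1 h2.2).trans (le_lowered h1 h2)
    · rw [lowered_eq h2]; exact (hbelow z hz).1
  have ha' : ∀ δ, 0 ≤ δ → δ ≤ 1 → ∀ z ∈ Ioo τ b,
      x ≤ lowered q δ y e z ∧ lowered q δ y e z ≤ max (f z) x := by
    intro δ h0 h1 z hz
    refine ⟨?_, (lowered_le h0 z).trans (habove z hz).2⟩
    by_cases h2 : z ≤ e ∧ y < q z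
    · exact (hya z hz h2.1 h2.2).trans (le_lowered h1 h2)
    · rw [lowered_eq h2]; exact (habove z hz).1
  rcases ht.1.eq_or_lt with rfl | hat
  · set δ := min δ₀ 1 with hδ
    have hδ0 : 0 < δ := lt_min hδ₀ one_pos
    have hδ1 : δ ≤ 1 := min_le_right _ _
    obtain ⟨h1, _, h3⟩ := hlow δ hδ0 (min_le_left _ _) hδ1
    have := O.not_lowering_bottom T hF hw htτ hτb hst hy0.le hδ0.le hδ1 (hb' δ hδ0.le hδ1)
      (ha' δ hδ0.le hδ1) h1
    have := mul_pos hη hδ0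
    linarith
  · set m := tailMass b F t with hmdef
    set W := tailWeight b F w t with hWdef
    have hmc := continuous_tailMass (F := F) b
    -- Handing out a gain of at most `K δ` through the types of `(u₀, t)` costs at most `W K δ / m`
    -- times their mass, which is less than `η δ` once `u₀` is close to `t`.
    obtain ⟨u₀, hu₀, hsmall⟩ : ∃ u₀ ∈ Ioo a t, W * K * (tailMass b F u₀ - m) < η * m := by
      have h1 : Continuous fun u => W * K * (tailMass b F u - m) := by fun_prop
      have h2 : (fun u => W * K * (tailMass b F u - m)) t < η * m := by
        simp only [← hmdef, sub_self, mul_zero]; positivity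
      obtain ⟨ε, hε, hball⟩ := Metric.isOpen_iff.1 (isOpen_lt h1 continuous_const) t h2
      obtain ⟨u, hu⟩ := exists_between (max_lt hat (show t - ε < t by linarith))
      obtain ⟨h3, h4⟩ := max_lt_iff.1 hu.1
      refine ⟨u, ⟨h3, hu.2⟩, hball ?_⟩
      rw [Metric.mem_ball, Real.dist_eq, abs_of_neg (by linarith [hu.2])]
      linarith
    have hB := T.raiseRent_pos hu₀.1.le hu₀.2 ht.2.le
    have hmu : 0 < tailMass b F u₀ := hF.tailMass_pos ⟨hu₀.1.le, hu₀.2.trans ht.2⟩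
    have hBm := mul_pos hB hmu
    set δ := min (min δ₀ 1) (raiseRent h f t u₀ * tailMass b F u₀ / (K + 1)) with hδ
    have hδ0 : 0 < δ := lt_min (lt_min hδ₀ one_pos) (by positivity)
    have hδ1 : δ ≤ 1 := (min_le_left _ _).trans (min_le_right _ _)
    obtain ⟨h1, h2, h3⟩ := hlow δ hδ0 ((min_le_left _ _).trans (min_le_left _ _)) hδ1
    set G := budgetGain b c h F q (lowered q δ y e) t with hG
    have hδB : δ * (K + 1) ≤ raiseRent h f t u₀ * tailMass b F u₀ := by
      rw [← le_div_iff₀ (by positivity)]; exact min_le_right _ _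
    have hcont : Continuous fun u => raiseRent h f t u * tailMass b F u :=
      (raiseRent_continuous T.toTechnology t).mul hmc
    -- The raise absorbs nothing at `u = t` and, since `δ` is small, at least the gain at `u₀`; some
    -- `u` in between absorbs it exactly.
    obtain ⟨u, hu, huG⟩ : G ∈ (fun u => raiseRent h f t u * tailMass b F u) '' Icc u₀ t := by
      refine intermediate_value_Icc' hu₀.2.le hcont.continuousOn ⟨?_, ?_⟩
      · simpa [raiseRent] using h1
      · nlinarith
    simp only at huG
    have hfin := O.not_lowering_raise T hF hw ⟨hu₀.1.trans_le hu.1, hu.2⟩ ht.2 htτ hτb hfb hex hst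
      hy hδ0.le hδ1 (hb' δ hδ0.le hδ1) (ha' δ hδ0.le hδ1) huG
    have anti : ∀ r s, r ≤ s → tailMass b F s ≤ tailMass b F r := by
      intro r s hrs
      have h5 := tailMass_sub (b := b) (F := F) r s
      have h6 : 0 ≤ ∫ _ in r..s, (1 : ℝ) ∂F := integral_nonneg_Ioo hrs fun _ _ => zero_le_one
      linarith
    have hmu' := anti u t hu.2
    have hmu'' := anti u₀ u hu.1
    have hBu : 0 ≤ raiseRent h f t u := intervalIntegral.integral_nonneg hu.2 fun z hz =>
      sub_nonneg.2 (T.h_mono z _ _ (T.f_pos z).le (T.f_mono hz.2))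
    set B := raiseRent h f t u
    have k1 : B * m ≤ K * δ := by
      have := mul_le_mul_of_nonneg_left hmu' hBu
      linarith
    have k2 : B * (tailMass b F u - m) ≤ B * (tailMass b F u₀ - m) :=
      mul_le_mul_of_nonneg_left (by linarith) hBu
    have k3 : η * δ ≤ W * (B * (tailMass b F u₀ - m)) :=
      (h3.trans hfin).trans (mul_le_mul_of_nonneg_left k2 hW.le)
    have hω : 0 ≤ tailMass b F u₀ - m := by linarith
    have k4 : η * δ * m ≤ W * (K * δ) * (tailMass b F u₀ - m) := by
      have h5 := mul_le_mul_of_nonneg_right k3 hm.le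
      have h6 := mul_le_mul_of_nonneg_left k1 (mul_nonneg hW.le hω)
      linarith
    have k5 := mul_lt_mul_of_pos_right hsmall hδ0
    linarith

/-- In an optimal plan, quality cannot exceed the first best where lowering it redistributes rents
towards higher weights. -/
lemma OptimalPlan.not_improvable (O : OptimalPlan a b c h F w q U)
    (T : StrictTechnology a b c h f) (hF : FullLaw a b F) (hw : Hump a b F w p) {d : ℝ}
    (ht : t ∈ Ico a b) (htτ : t ≤ τ) (hτb : τ ≤ b)
    (hfb : ∀ θ ∈ Ioo a t, q θ = f θ) (hex : ∀ θ ∈ Ioo a t, excess c q U θ = 0)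
    (hst : t = τ ∨ (f t ≤ x ∧ surplus c (f t) t ≤ U t))
    (hbelow : ∀ z ∈ Ioo t τ, min (f z) x ≤ q z ∧ q z ≤ x)
    (habove : ∀ z ∈ Ioo τ b, x ≤ q z ∧ q z ≤ max (f z) x)
    (htd : t ≤ d) (hde : d < e) (heb : e ≤ b) (hy : f t ≤ y) (hd : ∀ u ∈ Ioo d e, y < q u)
    (hover : ∀ u ∈ Ioo t b, u ≤ e → y < q u → f u ≤ q u ∧ tailGap b F w t u < 0)
    (hyb : ∀ z ∈ Ioo t τ, z ≤ e → y < q z → min (f z) x ≤ y)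
    (hya : ∀ z ∈ Ioo τ b, z ≤ e → y < q z → x ≤ y) : False :=
  O.not_lowerable T hF hw ht htτ hτb hfb hex hst hbelow habove hy hyb hya
    (T.lowering hF hw O.mono O.nonneg ht htd hde heb ((T.f_pos t).trans_le hy) hd hover)

/-- Lowering qualities that are bounded away from the first best, on a short interval above `t`, has
first-order benefits. -/
lemma Technology.lowering_jump (T : Technology a b c h f) (hF : FullLaw a b F)
    (hw : Hump a b F w p) (hq : Monotone q) (hq0 : ∀ u, 0 ≤ q u) {c₀ K : ℝ} (ht : a ≤ t)
    (hte : t < e) (heb : e ≤ b) (hy : 0 ≤ y) (hc₀ : 0 < c₀)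
    (hgap : ∀ u ∈ Ioo t e, y < q u ∧ c₀ ≤ surplus c y u - surplus c (q u) u) (hK0 : 0 ≤ K)
    (hK : ∀ u x z, 0 ≤ x → x ≤ z → z ≤ q b → h z u - h x u ≤ K * (z - x))
    (hsmall : K * q b * (e - t) ≤ c₀ / 2) :
    ∃ η K δ₀, 0 < η ∧ 0 ≤ K ∧ 0 < δ₀ ∧ ∀ δ, 0 < δ → δ ≤ δ₀ → δ ≤ 1 →
      0 ≤ budgetGain b c h F q (lowered q δ y e) t ∧
      budgetGain b c h F q (lowered q δ y e) t ≤ K * δ ∧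
      η * δ ≤ welfareGain b c h F w q (lowered q δ y e) t := by
  have htI : t ∈ Ico a b := ⟨ht, hte.trans_le heb⟩
  have hm := hF.tailMass_pos htI
  have hW := hw.tailWeight_pos hF htI
  set m := tailMass b F t with hmdef
  set W := tailWeight b F w t with hWdef
  set M := q b with hM
  have hM0 : 0 ≤ M := hq0 b
  obtain ⟨Kc, hKc0, hKc⟩ := T.c_lip M
  have hmc := continuous_tailMass (F := F) b
  have hgapc : Continuous (tailGap b F w t) := by
    have h2 := hw.continuous_tailWeight b
    unfold tailGap; fun_prop
  set ω := ∫ _ in t..e, (1 : ℝ) ∂F with hω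
  have hω0 : 0 < ω := hF.integral_pos ht hte heb intervalIntegrable_const fun _ _ => one_pos
  have hconst : ∀ r : ℝ, ∫ _ in t..e, r ∂F = r * ω := fun r => by
    rw [hω, ← intervalIntegral.integral_const_mul]; simp
  have anti : ∀ r s, r ≤ s → tailMass b F s ≤ tailMass b F r := by
    intro r s hrs
    have h5 := tailMass_sub (b := b) (F := F) r s
    have h6 : 0 ≤ ∫ _ in r..s, (1 : ℝ) ∂F := integral_nonneg_Ioo hrs fun _ _ => zero_le_one
    linarith
  have hmω : m - tailMass b F e = ω := tailMass_sub t e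
  -- By convexity of the cost, surplus rises by at least `δ c₀` per head on a mass `ω`. The tail gap
  -- is at most `W ω`, whatever its sign, so changed rents cost at most `K M δ (e - t) W ω`, which
  -- `hsmall` bounds by half of the surplus term.
  refine ⟨W * ω * c₀ / 2, Kc * M * ω + K * M * m * (e - t), 1, by positivity, ?_, one_pos,
    fun δ hδ _ hδ1 => ?_⟩
  · have : 0 ≤ e - t := by linarith
    positivity
  set l := lowered q δ y e with hl
  have hlm : Monotone l := lowered_mono hq hδ.le hδ1
  have hl0 : ∀ u, 0 ≤ l u := lowered_nonneg hq0 hy hδ1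
  have is : ∀ u v, IntervalIntegrable (fun θ => surplus c (l θ) θ - surplus c (q θ) θ) F u v :=
    fun u v => (T.surplus_integrable hlm F _ _).sub (T.surplus_integrable hq F _ _)
  have ih : ∀ u v, IntervalIntegrable (fun u => h (l u) u - h (q u) u) volume u v := fun u v =>
    (T.rent_integrable hlm _ _).sub (T.rent_integrable hq _ _)
  have hlow : ∀ u ∈ Ioo t e, l u = (1 - δ) * q u + δ * y := by
    intro u hu
    have h1 := overshoot_eq (overshoot_pos_iff.2 ⟨hu.2.le, (hgap u hu).1⟩)
    rw [hl, lowered, h1]; ring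
  have hhigh : ∀ u ∈ Ioo e b, l u = q u := fun u hu => lowered_eq fun h1 => not_lt.2 h1.1 hu.1
  have hqM : ∀ u ∈ Ioo t e, q u ≤ M := fun u hu => hq (hu.2.le.trans heb)
  have hdrop : ∀ u ∈ Ioo t e, 0 ≤ q u - l u ∧ q u - l u ≤ δ * M := by
    intro u hu
    have h1 := (hgap u hu).1
    have h2 := hqM u hu
    rw [hlow u hu]
    constructor
    · nlinarith
    · nlinarith
  have hs : ∀ u ∈ Ioo t e, δ * c₀ ≤ surplus c (l u) u - surplus c (q u) u ∧
      surplus c (l u) u - surplus c (q u) u ≤ Kc * M * δ := by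
    intro u hu
    obtain ⟨h1, h2⟩ := hgap u hu
    obtain ⟨h3, h4⟩ := hdrop u hu
    constructor
    · have h5 := T.c_convex u (q u) y δ (hq0 u) hy hδ.le hδ1
      rw [← hlow u hu] at h5
      have h6 := mul_le_mul_of_nonneg_left h2 hδ.le
      have h7 := hlow u hu
      unfold surplus at h6 ⊢
      linarith
    · have h5 := hKc u _ _ (hl0 u) (by linarith) (hqM u hu)
      have h6 := mul_le_mul_of_nonneg_left h4 hKc0
      unfold surplus
      linarith
  have hr : ∀ u ∈ Ioo t e, - (K * M * δ) ≤ h (l u) u - h (q u) u ∧ h (l u) u - h (q u) u ≤ 0 := by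
    intro u hu
    obtain ⟨h3, h4⟩ := hdrop u hu
    have h5 := hK u _ _ (hl0 u) (by linarith) (hqM u hu)
    have h6 := mul_le_mul_of_nonneg_left h4 hK0
    have h7 := T.h_mono u _ _ (hl0 u) (show l u ≤ q u by linarith)
    constructor <;> linarith
  have hσ : surplusGain b c F q l t = ∫ θ in t..e, (surplus c (l θ) θ - surplus c (q θ) θ) ∂F := by
    rw [surplusGain, ← intervalIntegral.integral_add_adjacent_intervals (is t e) (is e b),
      integral_congr_Ioo (k := fun _ => 0) heb fun u hu => by rw [hhigh u hu, sub_self]]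
    simp
  have hρ : ∀ g : ℝ → ℝ, Continuous g → ∫ u in t..b, (h (l u) u - h (q u) u) * g u =
      ∫ u in t..e, (h (l u) u - h (q u) u) * g u := by
    intro g hg
    rw [← intervalIntegral.integral_add_adjacent_intervals
      ((ih t e).mul_continuousOn hg.continuousOn) ((ih e b).mul_continuousOn hg.continuousOn),
      integral_congr_Ioo (k := fun _ => 0) heb fun u hu => by rw [hhigh u hu, sub_self, zero_mul]]
    simp
  have hσ1 : δ * c₀ * ω ≤ surplusGain b c F q l t := by
    rw [hσ, ← hconst]
    exact integral_mono_Ioo hte.le intervalIntegrable_const (is t e) fun u hu => (hs u hu).1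
  have hσ2 : surplusGain b c F q l t ≤ Kc * M * δ * ω := by
    rw [hσ, ← hconst]
    exact integral_mono_Ioo hte.le (is t e) intervalIntegrable_const fun u hu => (hs u hu).2
  have hmu : ∀ u ∈ Ioo t e, 0 ≤ tailMass b F u ∧ tailMass b F u ≤ m := fun u hu =>
    ⟨(hF.tailMass_pos ⟨ht.trans hu.1.le, hu.2.trans_le heb⟩).le, anti t u hu.1.le⟩
  have hk : 0 ≤ K * M * δ := by positivity
  have hvol : ∀ r : ℝ, ∫ _ in t..e, r = r * (e - t) := fun r => by
    rw [intervalIntegral.integral_const, smul_eq_mul, mul_comm]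
  have hρ1 : ∫ u in t..b, (h (l u) u - h (q u) u) * tailMass b F u ≤ 0 := by
    rw [hρ _ hmc]
    have := integral_mono_Ioo (F := volume) (k := fun _ => 0) hte.le
      ((ih t e).mul_continuousOn hmc.continuousOn) intervalIntegrable_const fun u hu =>
      mul_nonpos_of_nonpos_of_nonneg (hr u hu).2 (hmu u hu).1
    simpa using this
  have hρ2 : - (K * M * δ) * m * (e - t) ≤
      ∫ u in t..b, (h (l u) u - h (q u) u) * tailMass b F u := by
    rw [hρ _ hmc, ← hvol]
    refine integral_mono_Ioo hte.le intervalIntegrable_const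
      ((ih t e).mul_continuousOn hmc.continuousOn) fun u hu => ?_
    have h1 := mul_le_mul_of_nonneg_right (hr u hu).1 (hmu u hu).1
    have h2 := mul_le_mul_of_nonneg_left (hmu u hu).2 hk
    linarith
  have hρ3 : - (K * M * δ) * (W * ω) * (e - t) ≤
      ∫ u in t..b, (h (l u) u - h (q u) u) * tailGap b F w t u := by
    rw [hρ _ hgapc, ← hvol]
    refine integral_mono_Ioo hte.le intervalIntegrable_const
      ((ih t e).mul_continuousOn hgapc.continuousOn) fun u hu => ?_
    obtain ⟨h1, h2⟩ := hr u hu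
    have h3 : tailGap b F w t u ≤ W * ω := by
      have h4 : tailWeight b F w u ≤ W := by
        have h5 := hw.tailWeight_sub (b := b) t u
        have h6 : 0 ≤ ∫ z in t..u, w z ∂F := integral_nonneg_Ioo hu.1.le fun z hz =>
          hw.nonneg z ⟨ht.trans hz.1.le, (hz.2.trans hu.2).le.trans heb⟩
        linarith
      have h5 := mul_le_mul_of_nonneg_left h4 hm.le
      have h6 := mul_le_mul_of_nonneg_right (anti u e hu.2.le) hW.le
      rw [← hmω]
      unfold tailGap
      linarith
    rcases le_total 0 (tailGap b F w t u) with h4 | h4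
    · have h5 := mul_le_mul_of_nonneg_right h1 h4
      have h6 := mul_le_mul_of_nonneg_left h3 hk
      linarith
    · have h5 := mul_nonneg_of_nonpos_of_nonpos h2 h4
      have h6 : 0 ≤ K * M * δ * (W * ω) := by positivity
      linarith
  unfold budgetGain welfareGain
  have hδcω : 0 ≤ δ * c₀ * ω := by positivity
  refine ⟨by linarith, by linarith, ?_⟩
  have h1 := mul_le_mul_of_nonneg_left hσ1 hW.le
  have h2 := mul_le_mul_of_nonneg_left hsmall (show 0 ≤ W * ω * δ by positivity)
  linarith

/-- Where quality exceeds the first best or a constant upper bound of quality, the excess of the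
price over quality is increasing. -/
lemma Schedule.excess_mono (S : Schedule h q U) (T : Technology a b c h f) {u v : ℝ}
    (hu : u ∈ Icc a b) (hv : v ∈ Icc a b) (huv : u ≤ v)
    (hx : ∀ z ∈ Icc u v, min (f z) x ≤ q z ∧ q z ≤ x) : excess c q U u ≤ excess c q U v := by
  have hle : q u ≤ q v := S.mono huv
  -- The benchmark of `gap_antitone` with the inequalities reversed: its rents are now below those
  -- of `q`, it starts at `q u`, and it ends with at least the surplus of `q v`.
  have hV := T.clamp_envelope (S.nonneg u) hle hu hv huv
  have hvx := (hx v ⟨huv, le_rfl⟩).2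
  have hR : ∫ z in u..v, h (max (q u) (min (f z) (q v))) z ≤ ∫ z in u..v, h (q z) z := by
    refine intervalIntegral.integral_mono_on huv (T.rent_integrable (T.clamp_mono _ _) _ _)
      (T.rent_integrable S.mono _ _) fun z hz => T.h_mono _ _ _ (le_max_of_le_left (S.nonneg u)) ?_
    exact max_le (S.mono hz.1) ((min_le_min le_rfl hvx).trans (hx z hz).1)
  have hu' : max (q u) (min (f u) (q v)) = q u := by
    refine max_eq_left ?_
    rcases le_total (f u) (q u) with h1 | h1
    · exact (min_le_left _ _).trans h1
    · rcases min_le_iff.1 (hx u ⟨le_rfl, huv⟩).1 with h2 | h2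
      · exact (min_le_left _ _).trans h2
      · exact (min_le_right _ _).trans (hvx.trans h2)
  have h1 := T.surplus_le_clamp (u := v) (S.nonneg u) hle le_rfl
  have h2 := S.env u v
  rw [hu'] at hV
  simp only [excess]
  linarith

end Perturbation
end RatingDesign

/-! ### Slack majorization and the type where pooling begins -/

namespace RatingDesign
open Filter Topology
noncomputable section Strict
set_option linter.unusedSectionVars false

variable {a b : ℝ} {c h : ℝ → ℝ → ℝ} {f q U w : ℝ → ℝ} {p s t τ σ x : ℝ} {F : Measure ℝ}
  [IsProbabilityMeasure F] [NullSingletonClass F]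

lemma continuous_tailGap (hw : Hump a b F w p) (t : ℝ) : Continuous (tailGap b F w t) := by
  have h1 := continuous_tailMass (F := F) b
  have h2 := hw.continuous_tailWeight b
  unfold tailGap; fun_prop

/-- Above the peak, average weights of upper tails decrease. -/
lemma Hump.tailGap_peak_neg (hw : Hump a b F w p) (hF : FullLaw a b F) {u : ℝ}
    (hu : u ∈ Ioo p b) : tailGap b F w p u < 0 := by
  have hp := hw.peak_mem
  have hm : 0 < tailMass b F p := hF.tailMass_pos ⟨hp.1.le, hp.2⟩
  have i := hw.gap_integrable (tailMass b F p) (tailWeight b F w p)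
  have hI : ∀ z ∈ Icc p b, z ∈ Icc p b := fun z hz => hz
  -- Either all weights on `(p, u)` are above average, so the gap falls from zero at `p`, or all
  -- weights on `(u, b)` are below average.
  rcases le_or_gt (tailWeight b F w p) (tailMass b F p * w u) with h1 | h1
  · have h2 : 0 < ∫ z in p..u, (tailMass b F p * w z - tailWeight b F w p) ∂F := by
      refine hF.integral_pos hp.1.le hu.1 hu.2.le (i _ _) fun z hz => ?_
      have := mul_lt_mul_of_pos_left (hw.decreasing ⟨hz.1.le, (hz.2.trans hu.2).le⟩
        ⟨hu.1.le, hu.2.le⟩ hz.2) hm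
      linarith
    rw [← hw.tailGap_sub, tailGap_self] at h2
    linarith
  · have h2 : 0 < ∫ z in u..b, -(tailMass b F p * w z - tailWeight b F w p) ∂F := by
      refine hF.integral_pos (hp.1.le.trans hu.1.le) hu.2 le_rfl (i _ _).neg fun z hz => ?_
      have := mul_lt_mul_of_pos_left (hw.decreasing ⟨hu.1.le, hu.2.le⟩
        ⟨hu.1.le.trans hz.1.le, hz.2.le⟩ hz.1) hm
      linarith
    rw [intervalIntegral.integral_neg, ← hw.tailGap_sub, tailGap_end] at h2
    linarith

lemma primitive_nonpos {D : ℝ → ℝ} {r u : ℝ} (hu : u ∈ Icc a b)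
    (hD : ∀ θ ∈ Ioo a b, θ ≠ r → D θ ≤ 0) : ∫ θ in a..u, D θ ∂F ≤ 0 := by
  rw [intervalIntegral.integral_of_le hu.1]
  have hne : ∀ᵐ z ∂F, z ≠ r := by simp [ae_iff]
  refine integral_nonpos_of_ae ?_
  filter_upwards [ae_restrict_mem_Ioo (F := F) a u, ae_restrict_of_ae hne] with z hz hzr
  exact hD z ⟨hz.1, hz.2.trans_le hu.2⟩ hzr

lemma Schedule.profit_mono (S : Schedule h q U) (T : Technology a b c h f) : Monotone U := by
  intro u v huv
  have h1 := S.env u v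
  have h2 : 0 ≤ ∫ z in u..v, h (q z) z :=
    intervalIntegral.integral_nonneg huv fun z _ => T.h_nonneg z _ (S.nonneg z)
  linarith

/-- Below `t` profits equal first-best surplus. Profits are monotone, so the bound passes to `t`
from the left even if `q` jumps there. -/
lemma Schedule.firstBest_le_profit (S : Schedule h q U) (T : Technology a b c h f) (hat : a < t)
    (hfb : ∀ θ ∈ Ioo a t, q θ = f θ) (hex : ∀ θ ∈ Ioo a t, excess c q U θ = 0) :
    surplus c (f t) t ≤ U t := by
  refine ge_of_dense (S.profit_mono T) (g := fun t => surplus c (f t) t)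
    (T.surplus_cont.comp (T.f_cont.prodMk continuous_id)) (u := a) (v := t)
    (fun u' v' h1 h2 h3 => ?_) ⟨hat, le_rfl⟩
  obtain ⟨z, hz⟩ := exists_between h2
  have hz' : z ∈ Ioo a t := ⟨h1.trans_lt hz.1, hz.2.trans_le h3⟩
  have := hex z hz'
  rw [excess, hfb z hz'] at this
  exact ⟨z, hz, by linarith⟩

/-- Under strict submodularity, majorization is slack somewhere in an optimal plan. -/
lemma OptimalPlan.exists_slack (O : OptimalPlan a b c h F w q U)
    (T : StrictTechnology a b c h f) (hF : FullLaw a b F) (hw : Hump a b F w p)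
    (P : Pattern a b c f q U t τ x) : ∃ u ∈ Icc a b, 0 < ∫ θ in a..u, excess c q U θ ∂F := by
  -- Without slack the excess vanishes except perhaps at `t` and `τ`, so profits are the surplus of
  -- `q`. The first best priced at quality is feasible, hence `q` is first best. But then lowering
  -- qualities on an interval `(d, e)` above the peak towards `f d` shifts rents to higher weights,
  -- which `not_improvable` excludes.
  by_contra! hcon
  have hab := T.lt
  have T' := T.toTechnology
  have iD := O.excess_integrable (F := F) T'
  have hS : ∀ u ∈ Icc a b, ∫ θ in a..u, excess c q U θ ∂F = 0 := fun u hu =>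
    le_antisymm (hcon u hu) (O.slack u hu)
  have hS' : ∀ u ∈ Icc a b, ∀ v ∈ Icc a b, ∫ θ in u..v, excess c q U θ ∂F = 0 := by
    intro u hu v hv
    have := intervalIntegral.integral_add_adjacent_intervals (iD a u) (iD u v)
    rw [hS u hu, hS v hv] at this
    linarith
  have haτ := P.le_left.trans P.left_le
  have htb := P.left_le.trans P.le_right
  have z1 : ∀ z ∈ Ioo t τ, excess c q U z = 0 := by
    intro z hz
    have h0 : ∀ z ∈ Ioo t τ, 0 ≤ excess c q U z := fun z hz =>
      P.excess_nonneg O.toSchedule T' ⟨P.le_left.trans_lt hz.1, hz.2⟩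
    obtain ⟨y, hy, hy0⟩ := hF.exists_eq_zero P.le_left P.le_right hz.1.le hz.2 le_rfl (iD t τ) h0
      (hS' t ⟨P.le_left, htb⟩ τ ⟨haτ, P.le_right⟩).le
    refine le_antisymm ?_ (h0 z hz)
    rw [← hy0]
    exact O.excess_mono T' ⟨P.le_left.trans hz.1.le, hz.2.le.trans P.le_right⟩
      ⟨(P.le_left.trans hz.1.le).trans hy.1.le, hy.2.le.trans P.le_right⟩ hy.1.le
      fun y' hy' => P.below y' ⟨hz.1.trans_le hy'.1, hy'.2.trans_lt hy.2⟩
  have z2 : ∀ z ∈ Ioo τ b, excess c q U z = 0 := by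
    intro z hz
    have hzI : z ∈ Icc a b := ⟨haτ.trans hz.1.le, hz.2.le⟩
    rcases lt_trichotomy (excess c q U z) 0 with h1 | h1 | h1
    · have h2 := hF.integral_pos hzI.1 hz.2 le_rfl (iD z b).neg fun y hy => by
        have := P.excess_antitone O.toSchedule T' hz ⟨hz.1.trans hy.1, hy.2⟩ hy.1.le
        simp only [Pi.neg_apply]; linarith
      simp only [Pi.neg_apply, intervalIntegral.integral_neg] at h2
      rw [hS' z hzI b ⟨hab.le, le_rfl⟩] at h2
      linarith
    · exact h1
    · have h2 := hF.integral_pos haτ hz.1 hz.2.le (iD τ z) fun y hy => by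
        have := P.excess_antitone O.toSchedule T' ⟨hy.1, hy.2.trans hz.2⟩ hz hy.2.le
        linarith
      rw [hS' τ ⟨haτ, P.le_right⟩ z hzI] at h2
      linarith
  have hne : ∀ θ ∈ Ioo a b, θ ≠ t → θ ≠ τ → U θ = surplus c (q θ) θ := by
    intro θ hθ h1 h2
    have : excess c q U θ = 0 := by
      rcases lt_or_gt_of_ne h1 with h3 | h3
      · exact P.excess_eq θ ⟨hθ.1, h3⟩
      · rcases lt_or_gt_of_ne h2 with h4 | h4
        · exact z1 θ ⟨h3, h4⟩
        · exact z2 θ ⟨h4, hθ.2⟩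
    rw [excess] at this; linarith
  set V : ℝ → ℝ := fun θ => surplus c (f a) a + ∫ z in a..θ, h (f z) z with hV
  have SV : Schedule h f V := Schedule.of_rent T' T.f_mono (fun u => (T.f_pos u).le) _ _
  have hVeq : ∀ θ ∈ Icc a b, V θ = surplus c (f θ) θ := by
    intro θ hθ
    have := T'.firstBest_envelope ⟨le_rfl, hab.le⟩ hθ hθ.1
    simp only [hV]; linarith
  have hV0 : ∀ u ∈ Icc a b, ∫ θ in a..u, excess c f V θ ∂F = 0 := by
    intro u hu
    rw [integral_congr_Ioo (k := fun _ => 0) hu.1]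
    · simp
    · intro z hz
      rw [excess, hVeq z ⟨hz.1.le, hz.2.le.trans hu.2⟩]; ring
  have PV : Plan a b c h F f V :=
    ⟨SV, by rw [hVeq a ⟨le_rfl, hab.le⟩]; exact T'.surplus_firstBest_nonneg a,
      fun u hu => (hV0 u hu).ge, hV0 b ⟨hab.le, le_rfl⟩⟩
  have hopt := O.optimal _ _ PV
  have iw := hw.intervalIntegrable (F := F) a b
  have e1 : ∫ θ in a..b, w θ * V θ ∂F = ∫ θ in a..b, w θ * surplus c (f θ) θ ∂F :=
    integral_congr_Ioo hab.le fun z hz => by rw [hVeq z ⟨hz.1.le, hz.2.le⟩]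
  have e2 : ∫ θ in a..b, w θ * U θ ∂F = ∫ θ in a..b, w θ * surplus c (q θ) θ ∂F := by
    rw [intervalIntegral.integral_of_le hab.le, intervalIntegral.integral_of_le hab.le]
    have hn1 : ∀ᵐ z ∂F, z ≠ t := by simp [ae_iff]
    have hn2 : ∀ᵐ z ∂F, z ≠ τ := by simp [ae_iff]
    refine integral_congr_ae ?_
    filter_upwards [ae_restrict_mem_Ioo (F := F) a b, ae_restrict_of_ae hn1,
      ae_restrict_of_ae hn2] with z hz h1 h2
    rw [hne z hz h1 h2]
  have hfb : ∀ θ ∈ Ioo a b, q θ = f θ := by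
    refine first_best_of_integral T' hF O.mono O.nonneg ⟨hab.le, le_rfl⟩ iw
      (fun θ hθ => hw.pos hθ) ?_
    have j1 := intervalIntegrable_mul_comp T'.surplus_cont T.f_mono hab.le iw
    have j2 := intervalIntegrable_mul_comp T'.surplus_cont O.mono hab.le iw
    have : ∫ θ in a..b, w θ * (surplus c (f θ) θ - surplus c (q θ) θ) ∂F =
        ∫ θ in a..b, (w θ * surplus c (f θ) θ - w θ * surplus c (q θ) θ) ∂F :=
      intervalIntegral.integral_congr fun z _ => by ring
    rw [this, intervalIntegral.integral_sub j1 j2]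
    linarith
  have hp := hw.peak_mem
  have hex : ∀ θ ∈ Ioo a p, excess c q U θ = 0 := by
    intro θ hθ
    obtain ⟨z, hz, hz'⟩ : ∃ z ∈ Ioo a b, U z = surplus c (q z) z := by
      obtain ⟨z, hz⟩ := ((Ioo_infinite hab).sdiff (toFinite {t, τ})).nonempty
      refine ⟨z, hz.1, hne z hz.1 (fun h1 => hz.2 (Or.inl h1)) fun h1 => hz.2 (Or.inr h1)⟩
    rw [O.excess_const T' hfb le_rfl ⟨hθ.1, hθ.2.trans hp.2⟩ hz, excess, hz', sub_self]
  obtain ⟨d, hd⟩ := exists_between hp.2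
  obtain ⟨e, he⟩ := exists_between hd.2
  have had := hp.1.trans hd.1
  refine O.not_improvable T hF hw (t := p) (τ := p) (x := f p) (d := d) (e := e) (y := f d)
    ⟨hp.1.le, hp.2⟩ le_rfl hp.2.le (fun θ hθ => hfb θ ⟨hθ.1, hθ.2.trans hp.2⟩) hex (Or.inl rfl)
    (fun z hz => absurd (hz.1.trans hz.2) (lt_irrefl _)) ?_ hd.1.le he.1 he.2.le
    (T.f_mono hd.1.le) ?_ ?_ (fun z hz => absurd (hz.1.trans hz.2) (lt_irrefl _)) ?_
  · intro z hz
    rw [hfb z ⟨hp.1.trans hz.1, hz.2⟩]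
    exact ⟨T.f_mono hz.1.le, le_max_left _ _⟩
  · intro u hu
    rw [hfb u ⟨had.trans hu.1, hu.2.trans he.2⟩]
    exact T.f_strict ⟨had.le, hd.2.le⟩ ⟨(had.trans hu.1).le, (hu.2.trans he.2).le⟩ hu.1
  · intro u hu _ _
    exact ⟨(hfb u ⟨hp.1.trans hu.1, hu.2⟩).ge, hw.tailGap_peak_neg hF hu⟩
  · intro z _ _ _
    exact T.f_mono hd.1.le

/-- The type `s` at which the pooling region of an optimal plan begins. -/
structure Pattern.IsSplit (a : ℝ) (c : ℝ → ℝ → ℝ) (f q U : ℝ → ℝ) (t τ x s : ℝ) : Prop where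
  left_le : t ≤ s
  le_right : s ≤ τ
  first_best : ∀ θ ∈ Ioo a s, q θ = f θ
  excess_eq : ∀ θ ∈ Ioo a s, excess c q U θ = 0
  excess_pos : ∀ θ ∈ Ioo s τ, 0 < excess c q U θ
  le_level : ∀ θ ∈ Ioo t s, f θ ≤ x

/-- `s` is the end of the stretch of zero excess that starts at `t`. The excess is nondecreasing on
`(t, τ)`, hence positive from `s` to `τ`. On `(t, s)` profits equal the surplus of `q` but are at
least first best, because they start there and their rents are no smaller; this forces quality to be
first best. -/
lemma Pattern.exists_split (P : Pattern a b c f q U t τ x) (S : Schedule h q U)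
    (T : Technology a b c h f) (hS : ∃ u ∈ Icc a b, 0 < ∫ θ in a..u, excess c q U θ ∂F) :
    ∃ s, Pattern.IsSplit a c f q U t τ x s := by
  have htb := P.left_le.trans P.le_right
  set A : Set ℝ := {θ | θ ∈ Icc t τ ∧ ∀ z ∈ Ioo t θ, excess c q U z = 0} with hA
  have htA : t ∈ A := ⟨⟨le_rfl, P.left_le⟩, fun z hz => absurd (hz.1.trans hz.2) (lt_irrefl _)⟩
  have hbd : BddAbove A := ⟨τ, fun z hz => hz.1.2⟩
  set s := sSup A with hs
  have hts : t ≤ s := le_csSup hbd htA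
  have hsτ : s ≤ τ := csSup_le ⟨t, htA⟩ fun z hz => hz.1.2
  have hz0 : ∀ z ∈ Ioo t s, excess c q U z = 0 := by
    intro z hz
    obtain ⟨y, hy, hzy⟩ := exists_lt_of_lt_csSup ⟨t, htA⟩ hz.2
    exact hy.2 z ⟨hz.1, hzy⟩
  have hpos : ∀ z ∈ Ioo s τ, 0 < excess c q U z := by
    intro z hz
    have htz := hts.trans_lt hz.1
    have h0 := P.excess_nonneg S T (θ := z) ⟨P.le_left.trans_lt htz, hz.2⟩
    rcases h0.eq_or_lt with h1 | h1
    · exfalso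
      have : z ∈ A := by
        refine ⟨⟨htz.le, hz.2.le⟩, fun y hy => ?_⟩
        have hya := P.le_left.trans_lt hy.1
        refine le_antisymm ?_ (P.excess_nonneg S T ⟨hya, hy.2.trans hz.2⟩)
        rw [h1]
        exact S.excess_mono T ⟨hya.le, (hy.2.trans hz.2).le.trans P.le_right⟩
          ⟨(hya.trans hy.2).le, hz.2.le.trans P.le_right⟩ hy.2.le
          fun y' hy' => P.below y' ⟨hy.1.trans_le hy'.1, hy'.2.trans_lt hz.2⟩
      exact absurd (le_csSup hbd this) (not_le.2 hz.1)
    · exact h1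
  -- If the first best passed `x` before `s`, quality would be stuck at `x` up to `τ` and below `max
  -- f x` afterwards. The excess would then be nonpositive at all interior types except perhaps `t`,
  -- against the assumed slack.
  have hlev : ∀ z ∈ Ioo t s, f z ≤ x := by
    intro z hz
    by_contra! hfx
    have haz := P.le_left.trans_lt hz.1
    have hzτ := hz.2.trans_le hsτ
    have hge : ∀ y, z ≤ y → y < τ → q y = x := by
      intro y h1 h2
      have h3 := P.below y ⟨hz.1.trans_le h1, h2⟩
      rw [min_eq_right (hfx.le.trans (T.f_mono h1))] at h3
      exact le_antisymm h3.2 h3.1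
    have hup : ∀ y ∈ Ico z b, q y ≤ max (f y) x := by
      intro y hy
      refine le_of_dense S.mono (g := fun z => max (f z) x) (T.f_cont.max continuous_const)
        (u := z) (v := b) (fun u' v' h1 h2 h3 => ?_) hy
      obtain ⟨y', hy', hyτ⟩ := ((Ioo_infinite h2).sdiff (finite_singleton τ)).nonempty
      rcases lt_or_gt_of_ne hyτ with h4 | h4
      · exact ⟨y', hy', (hge y' (h1.trans hy'.1.le) h4).le.trans (le_max_right _ _)⟩
      · exact ⟨y', hy', (P.above y' ⟨h4, hy'.2.trans_le h3⟩).2⟩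
    have hD : ∀ v ∈ Ioo z b, excess c q U v ≤ 0 := by
      intro v hv
      rw [← hz0 z hz]
      refine S.excess_le T (x := x) ⟨haz.le, hzτ.le.trans P.le_right⟩ ⟨(haz.trans hv.1).le, hv.2.le⟩
        hv.1.le fun y hy => ⟨?_, hup y ⟨hy.1, hy.2.trans_lt hv.2⟩⟩
      rw [← hge z le_rfl hzτ]
      exact S.mono hy.1
    obtain ⟨u, hu, hu0⟩ := hS
    refine absurd hu0 (not_lt.2 (primitive_nonpos (r := t) hu fun θ hθ hne => ?_))
    rcases lt_or_gt_of_ne hne with h1 | h1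
    · exact (P.excess_eq θ ⟨hθ.1, h1⟩).le
    · rcases le_or_gt θ z with h2 | h2
      · exact (hz0 θ ⟨h1, h2.trans_lt hz.2⟩).le
      · exact hD θ ⟨h2, hθ.2⟩
  have hfb' : ∀ z ∈ Ioo t s, q z = f z := by
    intro z hz
    have hzτ := hz.2.trans_le hsτ
    have haz := P.le_left.trans_lt hz.1
    obtain ⟨h1, h2⟩ := P.start.resolve_left (hz.1.trans hzτ).ne
    have hzI : z ∈ Icc a b := ⟨haz.le, hzτ.le.trans P.le_right⟩
    have h3 := T.firstBest_envelope ⟨P.le_left, htb⟩ hzI hz.1.le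
    have h4 := S.env t z
    have h5 : ∫ y in t..z, h (f y) y ≤ ∫ y in t..z, h (q y) y := by
      refine integral_mono_Ioo hz.1.le (T.rent_integrable T.f_mono _ _)
        (T.rent_integrable S.mono _ _) fun y hy => T.h_mono y _ _ (T.f_pos y).le ?_
      have h6 := (P.below y ⟨hy.1, hy.2.trans hzτ⟩).1
      rwa [min_eq_left (hlev y ⟨hy.1, hy.2.trans hz.2⟩)] at h6
    have h6 := hz0 z hz
    rw [excess] at h6
    exact T.eq_firstBest (S.nonneg z) (by linarith)
  have hsb := hsτ.trans P.le_right
  have hfb : ∀ z ∈ Ioo a s, q z = f z := by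
    have hd : ∀ u' v', a ≤ u' → u' < v' → v' ≤ s → ∃ z ∈ Ioo u' v', q z = f z := by
      intro u' v' h1 h2 h3
      obtain ⟨y, hy, hyt⟩ := ((Ioo_infinite h2).sdiff (finite_singleton t)).nonempty
      rcases lt_or_gt_of_ne hyt with h4 | h4
      · exact ⟨y, hy, P.first_best y ⟨h1.trans_lt hy.1, h4⟩⟩
      · exact ⟨y, hy, hfb' y ⟨h4, hy.2.trans_le h3⟩⟩
    intro z hz
    refine le_antisymm (le_of_dense S.mono T.f_cont (fun u' v' h1 h2 h3 => ?_) ⟨hz.1.le, hz.2⟩)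
      (ge_of_dense S.mono T.f_cont (fun u' v' h1 h2 h3 => ?_) ⟨hz.1, hz.2.le⟩)
    · obtain ⟨y, hy, hy'⟩ := hd u' v' h1 h2 h3; exact ⟨y, hy, hy'.le⟩
    · obtain ⟨y, hy, hy'⟩ := hd u' v' h1 h2 h3; exact ⟨y, hy, hy'.ge⟩
  refine ⟨s, hts, hsτ, hfb, fun z hz => ?_, hpos, hlev⟩
  rcases lt_trichotomy z t with h1 | h1 | h1
  · exact P.excess_eq z ⟨hz.1, h1⟩
  · obtain ⟨y, hy⟩ := exists_between hz.1
    rw [S.excess_const T hfb hsb hz ⟨hy.1, hy.2.trans hz.2⟩]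
    exact P.excess_eq y ⟨hy.1, h1 ▸ hy.2⟩
  · exact hz0 z ⟨h1, hz.2⟩

end Strict
end RatingDesign

/-! ### Slack above the split, first best at the split, and the pooling quality -/

namespace RatingDesign
open Filter Topology
noncomputable section Strict
set_option linter.unusedSectionVars false

variable {a b : ℝ} {c h : ℝ → ℝ → ℝ} {f q U w : ℝ → ℝ} {p s t τ σ x : ℝ} {F : Measure ℝ}
  [IsProbabilityMeasure F] [NullSingletonClass F]

/-- Before `τ` the excess itself is positive. If the primitive vanished at a later `θ`, then `s =
τ`, and the excess would be nonnegative on `(τ, θ)` with zero integral; being antitone, it would be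
nonpositive on all of `(τ, b)`, and majorization would be slack nowhere. -/
lemma Pattern.IsSplit.primitive_pos (I : Pattern.IsSplit a c f q U t τ x s)
    (P : Pattern a b c f q U t τ x) (S : Plan a b c h F q U) (T : Technology a b c h f)
    (hF : FullLaw a b F) (hS : ∃ u ∈ Icc a b, 0 < ∫ θ in a..u, excess c q U θ ∂F) {θ : ℝ}
    (hθ : θ ∈ Ioo s b) : 0 < ∫ z in a..θ, excess c q U z ∂F := by
  have has : a ≤ s := P.le_left.trans I.left_le
  have haτ := P.le_left.trans P.left_le
  have iD := S.excess_integrable (F := F) T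
  have hs0 : ∫ z in a..s, excess c q U z ∂F = 0 := by
    rw [integral_congr_Ioo has I.excess_eq]; simp
  have hadd : ∀ u v, (∫ z in a..u, excess c q U z ∂F) + ∫ z in u..v, excess c q U z ∂F =
      ∫ z in a..v, excess c q U z ∂F := fun u v =>
    intervalIntegral.integral_add_adjacent_intervals (iD _ _) (iD _ _)
  have hlow : ∀ v, s < v → v ≤ τ → 0 < ∫ z in a..v, excess c q U z ∂F := by
    intro v h1 h2
    rw [← hadd s v, hs0, zero_add]
    exact hF.integral_pos has h1 (h2.trans P.le_right) (iD _ _)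
      fun z hz => I.excess_pos z ⟨hz.1, hz.2.trans_le h2⟩
  rcases le_or_gt θ τ with h1 | h1
  · exact hlow θ hθ.1 h1
  by_contra! hcon
  have hτ0 : 0 ≤ ∫ z in a..τ, excess c q U z ∂F := S.slack τ ⟨haτ, P.le_right⟩
  have hb := S.balance
  have haθ := haτ.trans h1.le
  have hnn : ∀ y ∈ Ioo τ θ, 0 ≤ excess c q U y := by
    intro y hy
    by_contra! hneg
    have h2 := hF.integral_pos haθ hθ.2 le_rfl (iD θ b).neg fun z hz => by
      have := P.excess_antitone S.toSchedule T ⟨hy.1, hy.2.trans hθ.2⟩ ⟨h1.trans hz.1, hz.2⟩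
        (hy.2.trans hz.1).le
      simp only [Pi.neg_apply]; linarith
    simp only [Pi.neg_apply, intervalIntegral.integral_neg] at h2
    have := hadd θ b
    have := S.slack θ ⟨haθ, hθ.2.le⟩
    linarith
  have hint : 0 ≤ ∫ z in τ..θ, excess c q U z ∂F := integral_nonneg_Ioo h1.le hnn
  have hτθ := hadd τ θ
  have hsτ : s = τ := by
    refine le_antisymm I.le_right (not_lt.1 fun h2 => ?_)
    have := hlow τ h2 le_rfl
    linarith
  have hzero : ∀ y ∈ Ioo τ b, excess c q U y ≤ 0 := by
    intro y hy
    obtain ⟨z, hz, hz0⟩ := hF.exists_eq_zero haτ hθ.2.le le_rfl (lt_min h1 hy.1) (min_le_left _ _)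
      (iD τ θ) hnn (by linarith)
    rw [← hz0]
    exact P.excess_antitone S.toSchedule T ⟨hz.1, hz.2.trans_le ((min_le_right _ _).trans hy.2.le)⟩
      hy (hz.2.le.trans (min_le_right _ _))
  obtain ⟨u, hu, hu0⟩ := hS
  refine absurd hu0 (not_lt.2 (primitive_nonpos (r := τ) hu fun z hz hne => ?_))
  rcases lt_or_gt_of_ne hne with h2 | h2
  · exact (I.excess_eq z ⟨hz.1, hsτ ▸ h2⟩).le
  · exact hzero z ⟨h2, hz.2⟩

/-- A continuous function that is negative at `u` is negative on an interval above `u`. -/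
lemma exists_Ioo_lt {g : ℝ → ℝ} (hg : Continuous g) {u v : ℝ} (huv : u < v) (h : g u < 0) :
    ∃ e ∈ Ioo u v, ∀ z ∈ Icc u e, g z < 0 := by
  obtain ⟨ε, hε, hball⟩ := Metric.isOpen_iff.1 (isOpen_lt hg continuous_const) u h
  obtain ⟨e, he⟩ := exists_between (lt_min huv (show u < u + ε by linarith))
  obtain ⟨h3, h4⟩ := lt_min_iff.1 he.2
  refine ⟨e, ⟨he.1, h3⟩, fun z hz => hball ?_⟩
  rw [Metric.mem_ball, Real.dist_eq, abs_of_nonneg (by linarith [hz.1])]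
  linarith [hz.2]

/-- The region where quality lies between the first best and a constant extends as long as the first
best is below quality. -/
lemma Pattern.extend_below (P : Pattern a b c f q U t τ x) (S : Schedule h q U)
    (T : Technology a b c h f) {r u e : ℝ} (htu : t ≤ u) (he : e ∈ Ioo u b) (hfe : f e < q u)
    (htr : t ≤ r) : f e < x ∧ ∀ z ∈ Ioo r (max τ e), min (f z) x ≤ q z ∧ q z ≤ x := by
  have hex : f e < x := by
    obtain ⟨y, hy, hyτ⟩ := ((Ioo_infinite he.1).sdiff (finite_singleton τ)).nonempty
    have h1 : f e < q y := hfe.trans_le (S.mono hy.1.le)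
    rcases lt_or_gt_of_ne hyτ with h2 | h2
    · exact h1.trans_le (P.below y ⟨htu.trans_lt hy.1, h2⟩).2
    · rcases le_max_iff.1 (P.above y ⟨h2, hy.2.trans he.2⟩).2 with h3 | h3
      · exact absurd (h3.trans (T.f_mono hy.2.le)) (not_le.2 h1)
      · exact h1.trans_le h3
  refine ⟨hex, fun z hz => ?_⟩
  have htz := htr.trans_lt hz.1
  rcases lt_trichotomy z τ with h1 | h1 | h1
  · exact P.below z ⟨htz, h1⟩
  · have hze : z < e := by
      rcases lt_max_iff.1 hz.2 with h2 | h2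
      · exact absurd h2 (h1 ▸ lt_irrefl _)
      · exact h2
    constructor
    · refine ge_of_dense S.mono (g := fun z => min (f z) x) (T.f_cont.min continuous_const)
        (u := r) (v := z) (fun u' v' h2 h3 h4 => ?_) ⟨hz.1, le_rfl⟩
      obtain ⟨y, hy⟩ := exists_between h3
      exact ⟨y, hy, (P.below y ⟨htr.trans_lt (h2.trans_lt hy.1),
        h1 ▸ hy.2.trans_le h4⟩).1⟩
    · obtain ⟨y, hy⟩ := exists_between hze
      refine (S.mono hy.1.le).trans ?_
      rcases le_max_iff.1 (P.above y ⟨h1 ▸ hy.1, hy.2.trans he.2⟩).2 with h3 | h3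
      · exact h3.trans ((T.f_mono hy.2.le).trans hex.le)
      · exact h3
  · have hze : z < e := (lt_max_iff.1 hz.2).resolve_left (not_lt.2 h1.le)
    have h2 := P.above z ⟨h1, hze.trans he.2⟩
    refine ⟨(min_le_right _ _).trans h2.1, h2.2.trans (max_le ?_ le_rfl)⟩
    exact (T.f_mono hze.le).trans hex.le

/-- Under strict submodularity, quality is first best at the type where pooling begins. -/
lemma Pattern.IsSplit.eq_firstBest (I : Pattern.IsSplit a c f q U t τ x s)
    (P : Pattern a b c f q U t τ x) (O : OptimalPlan a b c h F w q U)
    (T : StrictTechnology a b c h f) (hF : FullLaw a b F) (hw : Hump a b F w p)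
    (has : a < s) (hsb : s < b) : q s = f s := by
  have T' := T.toTechnology
  refine le_antisymm ?_ (ge_of_dense O.mono T.f_cont (u := a) (v := s) (fun u' v' h1 h2 h3 => ?_)
    ⟨has, le_rfl⟩)
  swap
  · obtain ⟨y, hy⟩ := exists_between h2
    exact ⟨y, hy, (I.first_best y ⟨h1.trans_lt hy.1, hy.2.trans_le h3⟩).ge⟩
  -- If `q s` exceeds the first best, lowering towards a level `y` strictly in between, on a short
  -- interval above `s`, gains surplus at first order. The ends `e₁`, `e₂` and `e` successively
  -- secure `f < y`, a surplus gain above `c₀`, and changes of rents that are small against `c₀`.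
  by_contra! hlt
  obtain ⟨y, hy⟩ := exists_between hlt
  obtain ⟨K, hK0, hK⟩ := T.h_lip (q b)
  set c₀ := (surplus c y s - surplus c (q s) s) / 2 with hc₀
  have hc₀0 : 0 < c₀ := by
    have := T.s_lt_right s y (q s) hy.1.le hy.2
    simp only [hc₀, surplus]
    linarith
  have hsc : ∀ v : ℝ, Continuous fun u => surplus c v u := fun v =>
    T'.surplus_cont.comp (continuous_const.prodMk continuous_id)
  obtain ⟨e₁, he₁, h1⟩ := exists_Ioo_lt (T.f_cont.sub continuous_const) hsb (sub_neg.2 hy.1)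
  obtain ⟨e₂, he₂, h2⟩ := exists_Ioo_lt (g := fun u => c₀ - (surplus c y u - surplus c (q s) u))
    (continuous_const.sub ((hsc y).sub (hsc (q s)))) he₁.1 (by linarith)
  obtain ⟨e, he, h3⟩ := exists_Ioo_lt (g := fun u => K * q b * (u - s) - c₀ / 2)
    (by fun_prop) he₂.1 (by simp only [sub_self, mul_zero]; linarith)
  have hee₁ := he.2.trans he₂.2
  have heb := hee₁.trans he₁.2
  have hfy : ∀ z ∈ Icc s e, f z < y := fun z hz => sub_neg.1 (h1 z ⟨hz.1, hz.2.trans hee₁.le⟩)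
  have hfe := hfy e ⟨he.1.le, le_rfl⟩
  obtain ⟨hex, hbe⟩ := P.extend_below O.toSchedule T' I.left_le ⟨he.1, heb⟩ (hfe.trans hy.2)
    I.left_le
  refine O.not_lowerable T hF hw (t := s) (τ := max τ e) (x := x) (e := e) (y := y)
    ⟨has.le, hsb⟩ (le_max_of_le_left I.le_right) (max_le P.le_right heb.le) I.first_best
    I.excess_eq
    (Or.inr ⟨(T.f_mono he.1.le).trans hex.le,
      O.firstBest_le_profit T' has I.first_best I.excess_eq⟩) hbe
    (fun z hz => P.above z ⟨(le_max_left _ _).trans_lt hz.1, hz.2⟩) hy.1.le ?_ ?_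
    (T'.lowering_jump hF hw O.mono O.nonneg has.le he.1 heb.le ((T.f_pos s).le.trans hy.1.le) hc₀0
      (fun u hu => ?_) hK0 hK (by linarith [h3 e ⟨he.1.le, le_rfl⟩]))
  · intro z hz hze _
    exact (min_le_left _ _).trans (hfy z ⟨hz.1.le, hze⟩).le
  · intro z hz hze _
    exact absurd hz.1 (not_lt.2 (hze.trans (le_max_right _ _)))
  · have h4 := O.mono hu.1.le
    refine ⟨hy.2.trans_le h4, ?_⟩
    have h5 := h2 u ⟨hu.1.le, hu.2.le.trans he.2.le⟩
    have h6 := T'.surplus_le_right (u := u)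
      ((hfy u ⟨hu.1.le, hu.2.le⟩).le.trans hy.2.le) h4
    linarith

/-- Under strict submodularity, pooling begins below the peak of the weights. -/
lemma Pattern.IsSplit.lt_peak (I : Pattern.IsSplit a c f q U t τ x s)
    (P : Pattern a b c f q U t τ x) (O : OptimalPlan a b c h F w q U)
    (T : StrictTechnology a b c h f) (hF : FullLaw a b F) (hw : Hump a b F w p) (htp : t ≤ p)
    (hS : ∃ u ∈ Icc a b, 0 < ∫ θ in a..u, excess c q U θ ∂F) : s < p := by
  -- If zero excess extended to the peak, the deviation could start at the peak, above which every
  -- tail has a below-average weight. Some type `u` above `s` must have quality above the first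
  -- best, as otherwise the excess would decrease from zero and there would be no slack.
  by_contra! hps
  have T' := T.toTechnology
  have hp := hw.peak_mem
  have has : a < s := hp.1.trans_le hps
  have hsb : s ≤ b := I.le_right.trans P.le_right
  obtain ⟨u, hu, hfu⟩ : ∃ u ∈ Ioo s b, f u < q u := by
    by_contra! hcon
    obtain ⟨u, hu, hu0⟩ := hS
    obtain ⟨r, hr⟩ := exists_between has
    refine absurd hu0 (not_lt.2 (primitive_nonpos (r := s) hu fun v hv hne => ?_))
    rcases lt_or_gt_of_ne hne with h2 | h2
    · exact (I.excess_eq v ⟨hv.1, h2⟩).le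
    · rw [← I.excess_eq r hr]
      refine O.excess_le T' (x := q r) ⟨hr.1.le, hr.2.le.trans hsb⟩ ⟨hv.1.le, hv.2.le⟩
        (hr.2.trans h2).le fun y hy => ⟨O.mono hy.1, le_max_of_le_left ?_⟩
      rcases lt_or_ge y s with h3 | h3
      · exact (I.first_best y ⟨hr.1.trans_le hy.1, h3⟩).le
      · refine le_of_dense O.mono T.f_cont (u := s) (v := b) (fun u' v' h4 h5 h6 => ?_)
          ⟨h3, hy.2.trans_lt hv.2⟩
        obtain ⟨z, hz⟩ := exists_between h5
        exact ⟨z, hz, hcon z ⟨h4.trans_lt hz.1, hz.2.trans_le h6⟩⟩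
  obtain ⟨e, he, hfe⟩ : ∃ e ∈ Ioo u b, f e < q u := by
    obtain ⟨e, he, hlt⟩ := exists_Ioo_lt (T.f_cont.sub continuous_const) hu.2 (sub_neg.2 hfu)
    exact ⟨e, he, sub_neg.1 (hlt e ⟨he.1.le, le_rfl⟩)⟩
  have hpu := hps.trans_lt hu.1
  have hpe := hpu.trans he.1
  obtain ⟨hex, hbe⟩ := P.extend_below O.toSchedule T' (I.left_le.trans hu.1.le) he hfe htp
  have hfb : ∀ θ ∈ Ioo a p, q θ = f θ := fun θ hθ => I.first_best θ ⟨hθ.1, hθ.2.trans_le hps⟩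
  have hex' : ∀ θ ∈ Ioo a p, excess c q U θ = 0 := fun θ hθ =>
    I.excess_eq θ ⟨hθ.1, hθ.2.trans_le hps⟩
  refine O.not_improvable T hF hw (t := p) (τ := max τ e) (x := x) (d := u) (e := e) (y := f e)
    ⟨hp.1.le, hp.2⟩ (le_max_of_le_right hpe.le) (max_le P.le_right he.2.le) hfb hex'
    (Or.inr ⟨(T.f_mono hpe.le).trans hex.le, O.firstBest_le_profit T' hp.1 hfb hex'⟩) hbe
    (fun z hz => P.above z ⟨(le_max_left _ _).trans_lt hz.1, hz.2⟩) hpu.le he.1 he.2.le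
    (T.f_mono hpe.le) (fun z hz => hfe.trans_le (O.mono hz.1.le)) ?_ ?_ ?_
  · intro z hz hze hqz
    exact ⟨(T.f_mono hze).trans hqz.le, hw.tailGap_peak_neg hF hz⟩
  · intro z _ hze _
    exact (min_le_left _ _).trans (T.f_mono hze)
  · intro z hz hze _
    exact absurd hz.1 (not_lt.2 (hze.trans (le_max_right _ _)))

/-- The shape of quality above a type at which price equals quality. -/
lemma Pattern.IsSplit.above_zero (I : Pattern.IsSplit a c f q U t τ x s)
    (P : Pattern a b c f q U t τ x) (S : Schedule h q U) (T : Technology a b c h f) {u : ℝ}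
    (hu : u ∈ Ioo s b) (hu0 : excess c q U u = 0) :
    τ ≤ u ∧ ∀ z ∈ Ioo u b, x ≤ q z ∧ q z ≤ max (f z) (q u) := by
  have hτu : τ ≤ u := by
    by_contra! h1
    exact absurd (I.excess_pos u ⟨hu.1, h1⟩) (hu0 ▸ lt_irrefl _)
  refine ⟨hτu, fun z hz => ?_⟩
  have hz' := P.above z ⟨hτu.trans_lt hz.1, hz.2⟩
  refine ⟨hz'.1, ?_⟩
  rcases hτu.eq_or_lt with h1 | h1
  · subst h1
    have hfx : x < f τ := by
      by_contra! hfx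
      obtain ⟨y, hy⟩ := exists_between hu.1
      have hay : a < y := P.le_left.trans_lt (I.left_le.trans_lt hy.1)
      have h2 := S.excess_mono T (x := q τ) ⟨hay.le, (hy.2.trans hu.2).le⟩
        ⟨(hay.trans hy.2).le, hu.2.le⟩ hy.2.le fun z hz => ⟨?_, S.mono hz.2⟩
      · have := I.excess_pos y hy
        linarith
      · rcases hz.2.eq_or_lt with h3 | h3
        · rw [h3]; exact min_le_right _ _
        · have h4 := (P.below z ⟨I.left_le.trans_lt (hy.1.trans_le hz.1), h3⟩).1
          rw [min_eq_left ((T.f_mono h3.le).trans hfx)] at h4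
          exact (min_le_left _ _).trans h4
    refine le_max_of_le_left (hz'.2.trans (max_le le_rfl ?_))
    exact hfx.le.trans (T.f_mono hz.1.le)
  · exact hz'.2.trans (max_le_max le_rfl (P.above u ⟨h1, hu.2⟩).1)

/-- Above a type of zero excess, `above_zero` bounds quality by the first best or by `q u`, hence by
the first best or `q v`; this is the shape under which the excess decreases. -/
lemma Pattern.IsSplit.excess_le (I : Pattern.IsSplit a c f q U t τ x s)
    (P : Pattern a b c f q U t τ x) (S : Schedule h q U) (T : Technology a b c h f) {u v v' : ℝ}
    (hu : u ∈ Ioo s b) (hu0 : excess c q U u = 0) (hv : u ≤ v) (hv' : v ≤ v') (hb : v' < b) :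
    excess c q U v' ≤ excess c q U v ∧
      (q v < f v → q v < q v' → excess c q U v' < excess c q U v) := by
  have hau : a ≤ u := (P.le_left.trans I.left_le).trans hu.1.le
  have hz := (I.above_zero P S T hu hu0).2
  have hsh : ∀ y ∈ Icc v v', q v ≤ q y ∧ q y ≤ max (f y) (q v) := by
    intro y hy
    refine ⟨S.mono hy.1, ?_⟩
    rcases (hv.trans hy.1).eq_or_lt with h1 | h1
    · exact le_max_of_le_right (S.mono (h1 ▸ hv))
    · exact (hz y ⟨h1, hy.2.trans_lt hb⟩).2.trans (max_le_max le_rfl (S.mono hv))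
  have h1 : v ∈ Icc a b := ⟨hau.trans hv, hv'.trans hb.le⟩
  have h2 : v' ∈ Icc a b := ⟨(hau.trans hv).trans hv', hb.le⟩
  exact ⟨S.excess_le T h1 h2 hv' hsh, S.excess_lt T h1 h2 hv' hsh⟩

/-- Under strict submodularity, all types in the mixing region whose price equals quality choose the
same quality. -/
lemma Pattern.IsSplit.quality_eq (I : Pattern.IsSplit a c f q U t τ x s)
    (P : Pattern a b c f q U t τ x) (O : OptimalPlan a b c h F w q U)
    (T : StrictTechnology a b c h f) (hF : FullLaw a b F) (hw : Hump a b F w p)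
    (hcut : Cut b F w q t σ x) (hτσ : τ = σ ∨ (t = a ∧ τ = a)) {u v : ℝ} (hu : u ∈ Ioo s b)
    (hv : v ∈ Ioo s b) (huv : u < v) (hu0 : excess c q U u = 0) (hv0 : excess c q U v = 0) :
    q u = q v := by
  have T' := T.toTechnology
  -- With different qualities at its ends, `[u, v]` still carries zero excess throughout, so quality
  -- below `q v` is never below the first best there. With the upper bound of `above_zero`, quality
  -- is first best wherever the first best lies strictly between `q u` and `q v`.
  by_contra hne
  have hlt : q u < q v := lt_of_le_of_ne (O.mono huv.le) hne
  obtain ⟨hτu, hz⟩ := I.above_zero P O.toSchedule T' hu hu0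
  have has : a ≤ s := P.le_left.trans I.left_le
  have hau := has.trans_lt hu.1
  have hD0 : ∀ y ∈ Icc u v, excess c q U y = 0 := by
    intro y hy
    have h1 := (I.excess_le P O.toSchedule T' hu hu0 le_rfl hy.1 (hy.2.trans_lt hv.2)).1
    have h2 := (I.excess_le P O.toSchedule T' hu hu0 hy.1 hy.2 hv.2).1
    linarith
  have hK : ∀ y ∈ Icc u v, q y < q v → f y ≤ q y := by
    intro y hy h1
    by_contra! h2
    have h3 := (I.excess_le P O.toSchedule T' hu hu0 hy.1 hy.2 hv.2).2 h2 h1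
    rw [hD0 y hy, hv0] at h3
    exact lt_irrefl _ h3
  have hfu : f u ≤ q u := hK u ⟨le_rfl, huv.le⟩ hlt
  have hfv : q v ≤ f v := by
    rcases le_max_iff.1 (hz v ⟨huv, hv.2⟩).2 with h1 | h1
    · exact h1
    · exact absurd h1 (not_le.2 hlt)
  have ivt : ∀ k, q u < k → k < q v → ∃ r ∈ Ioo u v, f r = k := by
    intro k h1 h2
    obtain ⟨r, hr, hrk⟩ := intermediate_value_Icc huv.le T.f_cont.continuousOn
      ⟨hfu.trans h1.le, h2.le.trans hfv⟩
    refine ⟨r, ⟨lt_of_le_of_ne hr.1 ?_, lt_of_le_of_ne hr.2 ?_⟩, hrk⟩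
    · rintro rfl; linarith
    · rintro rfl; linarith
  -- One third and two thirds of the way, so that on `[d, e]` the first best stays strictly between
  -- `q u` and `q v`.
  obtain ⟨d, hd, hfd⟩ := ivt (q u + (q v - q u) / 3) (by linarith) (by linarith)
  obtain ⟨e, he, hfe⟩ := ivt (q u + 2 * (q v - q u) / 3) (by linarith) (by linarith)
  have hde : d < e := by
    by_contra! h1
    have := T.f_mono h1
    linarith
  have hqf : ∀ y ∈ Icc d e, q y = f y := by
    intro y hy
    have huy := hd.1.trans_le hy.1
    have hyv := hy.2.trans_lt he.2
    have h1 := T.f_mono hy.1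
    have h2 := T.f_mono hy.2
    have h3 : q y ≤ f y := by
      rcases le_max_iff.1 (hz y ⟨huy, hyv.trans hv.2⟩).2 with h4 | h4
      · exact h4
      · linarith
    exact le_antisymm h3 (hK y ⟨huy.le, hyv.le⟩ (by linarith))
  have hqd := hqf d ⟨le_rfl, hde.le⟩
  have hxd : x ≤ q d := (hz d ⟨hd.1, hd.2.trans hv.2⟩).1
  have hsd := hu.1.trans hd.1
  have heb := he.2.trans hv.2
  have hσd : σ ≤ d := by
    rcases hτσ with h1 | ⟨h1, h2⟩
    · rw [← h1]; exact hτu.trans hd.1.le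
    · by_contra! h3
      have h4 := hcut.le_cut d (h1 ▸ hau.trans hd.1) h3
      have h5 := (P.above u ⟨h2 ▸ hau, hu.2⟩).1
      linarith
  have hts : t < b := (I.left_le.trans_lt hsd).trans (hd.2.trans hv.2)
  have hgap_s : 0 ≤ tailGap b F w t s := by
    rcases I.left_le.eq_or_lt with h1 | h1
    · rw [← h1, tailGap_self]
    · have hsσ : s ≤ σ := by
        rcases hτσ with h2 | ⟨h2, h3⟩
        · exact h2 ▸ I.le_right
        · have := I.le_right
          linarith
      have hcl : IsClosed {z | 0 ≤ tailGap b F w t z} :=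
        isClosed_le continuous_const (continuous_tailGap hw t)
      have hsub : Icc t s ⊆ {z | 0 ≤ tailGap b F w t z} := by
        rw [← closure_Ioo h1.ne]
        exact hcl.closure_subset_iff.2 fun z hz => hcut.gap_nonneg z hz.1 (hz.2.trans_le hsσ)
      exact hsub ⟨h1.le, le_rfl⟩
  have hms : 0 < tailMass b F s := hF.tailMass_pos ⟨has, hu.1.trans hu.2⟩
  have hmt : 0 < tailMass b F t := hF.tailMass_pos ⟨P.le_left, hts⟩
  -- The mean weight above `s` is at least that above `t`, and tails that start beyond `d` have
  -- means below the latter because `d` is past the crossing.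
  have hgap : ∀ z ∈ Ioo d b, tailGap b F w s z < 0 := by
    intro z hz
    obtain ⟨y, hy⟩ := exists_between hz.1
    have hty : t < y := I.left_le.trans_lt (hsd.trans hy.1)
    have h1 := hcut.gap_nonpos y (hσd.trans_lt hy.1) (hy.2.trans hz.2)
    have h2 := hw.tailGap_neg hF P.le_left hty hy.2 hz.2 h1
    have hmz : 0 < tailMass b F z := hF.tailMass_pos ⟨(has.trans hsd.le).trans hz.1.le, hz.2⟩
    unfold tailGap at h2 hgap_s ⊢
    by_contra! h3
    have h4 := mul_lt_mul_of_pos_left h2 hms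
    have h5 := mul_le_mul_of_nonneg_left hgap_s hmz.le
    have h6 := mul_le_mul_of_nonneg_left h3 hmt.le
    linarith
  have hst : s = τ ∨ (f s ≤ x ∧ surplus c (f s) s ≤ U s) := by
    rcases I.le_right.eq_or_lt with h1 | h1
    · exact Or.inl h1
    refine Or.inr ?_
    rcases I.left_le.eq_or_lt with h2 | h2
    · rw [← h2]; exact P.start.resolve_left (h2 ▸ h1.ne)
    · refine ⟨?_, O.firstBest_le_profit T' (P.le_left.trans_lt h2) I.first_best I.excess_eq⟩
      refine ge_of_dense (q := fun _ => x) monotone_const T.f_cont (u := t) (v := s)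
        (fun u' v' h3 h4 h5 => ?_) ⟨h2, le_rfl⟩
      obtain ⟨y, hy⟩ := exists_between h4
      exact ⟨y, hy, I.le_level y ⟨h3.trans_lt hy.1, hy.2.trans_le h5⟩⟩
  have had := has.trans_lt hsd
  refine O.not_improvable T hF hw (t := s) (τ := τ) (x := x) (d := d) (e := e) (y := f d)
    ⟨has, hu.1.trans hu.2⟩ I.le_right P.le_right I.first_best I.excess_eq hst
    (fun z hz => P.below z ⟨I.left_le.trans_lt hz.1, hz.2⟩) P.above hsd.le hde heb.le
    (T.f_mono hsd.le) ?_ ?_ ?_ ?_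
  · intro z hz
    rw [hqf z ⟨hz.1.le, hz.2.le⟩]
    exact T.f_strict ⟨had.le, (hde.trans heb).le⟩ ⟨(had.trans hz.1).le, (hz.2.trans heb).le⟩ hz.1
  · intro z hz hze hqz
    have hdz : d < z := by
      by_contra! h1
      have := O.mono h1
      linarith
    exact ⟨(hqf z ⟨hdz.le, hze⟩).ge, hgap z ⟨hdz, hz.2⟩⟩
  · intro z hz _ hqz
    have := O.mono (hz.2.le.trans (hτu.trans hd.1.le))
    linarith
  · intro z _ _ _
    rw [← hqd]; exact hxd

/-- The structure of optimal plans under strict submodularity. -/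
lemma OptimalPlan.exists_strict_pooling (O : OptimalPlan a b c h F w q U)
    (T : StrictTechnology a b c h f) (hF : FullLaw a b F) (hw : Hump a b F w p)
    (hqb : MonotoneOn (fun θ => q θ + excess c q U θ) (Icc a b)) :
    ∃ s ∈ Ico a p, (∀ θ ∈ Ioc a s, q θ = f θ) ∧ (∀ θ ∈ Ioo a s, excess c q U θ = 0) ∧
      (∀ θ ∈ Ioo s b, 0 < ∫ z in a..θ, excess c q U z ∂F) ∧
      ∃ k, (∀ θ ∈ Ioo a b, (0 < excess c q U θ → q θ + excess c q U θ ≤ k) ∧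
        (excess c q U θ < 0 → k ≤ q θ + excess c q U θ)) ∧
        (∀ θ ∈ Ioo s b, excess c q U θ = 0 → q θ = k) ∧ ∀ θ ∈ Ioo a s, q θ ≠ k := by
  have T' := T.toTechnology
  obtain ⟨t, τ, σ, x, ht, _, hcut, P, hτσ⟩ := O.exists_pattern T' hF hw
  have hS := O.exists_slack T hF hw P
  obtain ⟨s, I⟩ := P.exists_split O.toSchedule T' hS
  have hsp := I.lt_peak P O T hF hw ht.2 hS
  have has : a ≤ s := P.le_left.trans I.left_le
  have hsb : s < b := hsp.trans hw.peak_mem.2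
  have hpos := fun θ hθ => I.primitive_pos P O.toPlan T' hF hS (θ := θ) hθ
  have hI : ∀ θ ∈ Ioo a b, θ ∈ Icc a b := fun θ hθ => ⟨hθ.1.le, hθ.2.le⟩
  have hsI : ∀ θ ∈ Ioo s b, θ ∈ Ioo a b := fun θ hθ => ⟨has.trans_lt hθ.1, hθ.2⟩
  -- Types below `s` have to be revealed, so their qualities must differ from `k`. Strict
  -- monotonicity of the first best leaves room between them and any quality above `s`.
  have hfin : ∀ k, (∃ θ ∈ Ioo s b, q θ ≤ k) → ∀ θ ∈ Ioo a s, q θ ≠ k := by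
    rintro k ⟨θ', hθ', hk⟩ θ hθ rfl
    obtain ⟨y, hy⟩ := exists_between hθ.2
    have h1 : q y ≤ q θ' := O.mono (hy.2.trans hθ'.1).le
    rw [I.first_best y ⟨hθ.1.trans hy.1, hy.2⟩] at h1
    rw [I.first_best θ hθ] at hk
    have := T.f_strict ⟨hθ.1.le, hθ.2.le.trans hsb.le⟩
      ⟨(hθ.1.trans hy.1).le, hy.2.le.trans hsb.le⟩ hy.1
    linarith
  refine ⟨s, ⟨has, hsp⟩, fun θ hθ => ?_, I.excess_eq, hpos, ?_⟩
  · rcases hθ.2.eq_or_lt with h1 | h1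
    · rw [h1]
      exact I.eq_firstBest P O T hF hw (h1 ▸ hθ.1) hsb
    · exact I.first_best θ ⟨hθ.1, h1⟩
  -- A type above `s` with zero excess is revealed unless its quality is the pooling price; by
  -- `quality_eq` one value serves all such types. If there are none, any separating price works.
  by_cases hz : ∃ θ₀ ∈ Ioo s b, excess c q U θ₀ = 0
  · obtain ⟨θ₀, hθ₀, h0⟩ := hz
    refine ⟨q θ₀, fun θ hθ => ⟨fun h1 => ?_, fun h1 => ?_⟩, fun θ hθ h1 => ?_,
      hfin _ ⟨θ₀, hθ₀, le_rfl⟩⟩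
    · have h2 : θ ≤ θ₀ := by
        by_contra! h2
        have := (I.excess_le P O.toSchedule T' hθ₀ h0 le_rfl h2.le hθ.2).1
        linarith
      have := hqb (hI θ hθ) (hI θ₀ (hsI θ₀ hθ₀)) h2
      simp only [h0, add_zero] at this
      exact this
    · have h2 : θ₀ ≤ θ := by
        by_contra! h2
        have := P.single_crossing O.toSchedule T' hθ.1 hθ₀.2 h2 h1
        linarith
      have := hqb (hI θ₀ (hsI θ₀ hθ₀)) (hI θ hθ) h2
      simp only [h0, add_zero] at this
      exact this
    · rcases lt_trichotomy θ θ₀ with h2 | h2 | h2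
      · exact I.quality_eq P O T hF hw hcut hτσ hθ hθ₀ h2 h1 h0
      · rw [h2]
      · exact (I.quality_eq P O T hF hw hcut hτσ hθ₀ hθ h2 h0 h1).symm
  · push Not at hz
    obtain ⟨k, hk⟩ := exists_pooling_price hqb (D := excess c q U)
      fun u v hu hv huv h => P.single_crossing O.toSchedule T' hu hv huv h
    refine ⟨k, hk, fun θ hθ h1 => absurd h1 (hz θ hθ), hfin k ?_⟩
    obtain ⟨y, hy⟩ := exists_between hsb
    have h1 := hpos y hy
    by_contra! hcon
    have h2 : ∫ z in a..y, excess c q U z ∂F ≤ 0 := by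
      refine primitive_nonpos (b := b) (r := s) ⟨has.trans hy.1.le, hy.2.le⟩ fun θ hθ hne => ?_
      rcases lt_or_gt_of_ne hne with h3 | h3
      · exact (I.excess_eq θ ⟨hθ.1, h3⟩).le
      · by_contra! h4
        have h5 := (hk θ hθ).1 h4
        have h6 := hcon θ ⟨h3, hθ.2⟩
        linarith
    linarith

end Strict
end RatingDesign

/-! ### Partial derivatives of the cost on the closed strip -/

namespace RatingDesign
open Filter Topology
noncomputable section Extension
set_option linter.unusedSectionVars false

variable {a b : ℝ} {C : ℝ → ℝ → ℝ} {qFB : ℝ → ℝ}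

/-- Derivatives within a set that contains `[u, v]` are two-sided in the open interval, so the mean
value theorem applies up to the boundary of the domain. -/
lemma exists_slope {g g' : ℝ → ℝ} {s : Set ℝ} {u v : ℝ}
    (hg : ∀ x ∈ s, HasDerivWithinAt g (g' x) s x) (hs : Icc u v ⊆ s) (huv : u < v) :
    ∃ ξ ∈ Ioo u v, g v - g u = g' ξ * (v - u) := by
  obtain ⟨ξ, hξ, h⟩ := exists_hasDerivAt_eq_slope g g' huv
    (fun x hx => ((hg x (hs hx)).mono hs).continuousWithinAt)
    fun x hx => ((hg x (hs ⟨hx.1.le, hx.2.le⟩)).mono hs).hasDerivAt (Icc_mem_nhds hx.1 hx.2)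
  refine ⟨ξ, hξ, ?_⟩
  rw [h, div_mul_cancel₀ _ (sub_pos.2 huv).ne']

lemma le_of_derivWithin_nonneg {g g' : ℝ → ℝ} {s : Set ℝ} {u v : ℝ}
    (hg : ∀ x ∈ s, HasDerivWithinAt g (g' x) s x) (h0 : ∀ x ∈ s, 0 ≤ g' x) (hs : Icc u v ⊆ s)
    (huv : u ≤ v) : g u ≤ g v := by
  rcases huv.eq_or_lt with rfl | h1
  · exact le_rfl
  · obtain ⟨ξ, hξ, h⟩ := exists_slope hg hs h1
    have := mul_nonneg (h0 ξ (hs ⟨hξ.1.le, hξ.2.le⟩)) (sub_pos.2 h1).le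
    linarith

lemma exists_lipschitz {g g' : ℝ → ℝ → ℝ} {s : Set ℝ} (hs : IsCompact s)
    (hg : ∀ t ∈ s, ∀ x ∈ Ici (0 : ℝ), HasDerivWithinAt (fun y => g y t) (g' x t) (Ici 0) x)
    (hg' : ContinuousOn (fun z : ℝ × ℝ => g' z.1 z.2) (Ici 0 ×ˢ s)) (M : ℝ) :
    ∃ K, 0 ≤ K ∧ ∀ t ∈ s, ∀ x y, 0 ≤ x → x ≤ y → y ≤ M → |g y t - g x t| ≤ K * (y - x) := by
  obtain ⟨B, hB⟩ := ((isCompact_Icc (a := (0 : ℝ)) (b := M)).prod hs).exists_bound_of_continuousOn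
    (hg'.mono (prod_mono_left Icc_subset_Ici_self))
  refine ⟨max B 0, le_max_right _ _, fun t ht x y hx hxy hy => ?_⟩
  rcases hxy.eq_or_lt with rfl | h1
  · simp
  · obtain ⟨ξ, hξ, h⟩ := exists_slope (hg t ht) (u := x) (v := y) (fun z hz => hx.trans hz.1) h1
    rw [h, abs_mul, abs_of_pos (sub_pos.2 h1)]
    refine mul_le_mul_of_nonneg_right (le_max_of_le_left ?_) (sub_pos.2 h1).le
    exact hB (ξ, t) ⟨⟨hx.trans hξ.1.le, hξ.2.le.trans hy⟩, ht⟩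

lemma uniqueDiffOn_strip (hab : a < b) : UniqueDiffOn ℝ (Ici (0 : ℝ) ×ˢ Icc a b) :=
  (uniqueDiffOn_Ici 0).prod (uniqueDiffOn_Icc hab)

lemma hasDerivWithinAt_fst {g : ℝ × ℝ → ℝ} {s r : Set ℝ} {x t : ℝ}
    (hg : DifferentiableWithinAt ℝ g (s ×ˢ r) (x, t)) (ht : t ∈ r) :
    HasDerivWithinAt (fun y => g (y, t)) (fderivWithin ℝ g (s ×ˢ r) (x, t) (1, 0)) s x :=
  hg.hasFDerivWithinAt.comp_hasDerivWithinAt (f := fun y => (y, t)) x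
    ((hasDerivWithinAt_id x s).prodMk (hasDerivWithinAt_const x s t)) fun _ hy => ⟨hy, ht⟩

lemma hasDerivWithinAt_snd {g : ℝ × ℝ → ℝ} {s r : Set ℝ} {x t : ℝ}
    (hg : DifferentiableWithinAt ℝ g (s ×ˢ r) (x, t)) (hx : x ∈ s) :
    HasDerivWithinAt (fun y => g (x, y)) (fderivWithin ℝ g (s ×ˢ r) (x, t) (0, 1)) r t :=
  hg.hasFDerivWithinAt.comp_hasDerivWithinAt (f := fun y => (x, y)) t
    ((hasDerivWithinAt_const t r x).prodMk (hasDerivWithinAt_id t r)) fun _ hy => ⟨hx, hy⟩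

lemma _root_.IsCost.contDiffOn_fderiv_apply (hC : IsCost a b C) (hab : a < b) (v : ℝ × ℝ) :
    ContDiffOn ℝ 1
      (fun z => fderivWithin ℝ (fun z : ℝ × ℝ => C z.1 z.2) (Ici 0 ×ˢ Icc a b) z v)
      (Ici 0 ×ˢ Icc a b) :=
  (hC.smooth.fderivWithin (uniqueDiffOn_strip hab) (m := 1) (by norm_num)).clm_apply
    contDiffOn_const

lemma _root_.IsCost.hasDeriv_fst (hC : IsCost a b C) {x t : ℝ} (hx : 0 ≤ x)
    (ht : t ∈ Icc a b) : HasDerivWithinAt (fun y => C y t) (costQ C x t) (Ici 0) x :=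
  (hasDerivWithinAt_fst (hC.smooth.differentiableOn (by norm_num) (x, t) ⟨hx, ht⟩)
    ht).differentiableWithinAt.hasDerivWithinAt

lemma _root_.IsCost.hasDeriv_snd (hC : IsCost a b C) {x t : ℝ} (hx : 0 ≤ x)
    (ht : t ∈ Icc a b) : HasDerivWithinAt (fun s => C x s) (costT a b C x t) (Icc a b) t :=
  (hasDerivWithinAt_snd (hC.smooth.differentiableOn (by norm_num) (x, t) ⟨hx, ht⟩)
    (s := Ici 0) hx).differentiableWithinAt.hasDerivWithinAt

lemma _root_.IsCost.costQ_eq (hC : IsCost a b C) {x t : ℝ} (hx : 0 ≤ x) (ht : t ∈ Icc a b) :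
    costQ C x t =
      fderivWithin ℝ (fun z : ℝ × ℝ => C z.1 z.2) (Ici 0 ×ˢ Icc a b) (x, t) (1, 0) :=
  (hasDerivWithinAt_fst (hC.smooth.differentiableOn (by norm_num) (x, t) ⟨hx, ht⟩)
    ht).derivWithin (uniqueDiffOn_Ici 0 x hx)

lemma _root_.IsCost.costT_eq (hC : IsCost a b C) (hab : a < b) {x t : ℝ} (hx : 0 ≤ x)
    (ht : t ∈ Icc a b) : costT a b C x t =
      fderivWithin ℝ (fun z : ℝ × ℝ => C z.1 z.2) (Ici 0 ×ˢ Icc a b) (x, t) (0, 1) :=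
  (hasDerivWithinAt_snd (hC.smooth.differentiableOn (by norm_num) (x, t) ⟨hx, ht⟩)
    (s := Ici 0) hx).derivWithin (uniqueDiffOn_Icc hab t ht)

lemma _root_.IsCost.hasDeriv_costQ_fst (hC : IsCost a b C) (hab : a < b) {x t : ℝ} (hx : 0 ≤ x)
    (ht : t ∈ Icc a b) : HasDerivWithinAt (fun y => costQ C y t) (fderivWithin ℝ (fun z =>
      fderivWithin ℝ (fun z : ℝ × ℝ => C z.1 z.2) (Ici 0 ×ˢ Icc a b) z (1, 0))
      (Ici 0 ×ˢ Icc a b) (x, t) (1, 0)) (Ici 0) x :=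
  (hasDerivWithinAt_fst ((hC.contDiffOn_fderiv_apply hab (1, 0)).differentiableOn one_ne_zero
    (x, t) ⟨hx, ht⟩) ht).congr (fun _ hy => hC.costQ_eq hy ht) (hC.costQ_eq hx ht)

lemma _root_.IsCost.hasDeriv_costQ_snd (hC : IsCost a b C) (hab : a < b) {x t : ℝ} (hx : 0 ≤ x)
    (ht : t ∈ Icc a b) : HasDerivWithinAt (fun s => costQ C x s) (fderivWithin ℝ (fun z =>
      fderivWithin ℝ (fun z : ℝ × ℝ => C z.1 z.2) (Ici 0 ×ˢ Icc a b) z (1, 0))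
      (Ici 0 ×ˢ Icc a b) (x, t) (0, 1)) (Icc a b) t :=
  (hasDerivWithinAt_snd ((hC.contDiffOn_fderiv_apply hab (1, 0)).differentiableOn one_ne_zero
    (x, t) ⟨hx, ht⟩) (s := Ici 0) hx).congr (fun _ hy => hC.costQ_eq hx hy) (hC.costQ_eq hx ht)

lemma _root_.IsCost.costQQ_eq (hC : IsCost a b C) (hab : a < b) {x t : ℝ} (hx : 0 ≤ x)
    (ht : t ∈ Icc a b) : costQQ C x t = fderivWithin ℝ (fun z =>
      fderivWithin ℝ (fun z : ℝ × ℝ => C z.1 z.2) (Ici 0 ×ˢ Icc a b) z (1, 0))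
      (Ici 0 ×ˢ Icc a b) (x, t) (1, 0) :=
  (hC.hasDeriv_costQ_fst hab hx ht).derivWithin (uniqueDiffOn_Ici 0 x hx)

lemma _root_.IsCost.costQT_eq (hC : IsCost a b C) (hab : a < b) {x t : ℝ} (hx : 0 ≤ x)
    (ht : t ∈ Icc a b) : costQT a b C x t = fderivWithin ℝ (fun z =>
      fderivWithin ℝ (fun z : ℝ × ℝ => C z.1 z.2) (Ici 0 ×ˢ Icc a b) z (1, 0))
      (Ici 0 ×ˢ Icc a b) (x, t) (0, 1) :=
  (hC.hasDeriv_costQ_snd hab hx ht).derivWithin (uniqueDiffOn_Icc hab t ht)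

/-- The second derivative within the strip is symmetric because the strip lies in the closure of its
interior. This makes `C_qθ` the derivative of `C_θ` in quality. -/
lemma _root_.IsCost.costQT_eq_symm (hC : IsCost a b C) (hab : a < b) {x t : ℝ} (hx : 0 ≤ x)
    (ht : t ∈ Icc a b) : costQT a b C x t = fderivWithin ℝ (fun z =>
      fderivWithin ℝ (fun z : ℝ × ℝ => C z.1 z.2) (Ici 0 ×ˢ Icc a b) z (0, 1))
      (Ici 0 ×ˢ Icc a b) (x, t) (1, 0) := by
  have hu := uniqueDiffOn_strip hab
  have hxt : (x, t) ∈ Ici (0 : ℝ) ×ˢ Icc a b := ⟨hx, ht⟩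
  have hd : DifferentiableWithinAt ℝ (fderivWithin ℝ (fun z : ℝ × ℝ => C z.1 z.2)
      (Ici 0 ×ˢ Icc a b)) (Ici 0 ×ˢ Icc a b) (x, t) :=
    (hC.smooth.fderivWithin hu (m := 1) (by norm_num)).differentiableOn one_ne_zero _ hxt
  have hcl : (x, t) ∈ closure (interior (Ici (0 : ℝ) ×ˢ Icc a b)) := by
    rw [interior_prod_eq, closure_prod_eq, interior_Ici, interior_Icc, closure_Ioi,
      closure_Ioo hab.ne]
    exact hxt
  have hsymm := (hC.smooth (x, t) hxt).isSymmSndFDerivWithinAt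
    (by simp) hu hcl hxt
  rw [hC.costQT_eq hab hx ht]
  have key : ∀ v w : ℝ × ℝ, fderivWithin ℝ (fun z =>
      fderivWithin ℝ (fun z : ℝ × ℝ => C z.1 z.2) (Ici 0 ×ˢ Icc a b) z v)
      (Ici 0 ×ˢ Icc a b) (x, t) w = fderivWithin ℝ (fderivWithin ℝ (fun z : ℝ × ℝ => C z.1 z.2)
      (Ici 0 ×ˢ Icc a b)) (Ici 0 ×ˢ Icc a b) (x, t) w v := by
    intro v w
    rw [fderivWithin_clm_apply (hu _ hxt) hd (differentiableWithinAt_const v)]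
    simp
  rw [key, key]
  exact hsymm _ _

lemma _root_.IsCost.hasDeriv_costQ_costQQ (hC : IsCost a b C) (hab : a < b) {x t : ℝ} (hx : 0 ≤ x)
    (ht : t ∈ Icc a b) : HasDerivWithinAt (fun y => costQ C y t) (costQQ C x t) (Ici 0) x := by
  rw [hC.costQQ_eq hab hx ht]; exact hC.hasDeriv_costQ_fst hab hx ht

lemma _root_.IsCost.hasDeriv_costQ_costQT (hC : IsCost a b C) (hab : a < b) {x t : ℝ} (hx : 0 ≤ x)
    (ht : t ∈ Icc a b) :
    HasDerivWithinAt (fun s => costQ C x s) (costQT a b C x t) (Icc a b) t := by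
  rw [hC.costQT_eq hab hx ht]; exact hC.hasDeriv_costQ_snd hab hx ht

/-- Symmetry of the mixed second derivatives of the cost. -/
lemma _root_.IsCost.hasDeriv_costT_costQT (hC : IsCost a b C) (hab : a < b) {x t : ℝ} (hx : 0 ≤ x)
    (ht : t ∈ Icc a b) :
    HasDerivWithinAt (fun y => costT a b C y t) (costQT a b C x t) (Ici 0) x := by
  rw [hC.costQT_eq_symm hab hx ht]
  exact (hasDerivWithinAt_fst ((hC.contDiffOn_fderiv_apply hab (0, 1)).differentiableOn one_ne_zero
    (x, t) ⟨hx, ht⟩) ht).congr (fun _ hy => hC.costT_eq hab hy ht) (hC.costT_eq hab hx ht)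

lemma _root_.IsCost.continuousOn_costQ (hC : IsCost a b C) (hab : a < b) :
    ContinuousOn (fun z : ℝ × ℝ => costQ C z.1 z.2) (Ici 0 ×ˢ Icc a b) :=
  (hC.contDiffOn_fderiv_apply hab (1, 0)).continuousOn.congr fun _ hz => hC.costQ_eq hz.1 hz.2

lemma _root_.IsCost.continuousOn_costT (hC : IsCost a b C) (hab : a < b) :
    ContinuousOn (fun z : ℝ × ℝ => costT a b C z.1 z.2) (Ici 0 ×ˢ Icc a b) :=
  (hC.contDiffOn_fderiv_apply hab (0, 1)).continuousOn.congr fun _ hz =>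
    hC.costT_eq hab hz.1 hz.2

lemma _root_.IsCost.continuousOn_fderiv (hC : IsCost a b C) (hab : a < b) (v w : ℝ × ℝ) :
    ContinuousOn (fun z => fderivWithin ℝ (fun z =>
      fderivWithin ℝ (fun z : ℝ × ℝ => C z.1 z.2) (Ici 0 ×ˢ Icc a b) z v)
      (Ici 0 ×ˢ Icc a b) z w) (Ici 0 ×ˢ Icc a b) :=
  ((hC.contDiffOn_fderiv_apply hab v).continuousOn_fderivWithin (uniqueDiffOn_strip hab)
    le_rfl).clm_apply continuousOn_const

lemma _root_.IsCost.continuousOn_costQQ (hC : IsCost a b C) (hab : a < b) :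
    ContinuousOn (fun z : ℝ × ℝ => costQQ C z.1 z.2) (Ici 0 ×ˢ Icc a b) :=
  (hC.continuousOn_fderiv hab (1, 0) (1, 0)).congr fun _ hz => hC.costQQ_eq hab hz.1 hz.2

lemma _root_.IsCost.continuousOn_costQT (hC : IsCost a b C) (hab : a < b) :
    ContinuousOn (fun z : ℝ × ℝ => costQT a b C z.1 z.2) (Ici 0 ×ˢ Icc a b) :=
  (hC.continuousOn_fderiv hab (1, 0) (0, 1)).congr fun _ hz => hC.costQT_eq hab hz.1 hz.2

end Extension
end RatingDesign

/-! ### Costs and first best, extended to all reals, as a technology -/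

namespace RatingDesign
open Filter Topology
noncomputable section Extension
set_option linter.unusedSectionVars false

variable {a b : ℝ} {C : ℝ → ℝ → ℝ} {qFB : ℝ → ℝ}

/-- The type in `[a, b]` closest to `u`. -/
def clampType (a b u : ℝ) : ℝ := max a (min u b)

lemma clampType_mem (hab : a ≤ b) (u : ℝ) : clampType a b u ∈ Icc a b :=
  ⟨le_max_left _ _, max_le hab (min_le_right _ _)⟩

lemma clampType_of_mem {u : ℝ} (hu : u ∈ Icc a b) : clampType a b u = u := by
  rw [clampType, min_eq_left hu.2, max_eq_right hu.1]

lemma clampType_mono : Monotone (clampType a b) := fun _ _ h =>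
  max_le_max le_rfl (min_le_min h le_rfl)

lemma continuous_clampType : Continuous (clampType a b) := by unfold clampType; fun_prop

/-- The extension of a function of qualities and types to all reals. -/
def extend (a b : ℝ) (g : ℝ → ℝ → ℝ) (x u : ℝ) : ℝ := g (max x 0) (clampType a b u)

lemma extend_of_nonneg (g : ℝ → ℝ → ℝ) {x : ℝ} (hx : 0 ≤ x) (u : ℝ) :
    extend a b g x u = g x (clampType a b u) := by rw [extend, max_eq_left hx]

lemma extend_of_mem (g : ℝ → ℝ → ℝ) {x u : ℝ} (hx : 0 ≤ x) (hu : u ∈ Icc a b) :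
    extend a b g x u = g x u := by rw [extend_of_nonneg g hx, clampType_of_mem hu]

lemma continuous_extend (hab : a ≤ b) {g : ℝ → ℝ → ℝ}
    (hg : ContinuousOn (fun z : ℝ × ℝ => g z.1 z.2) (Ici 0 ×ˢ Icc a b)) :
    Continuous fun z : ℝ × ℝ => extend a b g z.1 z.2 :=
  hg.comp_continuous (f := fun z : ℝ × ℝ => (max z.1 0, clampType a b z.2))
    ((continuous_fst.max continuous_const).prodMk (continuous_clampType.comp continuous_snd))
    fun z => ⟨le_max_right z.1 0, clampType_mem hab _⟩

/-- The marginal rent of a type. -/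
def marginalRent (a b : ℝ) (C : ℝ → ℝ → ℝ) (x t : ℝ) : ℝ := - costT a b C x t

section Marginal

variable {x y t u : ℝ}

lemma _root_.IsCost.costQ_mono (hC : IsCost a b C) (hab : a < b) (ht : t ∈ Icc a b) (hx : 0 ≤ x)
    (hxy : x ≤ y) : costQ C x t ≤ costQ C y t :=
  le_of_derivWithin_nonneg (s := Ici 0) (fun _ hz => hC.hasDeriv_costQ_costQQ hab hz ht)
    (fun _ hz => hC.costQQ_nonneg _ hz t ht) (fun _ hz => hx.trans hz.1) hxy

lemma _root_.IsCost.costQ_anti (hC : IsCost a b C) (hab : a < b) (ht : t ∈ Icc a b)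
    (hu : u ∈ Icc a b) (hx : 0 ≤ x) (htu : t ≤ u) : costQ C x u ≤ costQ C x t :=
  neg_le_neg_iff.1 (le_of_derivWithin_nonneg (s := Icc a b) (g := fun s => - costQ C x s)
    (fun _ hz => (hC.hasDeriv_costQ_costQT hab hx hz).neg)
    (fun _ hz => neg_nonneg.2 (hC.costQT_nonpos x hx _ hz)) (Icc_subset_Icc ht.1 hu.2) htu)

lemma _root_.IsFirstBest.costQ_lt_one (hFB : IsFirstBest a b C qFB) (hC : IsCost a b C)
    (hab : a < b) (ht : t ∈ Icc a b) (hx : 0 ≤ x) : costQ C x t < 1 ↔ x < qFB t := by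
  obtain ⟨h1, h2, h3⟩ := hFB t ht
  constructor
  · intro h
    by_contra! hcon
    have := hC.costQ_mono hab ht h1 hcon
    linarith
  · intro h
    have h4 := hC.costQ_mono hab ht hx h.le
    rw [h2] at h4
    exact lt_of_le_of_ne h4 fun h5 => h.ne (h3 x hx h5)

lemma _root_.IsFirstBest.one_lt_costQ (hFB : IsFirstBest a b C qFB) (hC : IsCost a b C)
    (hab : a < b) (ht : t ∈ Icc a b) (hx : 0 ≤ x) : 1 < costQ C x t ↔ qFB t < x := by
  obtain ⟨h1, h2, h3⟩ := hFB t ht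
  constructor
  · intro h
    by_contra! hcon
    have := hC.costQ_mono hab ht hx hcon
    linarith
  · intro h
    have h4 := hC.costQ_mono hab ht h1 h.le
    rw [h2] at h4
    exact lt_of_le_of_ne h4 fun h5 => h.ne' (h3 x hx h5.symm)

lemma _root_.IsFirstBest.pos (hFB : IsFirstBest a b C qFB) (hC : IsCost a b C)
    (hab : a < b) (ht : t ∈ Icc a b) : 0 < qFB t := by
  rw [← hFB.costQ_lt_one hC hab ht le_rfl, hC.costQ_zero t ht]
  exact one_pos

lemma _root_.IsFirstBest.monotoneOn (hFB : IsFirstBest a b C qFB) (hC : IsCost a b C)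
    (hab : a < b) : MonotoneOn qFB (Icc a b) := by
  intro t ht u hu htu
  by_contra! h
  have h1 := (hFB.one_lt_costQ hC hab hu (hFB t ht).1).2 h
  have h2 := hC.costQ_anti hab ht hu (hFB t ht).1 htu
  rw [(hFB t ht).2.1] at h2
  linarith

lemma _root_.IsFirstBest.strictMonoOn (hFB : IsFirstBest a b C qFB) (hC : IsCost a b C)
    (hab : a < b) (hs : StrictlySubmodular a b C) : StrictMonoOn qFB (Icc a b) := by
  intro t ht u hu htu
  have hpos := hFB.pos hC hab ht
  rw [← hFB.costQ_lt_one hC hab hu hpos.le]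
  obtain ⟨ξ, hξ, h⟩ := exists_slope (g := fun s => costQ C (qFB t) s) (s := Icc a b)
    (fun _ hz => hC.hasDeriv_costQ_costQT hab hpos.le hz) (Icc_subset_Icc ht.1 hu.2) htu
  have h1 := mul_neg_of_neg_of_pos (hs _ hpos ξ ⟨ht.1.trans hξ.1.le, hξ.2.le.trans hu.2⟩)
    (sub_pos.2 htu)
  rw [(hFB t ht).2.1] at h
  linarith

/-- For `y ≥ 0`, the types with first best above or below `y` are those with `C_q` at `y` below or
above one, and these conditions are open by continuity of `C_q`. A negative `y` is trivial. -/
lemma _root_.IsFirstBest.continuous_extend (hFB : IsFirstBest a b C qFB) (hC : IsCost a b C)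
    (hab : a < b) : Continuous fun u => qFB (clampType a b u) := by
  have hk : ∀ x, Continuous fun u => extend a b (costQ C) x u := fun x =>
    (RatingDesign.continuous_extend hab.le (hC.continuousOn_costQ hab)).comp
      (continuous_const.prodMk continuous_id)
  have hm := clampType_mem hab.le
  rw [OrderTopology.continuous_iff]
  refine fun y => ⟨?_, ?_⟩
  · have : (fun u => qFB (clampType a b u)) ⁻¹' Ioi y = {u | extend a b (costQ C) y u < 1} := by
      ext u
      rw [mem_preimage, mem_Ioi, mem_ofPred_eq]
      rcases le_or_gt 0 y with h | h
      · rw [extend_of_nonneg _ h, hFB.costQ_lt_one hC hab (hm u) h]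
      · refine iff_of_true (h.trans (hFB.pos hC hab (hm u))) ?_
        rw [extend, max_eq_right h.le, hC.costQ_zero _ (hm u)]
        exact one_pos
    rw [this]
    exact isOpen_lt (hk y) continuous_const
  · have : (fun u => qFB (clampType a b u)) ⁻¹' Iio y = {u | 1 < extend a b (costQ C) y u} := by
      ext u
      rw [mem_preimage, mem_Iio, mem_ofPred_eq]
      rcases le_or_gt 0 y with h | h
      · rw [extend_of_nonneg _ h, hFB.one_lt_costQ hC hab (hm u) h]
      · refine iff_of_false (not_lt.2 (h.le.trans (hFB.pos hC hab (hm u)).le)) ?_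
        rw [extend, max_eq_right h.le, hC.costQ_zero _ (hm u)]
        norm_num
    rw [this]
    exact isOpen_lt continuous_const (hk y)

lemma _root_.IsCost.convexOn (hC : IsCost a b C) (hab : a < b) (ht : t ∈ Icc a b) :
    ConvexOn ℝ (Ici 0) fun y => C y t := by
  have hd : ∀ x ∈ interior (Ici (0 : ℝ)), HasDerivAt (fun y => C y t) (costQ C x t) x := by
    intro x hx
    rw [interior_Ici] at hx
    exact (hC.hasDeriv_fst (le_of_lt hx) ht).hasDerivAt (Ici_mem_nhds hx)
  refine MonotoneOn.convexOn_of_deriv (convex_Ici 0)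
    (fun x hx => (hC.hasDeriv_fst hx ht).continuousWithinAt)
    (fun x hx => (hd x hx).differentiableAt.differentiableWithinAt) fun x hx y hy hxy => ?_
  rw [(hd x hx).deriv, (hd y hy).deriv]
  exact hC.costQ_mono hab ht (interior_subset hx) hxy

lemma _root_.IsCost.sub_eq_integral (hC : IsCost a b C) (hab : a < b) (hx : 0 ≤ x)
    (hu : u ∈ Icc a b) (ht : t ∈ Icc a b) :
    C x u - C x t = ∫ z in u..t, extend a b (marginalRent a b C) x z := by
  have hc : Continuous fun z => extend a b (marginalRent a b C) x z :=
    (RatingDesign.continuous_extend hab.le (g := marginalRent a b C)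
      (hC.continuousOn_costT hab).neg).comp
      (continuous_const.prodMk continuous_id)
  have key : ∀ u ∈ Icc a b, ∀ t ∈ Icc a b, u ≤ t →
      C x u - C x t = ∫ z in u..t, extend a b (marginalRent a b C) x z := by
    intro u hu t ht hut
    have hsub : Icc u t ⊆ Icc a b := Icc_subset_Icc hu.1 ht.2
    have := intervalIntegral.integral_eq_sub_of_hasDerivAt_of_le
      (f := fun s => - C x s) (f' := fun z => extend a b (marginalRent a b C) x z) hut
      (fun z hz => ((hC.hasDeriv_snd hx (hsub hz)).mono hsub).continuousWithinAt.neg)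
      (fun z hz => ?_) (hc.intervalIntegrable _ _)
    · rw [this]; ring
    · have hz' := hsub ⟨hz.1.le, hz.2.le⟩
      rw [extend_of_mem _ hx hz']
      exact (((hC.hasDeriv_snd hx hz').mono hsub).hasDerivAt (Icc_mem_nhds hz.1 hz.2)).neg
  rcases le_total u t with h | h
  · exact key u hu t ht h
  · rw [intervalIntegral.integral_symm, ← key t ht u hu h]; ring

end Marginal

/-- A cost function that satisfies the standing assumptions, with its first best, is a technology. -/
lemma _root_.IsCost.technology (hC : IsCost a b C) (hFB : IsFirstBest a b C qFB) (hab : a < b) :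
    Technology a b (extend a b C) (extend a b (marginalRent a b C))
      fun u => qFB (clampType a b u) := by
  have hm := clampType_mem hab.le
  refine
    { lt := hab
      cont_c := continuous_extend hab.le hC.smooth.continuousOn
      cont_h := continuous_extend hab.le (hC.continuousOn_costT hab).neg
      c_zero := fun u => by rw [extend_of_nonneg C le_rfl, hC.zero _ (hm u)]
      c_mono := fun u x y hx hxy => ?_
      c_lip := fun M => ?_
      c_convex := fun u x y r hx hy hr hr1 => ?_
      h_nonneg := fun u x hx => ?_
      h_mono := fun u x y hx hxy => ?_
      h_lip := fun M => ?_
      ftc := fun x hx u hu v hv => ?_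
      f_cont := hFB.continuous_extend hC hab
      f_mono := fun u v huv => hFB.monotoneOn hC hab (hm u) (hm v) (clampType_mono huv)
      f_pos := fun u => hFB.pos hC hab (hm u)
      s_lt_left := fun u x y hx hxy hy => ?_
      s_lt_right := fun u x y hx hxy => ?_
      s_quad := fun M => ?_ }
  · rw [extend_of_nonneg C hx, extend_of_nonneg C (hx.trans hxy)]
    exact le_of_derivWithin_nonneg (s := Ici 0) (fun _ hz => hC.hasDeriv_fst hz (hm u))
      (fun _ hz => hC.costQ_nonneg _ hz _ (hm u)) (fun _ hz => hx.trans hz.1) hxy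
  · obtain ⟨K, hK0, hK⟩ := exists_lipschitz isCompact_Icc (g := C) (g' := costQ C)
      (fun t ht x hx => hC.hasDeriv_fst hx ht) (hC.continuousOn_costQ hab) M
    refine ⟨K, hK0, fun u x y hx hxy hy => ?_⟩
    rw [extend_of_nonneg C hx, extend_of_nonneg C (hx.trans hxy)]
    exact (le_abs_self _).trans (hK _ (hm u) x y hx hxy hy)
  · have h1 : 0 ≤ 1 - r := sub_nonneg.2 hr1
    rw [extend_of_nonneg C hx, extend_of_nonneg C hy, extend_of_nonneg C (by positivity)]
    exact (hC.convexOn hab (hm u)).2 hx hy h1 hr (by ring)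
  · rw [extend_of_nonneg _ hx]
    exact neg_nonneg.2 (hC.costT_nonpos x hx _ (hm u))
  · rw [extend_of_nonneg _ hx, extend_of_nonneg _ (hx.trans hxy)]
    exact le_of_derivWithin_nonneg (s := Ici 0) (g := fun y => marginalRent a b C y _)
      (fun _ hz => (hC.hasDeriv_costT_costQT hab hz (hm u)).neg)
      (fun _ hz => neg_nonneg.2 (hC.costQT_nonpos _ hz _ (hm u))) (fun _ hz => hx.trans hz.1) hxy
  · obtain ⟨K, hK0, hK⟩ := exists_lipschitz isCompact_Icc (g := costT a b C) (g' := costQT a b C)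
      (fun t ht x hx => hC.hasDeriv_costT_costQT hab hx ht) (hC.continuousOn_costQT hab) M
    refine ⟨K, hK0, fun u x y hx hxy hy => ?_⟩
    rw [extend_of_nonneg _ hx, extend_of_nonneg _ (hx.trans hxy)]
    have := (neg_le_abs _).trans (hK _ (hm u) x y hx hxy hy)
    unfold marginalRent
    linarith
  · rw [extend_of_mem C hx hu, extend_of_mem C hx hv]
    exact hC.sub_eq_integral hab hx hu hv
  · rw [extend_of_nonneg C hx, extend_of_nonneg C (hx.trans hxy.le)]
    obtain ⟨ξ, hξ, h⟩ := exists_slope (s := Ici 0) (u := x) (v := y)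
      (fun _ hz => hC.hasDeriv_fst hz (hm u)) (fun _ hz => hx.trans hz.1) hxy
    have h1 := (hFB.costQ_lt_one hC hab (hm u) (hx.trans hξ.1.le)).2 (hξ.2.trans_le hy)
    nlinarith [mul_lt_mul_of_pos_right h1 (sub_pos.2 hxy)]
  · have hx0 : 0 ≤ x := (hFB.pos hC hab (hm u)).le.trans hx
    rw [extend_of_nonneg C hx0, extend_of_nonneg C (hx0.trans hxy.le)]
    obtain ⟨ξ, hξ, h⟩ := exists_slope (s := Ici 0) (u := x) (v := y)
      (fun _ hz => hC.hasDeriv_fst hz (hm u)) (fun _ hz => hx0.trans hz.1) hxy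
    have h1 := (hFB.one_lt_costQ hC hab (hm u) (hx0.trans hξ.1.le)).2 (hx.trans_lt hξ.1)
    nlinarith [mul_lt_mul_of_pos_right h1 (sub_pos.2 hxy)]
  -- `C_q` is Lipschitz in quality and equals one at the first best, so the mean value theorem gives
  -- a loss quadratic in the distance. The range up to `max M (qFB b)` contains both points.
  · obtain ⟨L, hL0, hL⟩ := exists_lipschitz isCompact_Icc (g := costQ C) (g' := costQQ C)
      (fun t ht x hx => hC.hasDeriv_costQ_costQQ hab hx ht) (hC.continuousOn_costQQ hab)
      (max M (qFB b))
    refine ⟨L, hL0, fun u y hy hyM => ?_⟩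
    set t := clampType a b u
    have ht : t ∈ Icc a b := hm u
    obtain ⟨hf0, hf1, _⟩ := hFB t ht
    have hfb : qFB t ≤ qFB b := hFB.monotoneOn hC hab ht ⟨hab.le, le_rfl⟩ ht.2
    rw [extend_of_nonneg C hf0, extend_of_nonneg C hy]
    change qFB t - C (qFB t) t - L * (y - qFB t) ^ 2 ≤ y - C y t
    rcases lt_trichotomy y (qFB t) with h1 | h1 | h1
    · obtain ⟨ξ, hξ, h⟩ := exists_slope (s := Ici 0) (u := y) (v := qFB t)
        (fun _ hz => hC.hasDeriv_fst hz ht) (fun _ hz => hy.trans hz.1) h1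
      have h2 := (le_abs_self _).trans
        (hL t ht ξ _ (hy.trans hξ.1.le) hξ.2.le (le_max_of_le_right hfb))
      rw [hf1] at h2
      have h3 := mul_le_mul_of_nonneg_left (show qFB t - ξ ≤ qFB t - y by linarith [hξ.1]) hL0
      have h4 := mul_le_mul_of_nonneg_right (h2.trans h3) (sub_pos.2 h1).le
      nlinarith
    · rw [h1]; simp
    · obtain ⟨ξ, hξ, h⟩ := exists_slope (s := Ici 0) (u := qFB t) (v := y)
        (fun _ hz => hC.hasDeriv_fst hz ht) (fun _ hz => hf0.trans hz.1) h1
      have h2 := (le_abs_self _).trans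
        (hL t ht _ ξ hf0 hξ.1.le ((hξ.2.le.trans hyM).trans (le_max_left _ _)))
      rw [hf1] at h2
      have h3 := mul_le_mul_of_nonneg_left (show ξ - qFB t ≤ y - qFB t by linarith [hξ.2]) hL0
      have h4 := mul_le_mul_of_nonneg_right (h2.trans h3) (sub_pos.2 h1).le
      nlinarith

lemma _root_.IsCost.strictTechnology (hC : IsCost a b C) (hFB : IsFirstBest a b C qFB)
    (hab : a < b) (hs : StrictlySubmodular a b C) :
    StrictTechnology a b (extend a b C) (extend a b (marginalRent a b C))
      fun u => qFB (clampType a b u) := by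
  have hm := clampType_mem hab.le
  refine ⟨hC.technology hFB hab, fun m M hm0 => ?_, fun u hu v hv huv => ?_⟩
  · rcases lt_or_ge M m with hmM | hmM
    · exact ⟨1, one_pos, fun u x y h1 h2 h3 => absurd ((h1.trans h2).trans h3) (not_le.2 hmM)⟩
    -- `C_qθ` attains its maximum on this compact rectangle, and the maximum is negative because `m
    -- > 0`.
    obtain ⟨z, hz, hmin⟩ := ((isCompact_Icc (a := m) (b := M)).prod
      (isCompact_Icc (a := a) (b := b))).exists_isMaxOn ⟨(m, a), ⟨⟨le_rfl, hmM⟩, le_rfl, hab.le⟩⟩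
      ((hC.continuousOn_costQT hab).mono (prod_mono_left fun x hx => hm0.le.trans hx.1))
    refine ⟨- costQT a b C z.1 z.2, neg_pos.2 (hs _ (hm0.trans_le hz.1.1) _ hz.2),
      fun u x y h1 h2 h3 => ?_⟩
    have hx : 0 ≤ x := hm0.le.trans h1
    rw [extend_of_nonneg _ hx, extend_of_nonneg _ (hx.trans h2)]
    rcases h2.eq_or_lt with rfl | h2
    · simp
    obtain ⟨ξ, hξ, h⟩ := exists_slope (s := Ici 0) (u := x) (v := y)
      (fun _ hz => hC.hasDeriv_costT_costQT hab hz (hm u)) (fun _ hz => hx.trans hz.1) h2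
    have h4 : costQT a b C ξ (clampType a b u) ≤ costQT a b C z.1 z.2 :=
      hmin (show (ξ, clampType a b u) ∈ Icc m M ×ˢ Icc a b from
        ⟨⟨h1.trans hξ.1.le, hξ.2.le.trans h3⟩, hm u⟩)
    have h5 := mul_le_mul_of_nonneg_right h4 (sub_pos.2 h2).le
    unfold marginalRent
    linarith
  · simp only [clampType_of_mem hu, clampType_of_mem hv]
    exact hFB.strictMonoOn hC hab hs hu hv huv

end Extension
end RatingDesign

/-! ### Feasible pairs and plans -/

namespace RatingDesign
open Filter Topology
noncomputable section Translation
set_option linter.unusedSectionVars false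

variable {a b p : ℝ} {C : ℝ → ℝ → ℝ} {qFB q qbar q' U w : ℝ → ℝ} {F : Measure ℝ}

lemma _root_.IsTypeLaw.nullSingletonClass (hF : IsTypeLaw a b F) : NullSingletonClass F := by
  have := hF.isProbabilityMeasure
  refine ⟨fun x => ?_⟩
  rw [← measure_cdf F, StieltjesFunction.measure_singleton,
    hF.continuous_cdf.continuousAt.continuousWithinAt.leftLim_eq, sub_self, ENNReal.ofReal_zero]

lemma _root_.IsTypeLaw.fullLaw (hF : IsTypeLaw a b F) : FullLaw a b F := by
  refine ⟨hF.support_eq ▸ Measure.measure_compl_support, fun u v hu huv hv => ?_⟩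
  obtain ⟨z, hz⟩ := exists_between huv
  have hzs : z ∈ F.support := hF.support_eq ▸ ⟨hu.trans hz.1.le, hz.2.le.trans hv⟩
  exact (Measure.mem_support_iff_forall z).1 hzs _ (Ioo_mem_nhds hz.1 hz.2)

/-- A non-integrable function has integral zero by convention, so mean one already contains
integrability. -/
lemma _root_.IsHumpShaped.hump (hw : IsHumpShaped a b F w p) : Hump a b F w p := by
  refine ⟨hw.peak_mem, hw.nonneg, hw.increasing, hw.decreasing, ?_⟩
  by_contra h
  exact zero_ne_one ((integral_undef h).symm.trans hw.mean_one)

section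

variable [NullSingletonClass F]

lemma majSlack_eq {t : ℝ} (ht : a ≤ t) :
    majSlack a F q qbar t = ∫ θ in a..t, (qbar θ - q θ) ∂F := by
  rw [majSlack, integral_Icc_eq_integral_Ioc, intervalIntegral.integral_of_le ht]

lemma FullLaw.integral_eq (hF : FullLaw a b F) (hab : a ≤ b) {g k : ℝ → ℝ}
    (h : ∀ θ ∈ Icc a b, g θ = k θ) : ∫ θ, g θ ∂F = ∫ θ in a..b, k θ ∂F := by
  have h1 : F.restrict (Icc a b) = F := Measure.restrict_eq_self_of_ae_mem hF.compl_null
  rw [intervalIntegral.integral_of_le hab, ← integral_Icc_eq_integral_Ioc,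
    ← setIntegral_congr_fun measurableSet_Icc h, h1]

lemma FullLaw.map_eq (hF : FullLaw a b F) (h : ∀ θ ∈ Icc a b, q θ = q' θ) :
    F.map q = F.map q' :=
  Measure.map_congr (mem_of_superset (show Icc a b ∈ ae F from hF.compl_null) h)

lemma _root_.Implements.congr {S : Type*} [MeasurableSpace S] {π : Kernel ℝ S}
    (hπ : Implements a b F q' qbar π) (hF : FullLaw a b F) (h : ∀ θ ∈ Icc a b, q θ = q' θ) :
    Implements a b F q qbar π := by
  obtain ⟨P, hP, hP'⟩ := hπ
  refine ⟨P, ?_, fun t ht => ?_⟩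
  · unfold IsPrice at hP ⊢
    rwa [hF.map_eq h]
  · rw [h t ⟨ht.1.le, ht.2.le⟩]
    exact hP' t ht

end

variable [IsProbabilityMeasure F] [NullSingletonClass F]

/-- A feasible pair of qualities and prices, extended to all reals, is a plan. -/
lemma _root_.IsFeasible.exists_plan (hfeas : IsFeasible a b C F q qbar)
    (T : Technology a b (extend a b C) (extend a b (marginalRent a b C)) fun u =>
      qFB (clampType a b u)) :
    ∃ U, Plan a b (extend a b C) (extend a b (marginalRent a b C)) F
      (fun θ => q (clampType a b θ)) U ∧ (∀ θ ∈ Icc a b, U θ = profit C q qbar θ) ∧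
      ∀ θ ∈ Icc a b, excess (extend a b C) (fun θ => q (clampType a b θ)) U θ = qbar θ - q θ := by
  have hab := T.lt.le
  have hm := clampType_mem hab
  set qe : ℝ → ℝ := fun θ => q (clampType a b θ) with hqe
  have hq : Monotone qe := fun u v huv => hfeas.mono_q (hm u) (hm v) (clampType_mono huv)
  have hq0 : ∀ u, 0 ≤ qe u := fun u => hfeas.nonneg _ (hm u)
  have hqeq : ∀ θ ∈ Icc a b, qe θ = q θ := fun θ hθ => by simp only [hqe, clampType_of_mem hθ]
  have hc : ∀ s ∈ Icc a b, ∀ t ∈ Icc a b, extend a b C (qe s) t = C (q s) t := fun s hs t ht => by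
    rw [extend_of_mem C (hq0 s) ht, hqeq s hs]
  have haI : a ∈ Icc a b := ⟨le_rfl, hab⟩
  set U : ℝ → ℝ := fun θ =>
    profit C q qbar a + ∫ z in a..θ, extend a b (marginalRent a b C) (qe z) z with hU
  have S := Schedule.of_rent T hq hq0 (profit C q qbar a) a
  have hprofit : ∀ θ ∈ Icc a b, U θ = profit C q qbar θ := by
    intro θ hθ
    have := T.envelope (p := qbar) hq hq0 (fun t ht s hs => by
      rw [hc s hs t ht, hc t ht t ht]; exact hfeas.incentive t ht s hs) haI hθ hθ.1
    rw [hc θ hθ θ hθ, hc a haI a haI] at this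
    simp only [hU, ← this, profit]
    ring
  have hex : ∀ θ ∈ Icc a b, excess (extend a b C) qe U θ = qbar θ - q θ := by
    intro θ hθ
    rw [excess, surplus, hprofit θ hθ, hc θ hθ θ hθ, hqeq θ hθ, profit]
    ring
  have hslack : ∀ t ∈ Icc a b, ∫ θ in a..t, excess (extend a b C) qe U θ ∂F =
      majSlack a F q qbar t := fun t ht => by
    rw [majSlack_eq ht.1]
    exact integral_congr_Ioo ht.1 fun z hz => hex z ⟨hz.1.le, hz.2.le.trans ht.2⟩
  refine ⟨U, ⟨S, ?_, fun t ht => ?_, ?_⟩, hprofit, hex⟩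
  · rw [hprofit a haI]
    exact hfeas.participation a haI
  · rw [hslack t ht]
    exact hfeas.majorizes.1 t ht
  · rw [hslack b ⟨hab, le_rfl⟩]
    exact hfeas.majorizes.2

/-- A plan restricts to a feasible pair of qualities and prices. -/
lemma Plan.isFeasible {h : ℝ → ℝ → ℝ} {f : ℝ → ℝ} (P : Plan a b (extend a b C) h F q U)
    (T : Technology a b (extend a b C) h f) :
    IsFeasible a b C F q fun θ => U θ + C (q θ) θ := by
  have hab := T.lt.le
  have hc : ∀ s, ∀ t ∈ Icc a b, extend a b C (q s) t = C (q s) t := fun s t ht =>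
    extend_of_mem C (P.nonneg s) ht
  have hinc : ∀ t ∈ Icc a b, ∀ s ∈ Icc a b, U s + C (q s) s - C (q s) t ≤ U t := by
    intro t ht s hs
    rw [← hc s s hs, ← hc s t ht]
    exact T.incentive_of_envelope P.mono P.nonneg (fun u _ v _ _ => P.env u v) ht hs
  have hslack : ∀ t ∈ Icc a b, majSlack a F q (fun θ => U θ + C (q θ) θ) t =
      ∫ θ in a..t, excess (extend a b C) q U θ ∂F := fun t ht => by
    rw [majSlack_eq ht.1]
    refine integral_congr_Ioo ht.1 fun z hz => ?_
    rw [excess, surplus, hc z z ⟨hz.1.le, hz.2.le.trans ht.2⟩]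
    ring
  refine ⟨fun t _ => P.nonneg t, P.mono.monotoneOn _, fun u hu v hv huv => ?_, fun t ht s hs => ?_,
    fun t ht => ?_, fun t ht => ?_, ?_⟩
  · have h1 := hinc v hv u hu
    have h2 := T.c_mono v _ _ (P.nonneg u) (P.mono huv)
    rw [hc u v hv, hc v v hv] at h2
    linarith
  · simp only [profit, add_sub_cancel_right]
    exact hinc t ht s hs
  · simp only [profit, add_sub_cancel_right]
    exact P.part.trans (P.profit_mono T ht.1)
  · rw [hslack t ht]
    exact P.slack t ht
  · rw [hslack b ⟨hab, le_rfl⟩]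
    exact P.balance

/-- Every competing plan restricts to a feasible pair with the same profits on `[a, b]`, so
optimality carries over. -/
lemma _root_.IsOptimal.exists_optimalPlan (hopt : IsOptimal a b C F w q qbar) (hF : FullLaw a b F)
    (T : Technology a b (extend a b C) (extend a b (marginalRent a b C)) fun u =>
      qFB (clampType a b u)) :
    ∃ U, OptimalPlan a b (extend a b C) (extend a b (marginalRent a b C)) F w
      (fun θ => q (clampType a b θ)) U ∧
      ∀ θ ∈ Icc a b, excess (extend a b C) (fun θ => q (clampType a b θ)) U θ = qbar θ - q θ := by
  obtain ⟨U, P, hU, hex⟩ := hopt.1.exists_plan T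
  refine ⟨U, ⟨P, fun q' U' P' => ?_⟩, hex⟩
  have h1 := hopt.2 _ _ (P'.isFeasible T)
  unfold welfare at h1
  rwa [hF.integral_eq T.lt.le (k := fun θ => w θ * U' θ) fun θ _ => by
      simp only [profit, add_sub_cancel_right],
    hF.integral_eq T.lt.le (k := fun θ => w θ * U θ) fun θ hθ => by rw [hU θ hθ]] at h1

/-- A feasible pair is implemented by a rating system that announces quality with some probability,
provided that prices lie between quality and a pooling price. -/
lemma _root_.IsFeasible.exists_rating (hfeas : IsFeasible a b C F q qbar) (hF : FullLaw a b F)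
    (hab : a ≤ b) {k r : ℝ} (hk : ∀ θ ∈ Ioo a b, (0 < qbar θ - q θ → qbar θ ≤ k) ∧
      (qbar θ - q θ < 0 → k ≤ qbar θ)) (hr : r ∈ Icc (0 : ℝ) 1) :
    ∃ (α : ℝ → ℝ) (hα : Measurable α), (∀ x, α x ∈ Icc (0 : ℝ) 1) ∧
      Implements a b F q qbar (mixKernel α hα) ∧
      (∀ θ ∈ Ioo a b, q θ ≠ k → qbar θ - q θ = 0 → α (q θ) = 1) ∧
      (∀ θ ∈ Ioo a b, qbar θ - q θ ≠ 0 → α (q θ) < 1) ∧ α k = r := by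
  have hm := clampType_mem hab
  have hI : ∀ θ ∈ Ioo a b, θ ∈ Icc a b := fun θ hθ => ⟨hθ.1.le, hθ.2.le⟩
  have hqe : ∀ θ ∈ Icc a b, q θ = q (clampType a b θ) := fun θ hθ => by rw [clampType_of_mem hθ]
  -- Types with equal qualities receive equal prices, as otherwise one would imitate the other; the
  -- price is thus a function of quality.
  have hle : ∀ θ ∈ Icc a b, ∀ θ' ∈ Icc a b, q θ = q θ' → qbar θ ≤ qbar θ' := by
    intro θ hθ θ' hθ' h
    have := hfeas.incentive θ' hθ' θ hθ
    rw [profit, h] at this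
    linarith
  obtain ⟨α, hα, h01, himp, hone, hlt, hr⟩ := RatingDesign.exists_rating (F := F) (qbar := qbar)
    (q := fun θ => q (clampType a b θ)) (P := k) hab hF.compl_null
    (fun u v huv => hfeas.mono_q (hm u) (hm v) (clampType_mono huv)) hfeas.mono_qbar
    (fun θ hθ θ' hθ' h => by
      rw [← hqe θ (hI θ hθ), ← hqe θ' (hI θ' hθ')] at h
      exact le_antisymm (hle θ (hI θ hθ) θ' (hI θ' hθ') h) (hle θ' (hI θ' hθ') θ (hI θ hθ) h.symm))
    (fun θ hθ => by
      rw [← hqe θ (hI θ hθ)]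
      exact ⟨fun h => (hk θ hθ).1 (sub_pos.2 h), fun h => (hk θ hθ).2 (sub_neg.2 h)⟩)
    (by
      rw [← hfeas.majorizes.2, majSlack_eq hab]
      exact integral_congr_Ioo hab fun z hz => by rw [← hqe z (hI z hz)]) hr
  refine ⟨α, hα, h01, himp.congr hF hqe, fun θ hθ h1 h2 => ?_, fun θ hθ h1 => ?_, hr⟩
  · have := hone θ hθ
    rw [← hqe θ (hI θ hθ)] at this
    exact this h1 (sub_eq_zero.1 h2)
  · have := hlt θ hθ
    rw [← hqe θ (hI θ hθ)] at this
    exact this fun h => h1 (sub_eq_zero.2 h)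

end Translation
end RatingDesign

/-! ### Assembly of the proposition -/

open RatingDesign

theorem mainTheorem7 (a b : ℝ) (C : ℝ → ℝ → ℝ) (hC : IsCost a b C)
    (qFB : ℝ → ℝ) (hFB : IsFirstBest a b C qFB)
    (F : MeasureTheory.Measure ℝ) (hF : IsTypeLaw a b F)
    (w : ℝ → ℝ) (θstar : ℝ) (hw : IsHumpShaped a b F w θstar)
    (q qbar : ℝ → ℝ) (hopt : IsOptimal a b C F w q qbar) :
    ∃ θhat θtilde : ℝ, a ≤ θhat ∧ θhat ≤ θtilde ∧ θtilde < θstar ∧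
      (∀ t ∈ Set.Ioc a θhat, q t = qFB t) ∧
      (∀ t ∈ Set.Ico θhat θtilde, a < t → q t = qFB θhat) ∧
      ∃ (π : ProbabilityTheory.Kernel ℝ Signal) (α : ℝ → ℝ),
        ProbabilityTheory.IsMarkovKernel π ∧
        Implements a b F q qbar π ∧
        (∀ t ∈ Set.Ioo a θtilde, π (q t) = MeasureTheory.Measure.dirac (Sum.inl (q t))) ∧
        (∀ t ∈ Set.Ioo θtilde b, α (q t) ∈ Set.Icc (0 : ℝ) 1 ∧
          π (q t) = mixSignal (α (q t)) (q t)) ∧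
        (StrictlySubmodular a b C →
          ∀ t ∈ Set.Ioo θtilde b, 0 < majSlack a F q qbar t ∧ α (q t) < 1) := by
  have := hF.isProbabilityMeasure
  have := hF.nullSingletonClass
  have hab : a < b := hw.peak_mem.1.trans hw.peak_mem.2
  have T := hC.technology hFB hab
  obtain ⟨U, O, hex⟩ := hopt.exists_optimalPlan hF.fullLaw T
  have hI : ∀ θ ∈ Ioo a b, θ ∈ Icc a b := fun θ hθ => ⟨hθ.1.le, hθ.2.le⟩
  have hqe : ∀ θ ∈ Icc a b, q (clampType a b θ) = q θ := fun θ hθ => by rw [clampType_of_mem hθ]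
  by_cases hs : StrictlySubmodular a b C
  · obtain ⟨s, hsI, hfb, hzero, hslack, k, hk, hkeq, hkne⟩ :=
      O.exists_strict_pooling (hC.strictTechnology hFB hab hs) hF.fullLaw hw.hump (by
        refine hopt.1.mono_qbar.congr fun θ hθ => ?_
        rw [hex θ hθ, hqe θ hθ]
        ring)
    have hsb := hsI.2.trans hw.peak_mem.2
    have hl : ∀ θ ∈ Ioo a s, θ ∈ Ioo a b := fun θ hθ => ⟨hθ.1, hθ.2.trans hsb⟩
    have hu : ∀ θ ∈ Ioo s b, θ ∈ Ioo a b := fun θ hθ => ⟨hsI.1.trans_lt hθ.1, hθ.2⟩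
    -- The choice `r = 0` lets types whose quality is the pooling price send only the generic
    -- signal.
    obtain ⟨α, hα, h01, himp, hone, hlt, hα0⟩ := hopt.1.exists_rating hF.fullLaw hab.le (k := k)
      (fun θ hθ => by
        have := hk θ hθ
        rwa [hex θ (hI θ hθ), hqe θ (hI θ hθ), add_sub_cancel] at this) (r := 0)
      ⟨le_rfl, zero_le_one⟩
    -- Both thresholds are `s`, so the interval of constant quality is empty.
    refine ⟨s, s, hsI.1, le_rfl, hsI.2, fun t ht => ?_, fun t ht => absurd ht.2 (not_lt.2 ht.1),
      mixKernel α hα, α, isMarkovKernel_mixKernel hα h01, himp, fun t ht => ?_,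
      fun t _ => ⟨h01 _, rfl⟩, fun _ t ht => ⟨?_, ?_⟩⟩
    · have h1 := hfb t ht
      have h2 : t ∈ Icc a b := ⟨ht.1.le, ht.2.trans hsb.le⟩
      simpa only [clampType_of_mem h2] using h1
    · have h2 := hI t (hl t ht)
      have h3 := hkne t ht
      have h4 := hzero t ht
      rw [hqe t h2] at h3
      rw [hex t h2] at h4
      change mixSignal (α (q t)) (q t) = _
      rw [hone t (hl t ht) h3 h4, mixSignal_one]
    · rw [majSlack_eq (hu t ht).1.le]
      have h1 := hslack t ht
      rwa [integral_congr_Ioo (hu t ht).1.le fun z hz => hex z ⟨hz.1.le, (hz.2.trans ht.2).le⟩] at h1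
    · have h2 := hI t (hu t ht)
      by_cases h3 : qbar t - q t = 0
      · have h4 := hkeq t ht
        rw [hex t h2, hqe t h2] at h4
        rw [h4 h3, hα0]
        exact one_pos
      · exact hlt t (hu t ht) h3
  -- With both thresholds at `a` the claims about lower types are vacuous, and only implementation
  -- by full mixing is left. The value of `r` is immaterial here.
  · obtain ⟨t, τ, σ, x, _, _, _, P, _⟩ := O.exists_pattern T hF.fullLaw hw.hump
    obtain ⟨k, hk⟩ := exists_pooling_price (D := fun θ => qbar θ - q θ) hopt.1.mono_qbar
      fun u v hu hv huv h => by
        have huI := hI u ⟨hu, huv.trans hv⟩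
        have hvI := hI v ⟨hu.trans huv, hv⟩
        have h1 := P.single_crossing O.toSchedule T hu hv huv
        rw [hex u huI, hex v hvI] at h1
        exact h1 h
    obtain ⟨α, hα, h01, himp, _⟩ := hopt.1.exists_rating hF.fullLaw hab.le hk (r := 1)
      ⟨zero_le_one, le_rfl⟩
    exact ⟨a, a, le_rfl, le_rfl, hw.peak_mem.1, fun t ht => absurd ht.1 (not_lt.2 ht.2),
      fun t ht => absurd ht.2 (not_lt.2 ht.1), mixKernel α hα, α, isMarkovKernel_mixKernel hα h01,
      himp, fun t ht => absurd (ht.1.trans ht.2) (lt_irrefl _), fun t _ => ⟨h01 _, rfl⟩,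
      fun h => absurd h hs⟩
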